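/- **Conventions.** 2-categories are strict and small. For a 2-category $\mathscr C$, the (Duskin) nerve $\mathscr{NC}$ is the simplicial set whose $n$-simplices are the lax functors $[n]\to\mathscr C$ that strictly preserve identities: objects $x_i$, maps $f_{ij}\colon x_i\to x_j$ and 2-cells $f_{jk}\circ f_{ij}\Rightarrow f_{ik}$ (*lax triangles*), unital and associative. The upper décalage $\mathrm{dec}_\top X$ of a simplicial set $X$ is $(\mathrm{dec}_\top X)_n=X_{n+1}$, without the top face and degeneracy maps. A *unary operadic 2-category* $\mathbb O=(X,\mathscr C)$ is a simplicial set $X$ and a 2-category $\mathscr C$ with an isomorphism $\mathrm{dec}_\top X\cong\mathscr{NC}$. So $X_1$, $X_2$, $X_3$ are the sets of objects, maps and lax triangles of $\mathscr C$; $\pi_0(\mathbb O)$ is the set of connected components of $\mathscr C$ (in bijection with $X_0$). An *operadic functor* is a map of the simplicial sets. For $x\in X_1$ put $\pi(x)=d_0x$, $\phi(x)=d_1x$, $\mathbb 1_x=s_0x$, $u_x=s_1x$; for $c\in X_0$ put $u_c=s_0c$; for $f\in X_2$ (a map $d_1f\to d_0f$) the fiber is $\phi(f)=d_2f$; for $t\in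 X_3$ it is $\phi(t)=d_3t$. A *categorical $\mathbb O$-operad* $P$ consists of small categories $P_x$ ($x\in X_1$), functors $P_f\colon P_{d_0f}\times P_{d_2f}\to P_{d_1f}$, written $(a,b)\mapsto a\cdot_f b$ ($f\in X_2$), and objects $e_c\in P_{u_c}$ ($c\in X_0$), such that, as equalities of functors, $(a\cdot_{d_0t}b)\cdot_{d_2t}c=a\cdot_{d_1t}(b\cdot_{d_3t}c)$ for $t\in X_3$, and $a\cdot_{\mathbb 1_x}e_{\phi(x)}=a=e_{\pi(x)}\cdot_{u_x}a$ for $x\in X_1$. The *operadic Grothendieck construction* $\int_{\mathbb O}P$ has as $n$-simplices an $n$-simplex $b$ of $X$ with objects $a_{ij}\in P_{b_{ij}}$ ($i<j$) and maps $\gamma_{ijk}\colon a_{jk}\cdot_{b_{ijk}}a_{ij}\to a_{ik}$ ($i<j<k$) such that $\gamma_{ijl}\circ(\gamma_{jkl}\cdot a_{ij})=\gamma_{ikl}\circ(a_{kl}\cdot\gamma_{ijk})$ for $i<j<k<l$; this is extended to degenerate edges and triangles by the units $e_c$ and by identities. Thus its objects are pairs $(A,a)$ with $a\in P_A$, its maps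 $(A,a)\to(B,b)$ are triples $(f,p,\alpha)$ with $f\colon A\to B$, $p\in P_{\phi(f)}$, $\alpha\colon b\cdot_fp\to a$, and $\phi(f,p,\alpha)=(\phi(f),p)$. The projection $\pi_P\colon\int_{\mathbb O}P\to\mathbb O$ forgets the $a_{ij}$ and $\gamma_{ijk}$. Let $p\colon X\to Y$ be an operadic functor. A map $f\in X_2$ is *operadic $p$-cartesian* if for every horn $\lambda\colon\Lambda^3_2\to X$ with $d_0\lambda=f$ and every filler $\sigma$ of $p\lambda$ there is a unique filler $\tilde\sigma$ of $\lambda$ with $p\tilde\sigma=\sigma$. The functor $p$ is an *operadic fibration* if it is surjective on connected components and for all $a,b\in X_1$, $g\in Y_2$ with $d_0g=p(a)$, $d_2g=p(b)$ there is an operadic $p$-cartesian $\tilde g\in X_2$ with $p(\tilde g)=g$, $d_0\tilde g=a$, $d_2\tilde g=b$. It is *split* if it is equipped with a choice $\ell(a,b,g)$ of such lifts satisfying * $\ell(u_{\pi(x)},x,u_{p(x)})=u_x$ and $\ell(x,u_{\phi(x)},\mathbb 1_{p(x)})=\mathbb 1_x$ for all $x\in X_1$; * for all $s\in Y_3$ and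 $x,y,z\in X_1$ with $s_{01}=p(x)$, $s_{12}=p(y)$, $s_{23}=p(z)$, the lifts $\ell(d_1\ell(z,y,s_{123}),x,s_{013})$ and $\ell(z,d_1\ell(y,x,s_{012}),s_{023})$ have the same source $d_1$, and, together with $\ell(z,y,s_{123})$ and $\ell(y,x,s_{012})$, they are the faces $d_2,d_1,d_0,d_3$ of a $3$-simplex of $X$ over $s$. **Proposition.** Let $\mathbb O$ be a unary operadic 2-category and $P$ a categorical $\mathbb O$-operad. Then $\int_{\mathbb O}P$ is a unary operadic 2-category and $\pi_P\colon\int_{\mathbb O}P\to\mathbb O$ is a split operadic fibration. The chosen cartesian lift of $f\colon A\to B$ with target $(B,a)$ and fiber $(\phi(f),b)$ is $(f,b,\mathbb 1_{a\cdot_fb})\colon(A,a\cdot_fb)\to(B,a)$. -/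

import Mathlib

open CategoryTheory Simplicial Opposite

universe u

/-! ## Upper décalage -/

/-- The monotone map `[m+1] → [n+1]` which extends `θ : [m] → [n]` by sending top to top. -/
def extendTopFun {m n : ℕ} (θ : Fin (m + 1) →o Fin (n + 1)) : Fin (m + 2) →o Fin (n + 2) where
  toFun := Fin.lastCases (Fin.last (n + 1)) (fun i => (θ i).castSucc)
  monotone' := by
    intro i j hij
    induction j using Fin.lastCases with
    | last => simpa using Fin.le_last _
    | cast j =>
      induction i using Fin.lastCases with
      | last => exact absurd hij (not_le.mpr (Fin.castSucc_lt_last j))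
      | cast i => simpa using θ.monotone (by simpa using hij)

@[simp]
theorem extendTopFun_last {m n : ℕ} (θ : Fin (m + 1) →o Fin (n + 1)) :
    extendTopFun θ (Fin.last (m + 1)) = Fin.last (n + 1) :=
  Fin.lastCases_last (motive := fun _ => Fin (n + 2))

@[simp]
theorem extendTopFun_castSucc {m n : ℕ} (θ : Fin (m + 1) →o Fin (n + 1)) (i : Fin (m + 1)) :
    extendTopFun θ i.castSucc = (θ i).castSucc :=
  Fin.lastCases_castSucc (motive := fun _ => Fin (n + 2)) i

theorem extendTopFun_id (n : ℕ) :
    extendTopFun (OrderHom.id : Fin (n + 1) →o Fin (n + 1)) = OrderHom.id := by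
  ext i : 2
  induction i using Fin.lastCases <;> simp

theorem extendTopFun_comp {l m n : ℕ} (θ : Fin (m + 1) →o Fin (n + 1))
    (η : Fin (l + 1) →o Fin (m + 1)) :
    extendTopFun (θ.comp η) = (extendTopFun θ).comp (extendTopFun η) := by
  ext i : 2
  induction i using Fin.lastCases <;> simp

/-- The endofunctor `[n] ↦ [n+1]` of the simplex category, adjoining a new top element. -/
def addTop : SimplexCategory ⥤ SimplexCategory where
  obj d := ⦋d.len + 1⦌
  map θ := SimplexCategory.Hom.mk (extendTopFun θ.toOrderHom)
  map_id d := congrArg SimplexCategory.Hom.mk (extendTopFun_id d.len)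
  map_comp f g := congrArg SimplexCategory.Hom.mk (extendTopFun_comp g.toOrderHom f.toOrderHom)

/-- The upper décalage: `(dec X)_n = X_{n+1}`, forgetting the top face and degeneracy maps. -/
def dec (X : SSet.{u}) : SSet.{u} := addTop.op ⋙ X

/-- The upper décalage of a simplicial map. -/
def decMap {X Y : SSet.{u}} (p : X ⟶ Y) : dec X ⟶ dec Y := Functor.whiskerLeft addTop.op p

/-! ## The Duskin nerve of a 2-category -/

section Nerve

open Bicategory

/-- An `n`-simplex of the Duskin nerve, that is, a lax functor from the poset `[n]` to `C` which
strictly preserves identities: objects `x i`, maps `f i j : x i ⟶ x j` for `i ≤ j`, and lax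
triangles `f i j ≫ f j k ⟶ f i k`, with `f i i = 𝟙`, unital and associative. -/
@[ext]
structure DuskinSimplex (C : Type u) [Bicategory.{u, u} C] (d : SimplexCategory) where
  obj : Fin (d.len + 1) → C
  hom : ∀ {i j : Fin (d.len + 1)}, i ≤ j → (obj i ⟶ obj j)
  tri : ∀ {i j k : Fin (d.len + 1)} (hij : i ≤ j) (hjk : j ≤ k),
    hom hij ≫ hom hjk ⟶ hom (hij.trans hjk)
  hom_refl : ∀ i, hom (le_refl i) = 𝟙 (obj i)
  tri_refl_left : ∀ {i j : Fin (d.len + 1)} (hij : i ≤ j),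
    tri (le_refl i) hij = eqToHom (hom_refl i) ▷ hom hij ≫ (λ_ (hom hij)).hom
  tri_refl_right : ∀ {i j : Fin (d.len + 1)} (hij : i ≤ j),
    tri hij (le_refl j) = hom hij ◁ eqToHom (hom_refl j) ≫ (ρ_ (hom hij)).hom
  cocycle : ∀ {i j k l : Fin (d.len + 1)} (hij : i ≤ j) (hjk : j ≤ k) (hkl : k ≤ l),
    tri hij hjk ▷ hom hkl ≫ tri (hij.trans hjk) hkl =
      (α_ (hom hij) (hom hjk) (hom hkl)).hom ≫
        hom hij ◁ tri hjk hkl ≫ tri hij (hjk.trans hkl)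

/-- Restriction of a simplex of the nerve along a monotone map. -/
def DuskinSimplex.restrict {C : Type u} [Bicategory.{u, u} C] {d d' : SimplexCategory}
    (s : DuskinSimplex C d) (θ : d' ⟶ d) : DuskinSimplex C d' where
  obj i := s.obj (θ.toOrderHom i)
  hom h := s.hom (θ.toOrderHom.monotone h)
  tri h h' := s.tri (θ.toOrderHom.monotone h) (θ.toOrderHom.monotone h')
  hom_refl _ := s.hom_refl _
  tri_refl_left _ := s.tri_refl_left _
  tri_refl_right _ := s.tri_refl_right _
  cocycle _ _ _ := s.cocycle _ _ _

/-- The Duskin nerve of a 2-category. -/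
def duskinNerve (C : Type u) [Bicategory.{u, u} C] : SSet.{u} where
  obj d := DuskinSimplex C d.unop
  map θ := ↾fun s => s.restrict θ.unop
  map_id _ := rfl
  map_comp _ _ := rfl

end Nerve

/-! ## Unary operadic 2-categories -/

/-- The structure of a unary operadic 2-category `(X, C)` on a simplicial set `X`: a strict
2-category `C` together with an isomorphism between the upper décalage of `X` and the nerve
of `C`. Operadic functors are the maps of the underlying simplicial sets. Thus `X_1` is the set of
objects of `C`, `X_2` is the set of maps of `C`, and `X_3` is the set of lax triangles of `C`. -/
structure UnaryOperadicStructure (X : SSet.{u}) where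
  C : Type u
  [bicategory : Bicategory.{u, u} C]
  [strict : Bicategory.Strict C]
  iso : dec X ≅ duskinNerve C

/-! ## Categorical operads -/

/-- The data of a categorical operad: small categories `P_x` for the objects `x ∈ X_1`, functors
`P_{d_0 f} × P_{d_2 f} ⥤ P_{d_1 f}` for the maps `f ∈ X_2`, and units `e_c ∈ P_{u_c}` for
`c ∈ X_0`, with `u_c = s_0 c`. -/
structure CategoricalOperadData (X : SSet.{u}) where
  cat : X _⦋1⦌ → Type u
  [category : ∀ x, SmallCategory (cat x)]
  comp : ∀ f : X _⦋2⦌, cat (X.δ 0 f) × cat (X.δ 2 f) ⥤ cat (X.δ 1 f)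
  unit : ∀ c : X _⦋0⦌, cat (X.σ 0 c)

attribute [instance] CategoricalOperadData.category

namespace CategoricalOperadData

variable {X : SSet.{u}} (P : CategoricalOperadData X)

/-- The functor `P_f`, with the faces of `f` given up to propositional equality. -/
def mul (f : X _⦋2⦌) {x y z : X _⦋1⦌} (hx : X.δ 0 f = x) (hy : X.δ 2 f = y) (hz : X.δ 1 f = z) :
    P.cat x × P.cat y ⥤ P.cat z :=
  match x, y, z, hx, hy, hz with
  | _, _, _, rfl, rfl, rfl => P.comp f

/-- The unit `e_c`, with the object `u_c` given up to propositional equality. -/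
def unitAt (c : X _⦋0⦌) {x : X _⦋1⦌} (hx : X.σ 0 c = x) : P.cat x :=
  match x, hx with
  | _, rfl => P.unit c

end CategoricalOperadData

section SimplicialIdentities

variable {X : SSet.{u}}

theorem δ_two_σ_zero (x : X _⦋1⦌) : X.δ 2 (X.σ 0 x) = X.σ 0 (X.δ 1 x) :=
  SSet.δ_comp_σ_of_gt_apply (i := (1 : Fin 2)) (j := (0 : Fin 1)) (by decide) x

theorem δ_zero_σ_one (x : X _⦋1⦌) : X.δ 0 (X.σ 1 x) = X.σ 0 (X.δ 0 x) :=
  SSet.δ_comp_σ_of_le_apply (i := (0 : Fin 2)) (j := (0 : Fin 1)) (by decide) x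

end SimplicialIdentities

/-- A categorical operad over (the underlying simplicial set of) a unary operadic 2-category. For a
lax triangle `t ∈ X_3` with `g = d_0 t`, `h = d_1 t`, `f = d_2 t` and fiber `φ(t) = d_3 t`,
associativity reads `(a ·_g b) ·_f c = a ·_h (b ·_{φ(t)} c)`, as an equality of functors. For an
object `x`, with `𝟙_x = s_0 x`, `u_x = s_1 x`, `φ(x) = d_1 x` and `π(x) = d_0 x`, the unit laws read
`a ·_{𝟙_x} e_{φ(x)} = a` and `e_{π(x)} ·_{u_x} a = a`. -/
structure CategoricalOperad (X : SSet.{u}) extends CategoricalOperadData X where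
  assoc : ∀ (t : X _⦋3⦌) {x y z xy yz xyz : X _⦋1⦌}
    (h₀ : X.δ 0 (X.δ 0 t) = x) (h₁ : X.δ 2 (X.δ 0 t) = y) (h₂ : X.δ 1 (X.δ 0 t) = xy)
    (h₃ : X.δ 0 (X.δ 2 t) = xy) (h₄ : X.δ 2 (X.δ 2 t) = z) (h₅ : X.δ 1 (X.δ 2 t) = xyz)
    (h₆ : X.δ 0 (X.δ 3 t) = y) (h₇ : X.δ 2 (X.δ 3 t) = z) (h₈ : X.δ 1 (X.δ 3 t) = yz)
    (h₉ : X.δ 0 (X.δ 1 t) = x) (h₁₀ : X.δ 2 (X.δ 1 t) = yz) (h₁₁ : X.δ 1 (X.δ 1 t) = xyz),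
    (toCategoricalOperadData.mul (X.δ 0 t) h₀ h₁ h₂).prod (𝟭 (cat z)) ⋙
        toCategoricalOperadData.mul (X.δ 2 t) h₃ h₄ h₅ =
      prod.associator (cat x) (cat y) (cat z) ⋙
        (𝟭 (cat x)).prod (toCategoricalOperadData.mul (X.δ 3 t) h₆ h₇ h₈) ⋙
          toCategoricalOperadData.mul (X.δ 1 t) h₉ h₁₀ h₁₁
  mul_unit : ∀ (x : X _⦋1⦌) (h₀ : X.δ 0 (X.σ 0 x) = x) (h₁ : X.δ 1 (X.σ 0 x) = x),
    (𝟭 (cat x)).prod' ((Functor.const (cat x)).obj (unit (X.δ 1 x))) ⋙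
        toCategoricalOperadData.mul (X.σ 0 x) h₀ (δ_two_σ_zero x) h₁ = 𝟭 (cat x)
  unit_mul : ∀ (x : X _⦋1⦌) (h₁ : X.δ 1 (X.σ 1 x) = x) (h₂ : X.δ 2 (X.σ 1 x) = x),
    ((Functor.const (cat x)).obj (unit (X.δ 0 x))).prod' (𝟭 (cat x)) ⋙
        toCategoricalOperadData.mul (X.σ 1 x) (δ_zero_σ_one x) h₂ h₁ = 𝟭 (cat x)

/-! ## Edges and triangles of a simplex -/

section Faces

variable {X : SSet.{u}} {d d' : SimplexCategory}

/-- The vertex `i` of a simplex. -/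
def vertex (b : X.obj (op d)) (i : Fin (d.len + 1)) : X _⦋0⦌ :=
  X.map (SimplexCategory.const ⦋0⦌ d i).op b

/-- The edge `i ≤ j` of a simplex. -/
def edge (b : X.obj (op d)) {i j : Fin (d.len + 1)} (hij : i ≤ j) : X _⦋1⦌ :=
  X.map (SimplexCategory.mkOfLe i j hij : ⦋1⦌ ⟶ d).op b

/-- The triangle `i ≤ j ≤ k` of a simplex. -/
def triangle (b : X.obj (op d)) {i j k : Fin (d.len + 1)} (hij : i ≤ j) (hjk : j ≤ k) : X _⦋2⦌ :=
  X.map (SimplexCategory.mkOfLeComp i j k hij hjk : ⦋2⦌ ⟶ d).op b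

theorem map_map_eq {d'' : SimplexCategory} {f : d'' ⟶ d'} {g : d' ⟶ d} {h : d'' ⟶ d}
    (e : f ≫ g = h) (b : X.obj (op d)) : X.map f.op (X.map g.op b) = X.map h.op b := by
  subst e
  simp

theorem σ_vertex (b : X.obj (op d)) (i : Fin (d.len + 1)) :
    X.σ 0 (vertex b i) = edge b (le_refl i) := by
  refine map_map_eq ?_ b
  ext a : 3
  fin_cases a <;> rfl

theorem δ_zero_triangle (b : X.obj (op d)) {i j k : Fin (d.len + 1)} (hij : i ≤ j) (hjk : j ≤ k) :
    X.δ 0 (triangle b hij hjk) = edge b hjk := by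
  refine map_map_eq ?_ b
  ext a : 3
  fin_cases a <;> rfl

theorem δ_one_triangle (b : X.obj (op d)) {i j k : Fin (d.len + 1)} (hij : i ≤ j) (hjk : j ≤ k) :
    X.δ 1 (triangle b hij hjk) = edge b (hij.trans hjk) := by
  refine map_map_eq ?_ b
  ext a : 3
  fin_cases a <;> rfl

theorem δ_two_triangle (b : X.obj (op d)) {i j k : Fin (d.len + 1)} (hij : i ≤ j) (hjk : j ≤ k) :
    X.δ 2 (triangle b hij hjk) = edge b hij := by
  refine map_map_eq ?_ b
  ext a : 3
  fin_cases a <;> rfl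

theorem vertex_map (θ : d' ⟶ d) (b : X.obj (op d)) (i : Fin (d'.len + 1)) :
    vertex (X.map θ.op b) i = vertex b (θ.toOrderHom i) := by
  refine map_map_eq ?_ b
  ext a : 3
  fin_cases a
  rfl

theorem edge_map (θ : d' ⟶ d) (b : X.obj (op d)) {i j : Fin (d'.len + 1)} (hij : i ≤ j) :
    edge (X.map θ.op b) hij = edge b (θ.toOrderHom.monotone hij) := by
  refine map_map_eq ?_ b
  ext a : 3
  fin_cases a <;> rfl

theorem triangle_map (θ : d' ⟶ d) (b : X.obj (op d)) {i j k : Fin (d'.len + 1)} (hij : i ≤ j)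
    (hjk : j ≤ k) :
    triangle (X.map θ.op b) hij hjk =
      triangle b (θ.toOrderHom.monotone hij) (θ.toOrderHom.monotone hjk) := by
  refine map_map_eq ?_ b
  ext a : 3
  fin_cases a <;> rfl

end Faces

/-! ## The operadic Grothendieck construction -/

/-- The data of an `n`-simplex of the operadic Grothendieck construction: an `n`-simplex `b` of `X`,
an object `a_{ij}` of `P_x` for every edge `x = b_{ij}` of `b`, and a map
`a_{jk} ·_t a_{ij} ⟶ a_{ik}` in `P_{b_{ik}}` for every triangle `t = b_{ijk}` of `b`. Edges and
triangles of `b` are given up to propositional equality, which avoids all transports. -/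
structure GrothendieckSimplexData {X : SSet.{u}} (P : CategoricalOperad X)
    (d : SimplexCategory) where
  base : X.obj (op d)
  obj : ∀ {i j : Fin (d.len + 1)} (hij : i ≤ j) {x : X _⦋1⦌}, edge base hij = x → P.cat x
  hom : ∀ {i j k : Fin (d.len + 1)} (hij : i ≤ j) (hjk : j ≤ k) {t : X _⦋2⦌}
    (_ : triangle base hij hjk = t) {x y z : X _⦋1⦌} (hx : X.δ 0 t = x) (hy : X.δ 2 t = y)
    (hz : X.δ 1 t = z) (hx' : edge base hjk = x) (hy' : edge base hij = y)
    (hz' : edge base (hij.trans hjk) = z),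
    (P.mul t hx hy hz).obj (obj hjk hx', obj hij hy') ⟶ obj (hij.trans hjk) hz'

namespace GrothendieckSimplexData

variable {X : SSet.{u}} {P : CategoricalOperad X} {d : SimplexCategory}

/-- The object `a_{ij}` over the edge `ij`. -/
def a (s : GrothendieckSimplexData P d) {i j : Fin (d.len + 1)} (hij : i ≤ j) :
    P.cat (edge s.base hij) :=
  s.obj hij rfl

/-- The multiplication functor `P_t` of the triangle `t = ijk`. -/
def mul (s : GrothendieckSimplexData P d) {i j k : Fin (d.len + 1)} (hij : i ≤ j) (hjk : j ≤ k) :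
    P.cat (edge s.base hjk) × P.cat (edge s.base hij) ⥤ P.cat (edge s.base (hij.trans hjk)) :=
  P.mul (triangle s.base hij hjk) (δ_zero_triangle _ _ _) (δ_two_triangle _ _ _)
    (δ_one_triangle _ _ _)

/-- The map `γ_{ijk} : a_{jk} · a_{ij} ⟶ a_{ik}` over the triangle `ijk`. -/
def γ (s : GrothendieckSimplexData P d) {i j k : Fin (d.len + 1)} (hij : i ≤ j) (hjk : j ≤ k) :
    (s.mul hij hjk).obj (s.a hjk, s.a hij) ⟶ s.a (hij.trans hjk) :=
  s.hom hij hjk rfl _ _ _ rfl rfl rfl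

end GrothendieckSimplexData

/-- An `n`-simplex of the operadic Grothendieck construction. Over degenerate edges the objects are
the units `e` of the operad, over degenerate triangles the maps are identities, and for
`i ≤ j ≤ k ≤ l` the two maps `(a_{kl} · a_{jk}) · a_{ij} = a_{kl} · (a_{jk} · a_{ij}) ⟶ a_{il}`
agree: `γ_{ijl} ∘ (γ_{jkl} · a_{ij}) = γ_{ikl} ∘ (a_{kl} · γ_{ijk})`. The equations are
heterogeneous since the sources of the two sides are equal by the axioms of the operad only. -/
structure GrothendieckSimplex {X : SSet.{u}} (P : CategoricalOperad X) (d : SimplexCategory)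
    extends GrothendieckSimplexData P d where
  a_refl : ∀ i : Fin (d.len + 1),
    toGrothendieckSimplexData.a (le_refl i) = P.unitAt (vertex base i) (σ_vertex base i)
  γ_refl_left : ∀ {i j : Fin (d.len + 1)} (hij : i ≤ j),
    toGrothendieckSimplexData.γ (le_refl i) hij ≍ 𝟙 (toGrothendieckSimplexData.a hij)
  γ_refl_right : ∀ {i j : Fin (d.len + 1)} (hij : i ≤ j),
    toGrothendieckSimplexData.γ hij (le_refl j) ≍ 𝟙 (toGrothendieckSimplexData.a hij)
  cocycle : ∀ {i j k l : Fin (d.len + 1)} (hij : i ≤ j) (hjk : j ≤ k) (hkl : k ≤ l),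
    (toGrothendieckSimplexData.mul hij (hjk.trans hkl)).map
        (Prod.mkHom (toGrothendieckSimplexData.γ hjk hkl)
          (𝟙 (toGrothendieckSimplexData.a hij))) ≫
      toGrothendieckSimplexData.γ hij (hjk.trans hkl) ≍
    (toGrothendieckSimplexData.mul (hij.trans hjk) hkl).map
        (Prod.mkHom (𝟙 (toGrothendieckSimplexData.a hkl))
          (toGrothendieckSimplexData.γ hij hjk)) ≫
      toGrothendieckSimplexData.γ (hij.trans hjk) hkl

namespace GrothendieckSimplex

variable {X : SSet.{u}} {P : CategoricalOperad X} {d d' : SimplexCategory}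

/-- The restriction of the data of a simplex along a monotone map. -/
def restrictData (s : GrothendieckSimplexData P d) (θ : d' ⟶ d) : GrothendieckSimplexData P d' where
  base := X.map θ.op s.base
  obj hij _ hx := s.obj (θ.toOrderHom.monotone hij) ((edge_map θ s.base hij).symm.trans hx)
  hom hij hjk _ ht _ _ _ hx hy hz hx' hy' hz' :=
    s.hom (θ.toOrderHom.monotone hij) (θ.toOrderHom.monotone hjk)
      ((triangle_map θ s.base hij hjk).symm.trans ht) hx hy hz
      ((edge_map θ s.base hjk).symm.trans hx') ((edge_map θ s.base hij).symm.trans hy')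
      ((edge_map θ s.base (hij.trans hjk)).symm.trans hz')

theorem a_refl' (s : GrothendieckSimplex P d) (i : Fin (d.len + 1)) {c : X _⦋0⦌} {x : X _⦋1⦌}
    (hc : vertex s.base i = c) (hx : edge s.base (le_refl i) = x) (h : X.σ 0 c = x) :
    s.obj (le_refl i) hx = P.unitAt c h := by
  subst hc hx
  exact s.a_refl i

theorem γ_refl_left' (s : GrothendieckSimplex P d) {i j : Fin (d.len + 1)} (hij : i ≤ j)
    {t : X _⦋2⦌} (ht : triangle s.base (le_refl i) hij = t) {x y z : X _⦋1⦌} (hx : X.δ 0 t = x)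
    (hy : X.δ 2 t = y) (hz : X.δ 1 t = z) (hx' : edge s.base hij = x)
    (hy' : edge s.base (le_refl i) = y) (hz' : edge s.base hij = z) :
    s.hom (le_refl i) hij ht hx hy hz hx' hy' hz' ≍ 𝟙 (s.obj hij hx') := by
  subst ht hx' hy' hz'
  exact s.γ_refl_left hij

theorem γ_refl_right' (s : GrothendieckSimplex P d) {i j : Fin (d.len + 1)} (hij : i ≤ j)
    {t : X _⦋2⦌} (ht : triangle s.base hij (le_refl j) = t) {x y z : X _⦋1⦌} (hx : X.δ 0 t = x)
    (hy : X.δ 2 t = y) (hz : X.δ 1 t = z) (hx' : edge s.base (le_refl j) = x)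
    (hy' : edge s.base hij = y) (hz' : edge s.base hij = z) :
    s.hom hij (le_refl j) ht hx hy hz hx' hy' hz' ≍ 𝟙 (s.obj hij hy') := by
  subst ht hx' hy' hz'
  exact s.γ_refl_right hij

theorem cocycle' (s : GrothendieckSimplex P d) {i j k l : Fin (d.len + 1)} (hij : i ≤ j)
    (hjk : j ≤ k) (hkl : k ≤ l) {tijk tijl tikl tjkl : X _⦋2⦌} {xij xik xil xjk xjl xkl : X _⦋1⦌}
    (htijk : triangle s.base hij hjk = tijk) (htijl : triangle s.base hij (hjk.trans hkl) = tijl)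
    (htikl : triangle s.base (hij.trans hjk) hkl = tikl) (htjkl : triangle s.base hjk hkl = tjkl)
    (hxij : edge s.base hij = xij) (hxik : edge s.base (hij.trans hjk) = xik)
    (hxil : edge s.base (hij.trans (hjk.trans hkl)) = xil) (hxjk : edge s.base hjk = xjk)
    (hxjl : edge s.base (hjk.trans hkl) = xjl) (hxkl : edge s.base hkl = xkl)
    (h₀ : X.δ 0 tijk = xjk) (h₁ : X.δ 2 tijk = xij) (h₂ : X.δ 1 tijk = xik)
    (h₃ : X.δ 0 tijl = xjl) (h₄ : X.δ 2 tijl = xij) (h₅ : X.δ 1 tijl = xil)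
    (h₆ : X.δ 0 tikl = xkl) (h₇ : X.δ 2 tikl = xik) (h₈ : X.δ 1 tikl = xil)
    (h₉ : X.δ 0 tjkl = xkl) (h₁₀ : X.δ 2 tjkl = xjk) (h₁₁ : X.δ 1 tjkl = xjl) :
    (P.mul tijl h₃ h₄ h₅).map
        (Prod.mkHom (s.hom hjk hkl htjkl h₉ h₁₀ h₁₁ hxkl hxjk hxjl) (𝟙 (s.obj hij hxij))) ≫
      s.hom hij (hjk.trans hkl) htijl h₃ h₄ h₅ hxjl hxij hxil ≍
    (P.mul tikl h₆ h₇ h₈).map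
        (Prod.mkHom (𝟙 (s.obj hkl hxkl)) (s.hom hij hjk htijk h₀ h₁ h₂ hxjk hxij hxik)) ≫
      s.hom (hij.trans hjk) hkl htikl h₆ h₇ h₈ hxkl hxik hxil := by
  subst htijk htijl htikl htjkl hxij hxik hxil hxjk hxjl hxkl
  exact s.cocycle hij hjk hkl

/-- The restriction of a simplex along a monotone map. -/
def restrict (s : GrothendieckSimplex P d) (θ : d' ⟶ d) : GrothendieckSimplex P d' where
  toGrothendieckSimplexData := restrictData s.toGrothendieckSimplexData θ
  a_refl i := s.a_refl' _ (vertex_map θ s.base i).symm _ _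
  γ_refl_left _ := s.γ_refl_left' _ _ _ _ _ _ _ _
  γ_refl_right _ := s.γ_refl_right' _ _ _ _ _ _ _ _
  cocycle hij hjk hkl :=
    s.cocycle' (θ.toOrderHom.monotone hij) (θ.toOrderHom.monotone hjk) (θ.toOrderHom.monotone hkl)
      (triangle_map θ s.base _ _).symm (triangle_map θ s.base _ _).symm
      (triangle_map θ s.base _ _).symm (triangle_map θ s.base _ _).symm
      (edge_map θ s.base _).symm (edge_map θ s.base _).symm (edge_map θ s.base _).symm
      (edge_map θ s.base _).symm (edge_map θ s.base _).symm (edge_map θ s.base _).symm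
      _ _ _ _ _ _ _ _ _ _ _ _

theorem ext' {s s' : GrothendieckSimplex P d} (hb : s.base = s'.base)
    (ho : ∀ {i j : Fin (d.len + 1)} (hij : i ≤ j) {x : X _⦋1⦌} (hx : edge s.base hij = x)
      (hx' : edge s'.base hij = x), s.obj hij hx = s'.obj hij hx')
    (hh : ∀ {i j k : Fin (d.len + 1)} (hij : i ≤ j) (hjk : j ≤ k) {t : X _⦋2⦌}
      (ht : triangle s.base hij hjk = t) (ht' : triangle s'.base hij hjk = t) {x y z : X _⦋1⦌}
      (hx : X.δ 0 t = x) (hy : X.δ 2 t = y) (hz : X.δ 1 t = z) (hx₁ : edge s.base hjk = x)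
      (hy₁ : edge s.base hij = y) (hz₁ : edge s.base (hij.trans hjk) = z)
      (hx₂ : edge s'.base hjk = x) (hy₂ : edge s'.base hij = y)
      (hz₂ : edge s'.base (hij.trans hjk) = z),
      s.hom hij hjk ht hx hy hz hx₁ hy₁ hz₁ ≍ s'.hom hij hjk ht' hx hy hz hx₂ hy₂ hz₂) :
    s = s' := by
  obtain ⟨⟨b, o, h⟩, _, _, _, _⟩ := s
  obtain ⟨⟨b', o', h'⟩, _, _, _, _⟩ := s'
  obtain rfl : b = b' := hb
  obtain rfl : @o = @o' := by
    funext i j hij x hx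
    exact ho hij hx hx
  obtain rfl : @h = @h' := by
    funext i j k hij hjk t ht x y z hx hy hz hx' hy' hz'
    exact eq_of_heq (hh hij hjk ht ht hx hy hz hx' hy' hz' hx' hy' hz')
  rfl

end GrothendieckSimplex

namespace CategoricalOperad

variable {X : SSet.{u}} (P : CategoricalOperad X)

/-- The underlying simplicial set of the operadic Grothendieck construction `∫ P`. Its
`1`-simplices amount to pairs `(A, a)` with `A ∈ X_1` and `a ∈ P_A`, its `2`-simplices
`(A, a) ⟶ (B, b)` to triples `(f, p, α)` with `f : A ⟶ B` in `X_2`, `p ∈ P_{φ(f)}` and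
`α : b ·_f p ⟶ a`, and its `3`-simplices to the lax triangles `(ρ, γ)` of such triples. -/
def grothendieck : SSet.{u} where
  obj d := GrothendieckSimplex P d.unop
  map θ := ↾fun s => s.restrict θ.unop
  map_id d := by
    ext s
    refine GrothendieckSimplex.ext' ?_ ?_ ?_
    · change X.map (𝟙 _) s.base = s.base
      simp
    · intros
      rfl
    · intros
      rfl
  map_comp f g := by
    ext s
    refine GrothendieckSimplex.ext' ?_ ?_ ?_
    · change X.map (f ≫ g) s.base = X.map g (X.map f s.base)
      simp
    · intros
      rfl
    · intros
      rfl

/-- The projection `π_P : ∫ P ⟶ X`. -/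
def proj : P.grothendieck ⟶ X where
  app _ := ↾fun s => s.base

end CategoricalOperad

/-! ## Split operadic fibrations -/

section Fibrations

variable {X Y : SSet.{u}}

/-- A `2`-simplex `f` (that is, a map of the 2-category) is operadic `p`-cartesian if for any
`(3,2)`-horn `l` with `d_0 l = f` and any filler `σ` of `p l`, there is a unique filler `τ` of `l`
with `p τ = σ`. -/
def IsOperadicCartesian (p : X ⟶ Y) (f : X _⦋2⦌) : Prop :=
  ∀ l : (Λ[3, 2] : SSet.{u}) ⟶ X,
    l.app (op ⦋2⦌) (SSet.horn.face (2 : Fin 4) (0 : Fin 4) (by decide)) = f →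
    ∀ σ : (Δ[3] : SSet.{u}) ⟶ Y, (SSet.horn 3 2).ι ≫ σ = l ≫ p →
      ∃! τ : (Δ[3] : SSet.{u}) ⟶ X, (SSet.horn 3 2).ι ≫ τ = l ∧ τ ≫ p = σ

/-- `f` is an operadic `p`-cartesian lift of `g` with target `a` and fiber `b`. -/
structure IsCartesianLift (p : X ⟶ Y) (a b : X _⦋1⦌) (g : Y _⦋2⦌) (f : X _⦋2⦌) : Prop where
  map_eq : p.app (op ⦋2⦌) f = g
  target_eq : X.δ 0 f = a
  fiber_eq : X.δ 2 f = b
  cartesian : IsOperadicCartesian p f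

/-- Operadic fibrations. The nerve of the 2-category underlying a unary operadic 2-category with
simplicial set `X` is `dec X`, hence the connected components of that 2-category are those of
`dec X`. -/
structure IsOperadicFibration (p : X ⟶ Y) : Prop where
  surjective : Function.Surjective (SSet.mapπ₀ (decMap p))
  exists_lift : ∀ (a b : X _⦋1⦌) (g : Y _⦋2⦌), Y.δ 0 g = p.app (op ⦋1⦌) a →
    Y.δ 2 g = p.app (op ⦋1⦌) b → ∃ f : X _⦋2⦌, IsCartesianLift p a b g f

/-- A choice of a map `ℓ(a, b, g)` for all `a`, `b` and `g` with `d_0 g = p(a)`, `d_2 g = p(b)`. -/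
def LiftChoice (p : X ⟶ Y) : Type u :=
  ∀ (a b : X _⦋1⦌) (g : Y _⦋2⦌), Y.δ 0 g = p.app (op ⦋1⦌) a → Y.δ 2 g = p.app (op ⦋1⦌) b → X _⦋2⦌

/-- A choice `ℓ` of operadic cartesian lifts is a splitting if
* `ℓ(u_{π(x)}, x, u_{p(x)}) = u_x` and `ℓ(x, u_{φ(x)}, 𝟙_{p(x)}) = 𝟙_x`, where `u_{π(x)} = s_0 d_0 x`,
  `u_{φ(x)} = s_0 d_1 x`, `u_x = s_1 x` and `𝟙_x = s_0 x`;
* for every `s ∈ Y_3` with edges `s_{01} = p(x)`, `s_{12} = p(y)`, `s_{23} = p(z)`, the lifts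
  `ℓ(d_1 ℓ(z, y, s_{123}), x, s_{013})` and `ℓ(z, d_1 ℓ(y, x, s_{012}), s_{023})` have the same
  source, and together with `ℓ(z, y, s_{123})` and `ℓ(y, x, s_{012})` they are the faces of a
  `3`-simplex over `s`. -/
structure IsSplitting (p : X ⟶ Y) (ℓ : LiftChoice p) : Prop where
  isLift : ∀ (a b : X _⦋1⦌) (g : Y _⦋2⦌) (h₀ : Y.δ 0 g = p.app (op ⦋1⦌) a)
    (h₂ : Y.δ 2 g = p.app (op ⦋1⦌) b), IsCartesianLift p a b g (ℓ a b g h₀ h₂)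
  lift_trivial : ∀ (x : X _⦋1⦌)
    (h₀ : Y.δ 0 (Y.σ 1 (p.app (op ⦋1⦌) x)) = p.app (op ⦋1⦌) (X.σ 0 (X.δ 0 x)))
    (h₂ : Y.δ 2 (Y.σ 1 (p.app (op ⦋1⦌) x)) = p.app (op ⦋1⦌) x),
    ℓ (X.σ 0 (X.δ 0 x)) x (Y.σ 1 (p.app (op ⦋1⦌) x)) h₀ h₂ = X.σ 1 x
  lift_identity : ∀ (x : X _⦋1⦌)
    (h₀ : Y.δ 0 (Y.σ 0 (p.app (op ⦋1⦌) x)) = p.app (op ⦋1⦌) x)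
    (h₂ : Y.δ 2 (Y.σ 0 (p.app (op ⦋1⦌) x)) = p.app (op ⦋1⦌) (X.σ 0 (X.δ 1 x))),
    ℓ x (X.σ 0 (X.δ 1 x)) (Y.σ 0 (p.app (op ⦋1⦌) x)) h₀ h₂ = X.σ 0 x
  lift_assoc : ∀ (s : Y _⦋3⦌) (x y z : X _⦋1⦌)
    (hz : Y.δ 0 (Y.δ 0 s) = p.app (op ⦋1⦌) z) (hy : Y.δ 2 (Y.δ 0 s) = p.app (op ⦋1⦌) y)
    (hy' : Y.δ 0 (Y.δ 3 s) = p.app (op ⦋1⦌) y) (hx : Y.δ 2 (Y.δ 3 s) = p.app (op ⦋1⦌) x)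
    (hzy : Y.δ 0 (Y.δ 2 s) = p.app (op ⦋1⦌) (X.δ 1 (ℓ z y (Y.δ 0 s) hz hy)))
    (hx' : Y.δ 2 (Y.δ 2 s) = p.app (op ⦋1⦌) x) (hz' : Y.δ 0 (Y.δ 1 s) = p.app (op ⦋1⦌) z)
    (hyx : Y.δ 2 (Y.δ 1 s) = p.app (op ⦋1⦌) (X.δ 1 (ℓ y x (Y.δ 3 s) hy' hx))),
    X.δ 1 (ℓ (X.δ 1 (ℓ z y (Y.δ 0 s) hz hy)) x (Y.δ 2 s) hzy hx') =
      X.δ 1 (ℓ z (X.δ 1 (ℓ y x (Y.δ 3 s) hy' hx)) (Y.δ 1 s) hz' hyx) ∧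
    ∃ t : X _⦋3⦌, p.app (op ⦋3⦌) t = s ∧ X.δ 0 t = ℓ z y (Y.δ 0 s) hz hy ∧
      X.δ 1 t = ℓ z (X.δ 1 (ℓ y x (Y.δ 3 s) hy' hx)) (Y.δ 1 s) hz' hyx ∧
      X.δ 2 t = ℓ (X.δ 1 (ℓ z y (Y.δ 0 s) hz hy)) x (Y.δ 2 s) hzy hx' ∧
      X.δ 3 t = ℓ y x (Y.δ 3 s) hy' hx

end Fibrations

/-- The `2`-simplex `t` of `∫ P` is the map `(f, b, 𝟙) : (d_1 f, a ·_f b) ⟶ (d_0 f, a)`, where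
`A = (d_0 f, a)` and `B = (d_2 f, b)`. -/
structure IsCanonicalLift {X : SSet.{u}} {P : CategoricalOperad X} (A B : GrothendieckSimplex P ⦋1⦌)
    (f : X _⦋2⦌) (t : GrothendieckSimplex P ⦋2⦌) : Prop where
  base_eq : t.base = f
  target_eq : t.a (i := 1) (j := 2) (by decide) ≍ A.a (i := 0) (j := 1) (by decide)
  fiber_eq : t.a (i := 0) (j := 1) (by decide) ≍ B.a (i := 0) (j := 1) (by decide)
  source_eq : (t.mul (i := 0) (j := 1) (k := 2) (by decide) (by decide)).obj
    (t.a (by decide), t.a (by decide)) = t.a (by decide)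
  hom_eq : t.γ (i := 0) (j := 1) (k := 2) (by decide) (by decide) = eqToHom source_eq

/-!
# The operadic Grothendieck construction is a split operadic fibration

Let `X` be a simplicial set with `dec_⊤ X ≅ N C`, and let `P` be a categorical operad on `X`.

*The décalage of `∫ P` is a nerve.* Under the isomorphism, `P` becomes an operad indexed by the
cells of `C` (`IndexedOperad`, `UnaryOperadicStructure.indexedOperad`): a category `Q A = P_A` for
every object, a category `R f = P_{φ(f)}` for every map, an action of `R f` from `Q B` to `Q A`, and
a composition `R g × R f ⥤ R h` for every lax triangle `f ≫ g ⟶ h`. A 2-cell `θ : f ⟶ f'` is the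
same as a lax triangle `f ≫ 𝟙 ⟶ f'`, and composition with the unit along it is a functor
`push θ : R f ⥤ R f'`. Functoriality of `push` and its compatibility with composition, whiskering,
associators and unitors follow from the associativity and unit laws of `P`. Hence the pairs
`(A, a)`, the triples `(f, p, α)` and the pairs `(θ, ω)` with `ω : push θ p ⟶ p'` form a bicategory
(`IndexedOperad.Total.bicategory`), which is strict if `C` is (`IndexedOperad.Total.strict`). A
simplex of its nerve is a simplex of `N C` with decorations (`IndexedOperad.Total.decorationEquiv`),
and so is a simplex of `dec_⊤ (∫ P)`: edges and triangles which contain the top vertex lie over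
objects and maps of `C`, the remaining ones lie over fibers. This gives the isomorphism of
`dec_⊤ (∫ P)` with the nerve (`UnaryOperadicStructure.grothendieckToNerve_bijective`,
`UnaryOperadicStructure.grothendieckToNerve_restrict`).

*The projection is a split fibration.* If `γ₁₂₃` is an identity, then the cocycle condition for a
`3`-simplex of `∫ P` reads `γ₀₁₃ = γ₀₂₃ ∘ (a₂₃ · γ₀₁₂)`. The faces `0`, `1` and `3` contain all
edges and all triangles other than `013`, so a horn `Λ[3, 2]` whose face `0` is a strict triangle
has exactly one filler over a given `3`-simplex of `X`
(`GrothendieckSimplex.exists_of_faces`, `GrothendieckSimplex.eq_of_faces`). Thus the triangles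
`(f, b, 𝟙)` are cartesian. Such a triangle is determined by `f`, its target and its fiber
(`IsCanonicalLift.unique`), so the splitting laws amount to the facts that degenerate triangles are
strict, and that the face `2` of a `3`-simplex is strict if the faces `0`, `1` and `3` are.
-/

/-! ### Morphisms which agree up to equality of their endpoints -/

/-- Two morphisms of a category are equal, together with their sources and targets. The axioms of
an operad are equalities of functors, so the maps that they compare have endpoints which agree only
propositionally. This relation is transitive and stable under composition and functors, and
`eqToHom` is related to an identity, so equalities of such maps are proved without transport. -/
structure HomEq {C : Type*} [Category* C] {a b c d : C} (u : a ⟶ b) (v : c ⟶ d) : Prop where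
  left : a = c
  right : b = d
  heq : u ≍ v

infix:50 " ~ₕ " => HomEq

namespace HomEq

variable {C D : Type*} [Category* C] [Category* D]

theorem rfl {a b : C} {u : a ⟶ b} : u ~ₕ u := ⟨.refl _, .refl _, .refl _⟩

@[symm]
theorem symm {a b c d : C} {u : a ⟶ b} {v : c ⟶ d} (h : u ~ₕ v) : v ~ₕ u := by
  obtain ⟨rfl, rfl, rfl⟩ := h
  exact .rfl

theorem trans {a b c d e f : C} {u : a ⟶ b} {v : c ⟶ d} {w : e ⟶ f} (h : u ~ₕ v) (h' : v ~ₕ w) :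
    u ~ₕ w := by
  obtain ⟨rfl, rfl, rfl⟩ := h
  exact h'

theorem of_eq {a b : C} {u v : a ⟶ b} (h : u = v) : u ~ₕ v := h ▸ .rfl

theorem eq {a b : C} {u v : a ⟶ b} (h : u ~ₕ v) : u = v := eq_of_heq h.heq

theorem id {a b : C} (h : a = b) : 𝟙 a ~ₕ 𝟙 b := h ▸ .rfl

theorem eqToHom {a b : C} (h : a = b) : CategoryTheory.eqToHom h ~ₕ 𝟙 b := by
  subst h
  exact .rfl

theorem comp {a b c a' b' c' : C} {u : a ⟶ b} {v : b ⟶ c} {u' : a' ⟶ b'} {v' : b' ⟶ c'}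
    (h : u ~ₕ u') (h' : v ~ₕ v') : u ≫ v ~ₕ u' ≫ v' := by
  obtain ⟨rfl, rfl, rfl⟩ := h
  obtain ⟨_, rfl, rfl⟩ := h'
  exact .rfl

theorem eqToHom_comp {a b c : C} (h : a = b) (u : b ⟶ c) : CategoryTheory.eqToHom h ≫ u ~ₕ u := by
  subst h
  exact .of_eq (Category.id_comp u)

/-- A morphism which is an identity up to equality of its endpoints can be cancelled. -/
theorem id_comp {a b c x y : C} {u : a ⟶ b} {v : b ⟶ c} {v' : x ⟶ y} {z : C} (h : u ~ₕ 𝟙 z)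
    (h' : v ~ₕ v') : u ≫ v ~ₕ v' := by
  obtain ⟨rfl, rfl, rfl⟩ := h
  exact (of_eq (Category.id_comp v)).trans h'

theorem comp_id {a b c x y : C} {u : a ⟶ b} {v : b ⟶ c} {u' : x ⟶ y} {z : C} (h : u ~ₕ u')
    (h' : v ~ₕ 𝟙 z) : u ≫ v ~ₕ u' := by
  obtain ⟨rfl, rfl, rfl⟩ := h'
  exact (of_eq (Category.comp_id u)).trans h

theorem map (F : C ⥤ D) {a b c d : C} {u : a ⟶ b} {v : c ⟶ d} (h : u ~ₕ v) :
    F.map u ~ₕ F.map v := by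
  obtain ⟨rfl, rfl, rfl⟩ := h
  exact .rfl

theorem of_functor_eq {F G : C ⥤ D} (h : F = G) {a b : C} (u : a ⟶ b) : F.map u ~ₕ G.map u := by
  subst h
  exact .rfl

theorem map_id (F : C ⥤ D) {a b c : C} {u : a ⟶ b} (h : u ~ₕ 𝟙 c) :
    F.map u ~ₕ 𝟙 (F.obj c) :=
  (h.map F).trans (.of_eq (F.map_id c))

theorem prodMk {a b c d : C} {a' b' c' d' : D} {u : a ⟶ b} {v : c ⟶ d} {u' : a' ⟶ b'}
    {v' : c' ⟶ d'} (h : u ~ₕ v) (h' : u' ~ₕ v') : Prod.mkHom u u' ~ₕ Prod.mkHom v v' := by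
  obtain ⟨rfl, rfl, rfl⟩ := h
  obtain ⟨rfl, rfl, rfl⟩ := h'
  exact .rfl

end HomEq

/-! ### Strictly increasing families in small ordinals -/

theorem fin_two_eq_of_lt : ∀ {i j : Fin 2}, i < j → i = 0 ∧ j = 1 := by decide

theorem fin_three_eq_of_lt_of_lt :
    ∀ {i j k : Fin 3}, i < j → j < k → i = 0 ∧ j = 1 ∧ k = 2 := by decide

theorem fin_four_eq_of_lt_of_lt_of_lt :
    ∀ {i j k l : Fin 4}, i < j → j < k → k < l → i = 0 ∧ j = 1 ∧ k = 2 ∧ l = 3 := by decide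

/-- Case distinction for the pairs `i < j` in `Fin 2`, which reduces on numerals. -/
@[elab_as_elim]
def finTwoLtCases {motive : ∀ i j : Fin 2, i < j → Sort*} (h₀₁ : motive 0 1 (by decide))
    {i j : Fin 2} (h : i < j) : motive i j h := by
  obtain rfl := (fin_two_eq_of_lt h).1
  obtain rfl := (fin_two_eq_of_lt h).2
  exact h₀₁

/-- Case distinction for the triples `i < j < k` in `Fin 3`, which reduces on numerals. -/
@[elab_as_elim]
def finThreeLtLtCases {motive : ∀ i j k : Fin 3, i < j → j < k → Sort*}
    (h₀₁₂ : motive 0 1 2 (by decide) (by decide)) {i j k : Fin 3} (h : i < j) (h' : j < k) :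
    motive i j k h h' := by
  obtain rfl := (fin_three_eq_of_lt_of_lt h h').1
  obtain rfl := (fin_three_eq_of_lt_of_lt h h').2.1
  obtain rfl := (fin_three_eq_of_lt_of_lt h h').2.2
  exact h₀₁₂

/-- Case distinction for the pairs `i < j` in `Fin 3`, which reduces on numerals. -/
@[elab_as_elim]
def finThreeLtCases {motive : ∀ i j : Fin 3, i < j → Sort*} (h₀₁ : motive 0 1 (by decide))
    (h₁₂ : motive 1 2 (by decide)) (h₀₂ : motive 0 2 (by decide)) {i j : Fin 3} (h : i < j) :
    motive i j h := by
  match i, j, h with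
  | 0, 1, _ => exact h₀₁
  | 1, 2, _ => exact h₁₂
  | 0, 2, _ => exact h₀₂
  | 0, 0, h => exact absurd h (by decide)
  | 1, 0, h => exact absurd h (by decide)
  | 1, 1, h => exact absurd h (by decide)
  | 2, 0, h => exact absurd h (by decide)
  | 2, 1, h => exact absurd h (by decide)
  | 2, 2, h => exact absurd h (by decide)

/-- Case distinction for the pairs `i < j` in `Fin 4`, which reduces on numerals. -/
@[elab_as_elim]
def finFourLtCases {motive : ∀ i j : Fin 4, i < j → Sort*} (h₀₁ : motive 0 1 (by decide))
    (h₁₂ : motive 1 2 (by decide)) (h₂₃ : motive 2 3 (by decide)) (h₀₂ : motive 0 2 (by decide))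
    (h₁₃ : motive 1 3 (by decide)) (h₀₃ : motive 0 3 (by decide)) {i j : Fin 4} (h : i < j) :
    motive i j h := by
  match i, j, h with
  | 0, 1, _ => exact h₀₁
  | 1, 2, _ => exact h₁₂
  | 2, 3, _ => exact h₂₃
  | 0, 2, _ => exact h₀₂
  | 1, 3, _ => exact h₁₃
  | 0, 3, _ => exact h₀₃
  | 0, 0, h => exact absurd h (by decide)
  | 1, 0, h => exact absurd h (by decide)
  | 1, 1, h => exact absurd h (by decide)
  | 2, 0, h => exact absurd h (by decide)
  | 2, 1, h => exact absurd h (by decide)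
  | 2, 2, h => exact absurd h (by decide)
  | 3, 0, h => exact absurd h (by decide)
  | 3, 1, h => exact absurd h (by decide)
  | 3, 2, h => exact absurd h (by decide)
  | 3, 3, h => exact absurd h (by decide)

/-- Case distinction for the triples `i < j < k` in `Fin 4`, which reduces on numerals. -/
@[elab_as_elim]
def finFourLtLtCases {motive : ∀ i j k : Fin 4, i < j → j < k → Sort*}
    (h₀₁₂ : motive 0 1 2 (by decide) (by decide)) (h₁₂₃ : motive 1 2 3 (by decide) (by decide))
    (h₀₁₃ : motive 0 1 3 (by decide) (by decide)) (h₀₂₃ : motive 0 2 3 (by decide) (by decide))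
    {i j k : Fin 4} (h : i < j) (h' : j < k) : motive i j k h h' := by
  refine finFourLtCases (motive := fun i j h => ∀ k h', motive i j k h h') ?_ ?_ ?_ ?_ ?_ ?_ h k h'
    <;> intro k h'
  · match k, h' with
    | 0, h' => exact absurd h' (by decide)
    | 1, h' => exact absurd h' (by decide)
    | 2, _ => exact h₀₁₂
    | 3, _ => exact h₀₁₃
  · match k, h' with
    | 0, h' => exact absurd h' (by decide)
    | 1, h' => exact absurd h' (by decide)
    | 2, h' => exact absurd h' (by decide)
    | 3, _ => exact h₁₂₃
  · exact absurd h' (by omega)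
  · match k, h' with
    | 0, h' => exact absurd h' (by decide)
    | 1, h' => exact absurd h' (by decide)
    | 2, h' => exact absurd h' (by decide)
    | 3, _ => exact h₀₂₃
  · exact absurd h' (by omega)
  · exact absurd h' (by omega)

/-! ### Simplices of the Duskin nerve -/

namespace DuskinSimplex

open Bicategory

variable {C : Type u} [Bicategory.{u, u} C] {d : SimplexCategory}

/-- A simplex of the Duskin nerve is determined by its nondegenerate edges and triangles. -/
theorem ext_of_lt {s s' : DuskinSimplex C d} (ho : ∀ i, s.obj i = s'.obj i)
    (hh : ∀ {i j} (h : i < j), s.hom h.le ≍ s'.hom h.le)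
    (ht : ∀ {i j k} (h : i < j) (h' : j < k), s.tri h.le h'.le ≍ s'.tri h.le h'.le) : s = s' := by
  obtain ⟨o, h, t, r, tl, tr, _⟩ := s
  obtain ⟨o', h', t', r', tl', tr', _⟩ := s'
  obtain rfl : o = o' := funext ho
  obtain rfl : @h = @h' := by
    funext i j hij
    rcases hij.eq_or_lt with rfl | hlt
    · exact (r i).trans (r' i).symm
    · exact eq_of_heq (hh hlt)
  obtain rfl : @t = @t' := by
    funext i j k hij hjk
    rcases hij.eq_or_lt with rfl | hlt
    · exact (tl hjk).trans (tl' hjk).symm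
    rcases hjk.eq_or_lt with rfl | hlt'
    · exact (tr hij).trans (tr' hij).symm
    · exact eq_of_heq (ht hlt hlt')
  rfl

/-- The cocycle condition for a tetrahedron whose first edge is degenerate. -/
theorem cocycle_refl_left {x y z : C} {e : x ⟶ x} (he : e = 𝟙 x) {f : x ⟶ y} {g : y ⟶ z}
    {h : x ⟶ z} (t : f ≫ g ⟶ h) : (eqToHom he ▷ f ≫ (λ_ f).hom) ▷ g ≫ t =
      (α_ e f g).hom ≫ e ◁ t ≫ eqToHom he ▷ h ≫ (λ_ h).hom := by
  subst he
  simp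

/-- The cocycle condition for a tetrahedron whose second edge is degenerate. -/
theorem cocycle_refl_middle {x y z : C} {e : y ⟶ y} (he : e = 𝟙 y) {f : x ⟶ y} {g : y ⟶ z}
    {h : x ⟶ z} (t : f ≫ g ⟶ h) : (f ◁ eqToHom he ≫ (ρ_ f).hom) ▷ g ≫ t =
      (α_ f e g).hom ≫ f ◁ (eqToHom he ▷ g ≫ (λ_ g).hom) ≫ t := by
  subst he
  simp

/-- The cocycle condition for a tetrahedron whose third edge is degenerate. -/
theorem cocycle_refl_right {x y z : C} {e : z ⟶ z} (he : e = 𝟙 z) {f : x ⟶ y} {g : y ⟶ z}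
    {h : x ⟶ z} (t : f ≫ g ⟶ h) : t ▷ e ≫ h ◁ eqToHom he ≫ (ρ_ h).hom =
      (α_ f g e).hom ≫ f ◁ (g ◁ eqToHom he ≫ (ρ_ g).hom) ≫ t := by
  subst he
  simp

section OfLT

variable (obj : Fin (d.len + 1) → C) (hom : ∀ {i j}, i < j → (obj i ⟶ obj j))
  (tri : ∀ {i j k} (hij : i < j) (hjk : j < k), hom hij ≫ hom hjk ⟶ hom (hij.trans hjk))

/-- The extension by identities of a family of maps indexed by `i < j` to `i ≤ j`. The decision
whether `i = j` is an argument, so that the extension reduces by computation. -/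
def homExt {i j : Fin (d.len + 1)} (h : i ≤ j) (p : Decidable (i = j)) : obj i ⟶ obj j :=
  @dite _ (i = j) p (fun e => eqToHom (congrArg obj e)) (fun n => hom (lt_of_le_of_ne h n))

/-- The extension by unitors of a family of lax triangles indexed by `i < j < k` to
`i ≤ j ≤ k`. -/
def triExt {i j k : Fin (d.len + 1)} (hij : i ≤ j) (hjk : j ≤ k) (p : Decidable (i = j))
    (q : Decidable (j = k)) (r : Decidable (i = k)) :
    homExt obj hom hij p ≫ homExt obj hom hjk q ⟶ homExt obj hom (hij.trans hjk) r := by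
  match p, q, r with
  | isTrue e, q, r =>
    subst e
    exact (λ_ _).hom ≫ eqToHom (by rw [Subsingleton.elim q r])
  | isFalse _, isTrue e, r =>
    subst e
    exact (ρ_ _).hom ≫ eqToHom (congrArg _ (Subsingleton.elim _ r))
  | isFalse n, isFalse n', isFalse _ => exact tri (lt_of_le_of_ne hij n) (lt_of_le_of_ne hjk n')
  | isFalse n, isFalse _, isTrue e => exact absurd (le_antisymm hij (e ▸ hjk)) n

theorem triExt_refl_left {i j : Fin (d.len + 1)} (hij : i ≤ j) (p : Decidable (i = i))
    (q : Decidable (i = j)) (e : homExt obj hom (le_refl i) p = 𝟙 (obj i)) :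
    triExt obj hom tri (le_refl i) hij p q q =
      eqToHom e ▷ homExt obj hom hij q ≫ (λ_ (homExt obj hom hij q)).hom := by
  match p with
  | isFalse n => exact absurd rfl n
  | isTrue _ =>
    rw [show eqToHom e = 𝟙 (𝟙 (obj i)) from rfl]
    simp [triExt, homExt]

theorem triExt_refl_right {i j : Fin (d.len + 1)} (hij : i ≤ j) (p : Decidable (j = j))
    (q : Decidable (i = j)) (e : homExt obj hom (le_refl j) p = 𝟙 (obj j)) :
    triExt obj hom tri hij (le_refl j) q p q =
      homExt obj hom hij q ◁ eqToHom e ≫ (ρ_ (homExt obj hom hij q)).hom := by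
  match p, q with
  | isFalse n, _ => exact absurd rfl n
  | isTrue _, isTrue e =>
    subst e
    simp [triExt, homExt, unitors_equal]
  | isTrue _, isFalse _ =>
    rw [show eqToHom e = 𝟙 (𝟙 (obj j)) from rfl]
    simp [triExt, homExt]

/-- A simplex of the Duskin nerve from its nondegenerate edges and triangles. It suffices to have
the cocycle condition for `i < j < k < l`. -/
def ofLT (cocycle : ∀ {i j k l} (hij : i < j) (hjk : j < k) (hkl : k < l),
    tri hij hjk ▷ hom hkl ≫ tri (hij.trans hjk) hkl = (α_ (hom hij) (hom hjk) (hom hkl)).hom ≫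
      hom hij ◁ tri hjk hkl ≫ tri hij (hjk.trans hkl)) : DuskinSimplex C d where
  obj := obj
  hom h := homExt obj hom h inferInstance
  tri h h' := triExt obj hom tri h h' inferInstance inferInstance inferInstance
  hom_refl i := by
    rw [Subsingleton.elim (inferInstance : Decidable (i = i)) (isTrue rfl)]
    rfl
  tri_refl_left h := triExt_refl_left obj hom tri h _ _ _
  tri_refl_right h := triExt_refl_right obj hom tri h _ _ _
  cocycle {i j k l} hij hjk hkl := by
    have hr (i) : homExt obj hom (le_refl i) inferInstance = 𝟙 (obj i) := by
      rw [Subsingleton.elim (inferInstance : Decidable (i = i)) (isTrue rfl)]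
      rfl
    rcases hij.eq_or_lt with rfl | h₁
    · rw [triExt_refl_left _ _ _ _ _ _ (hr _), triExt_refl_left _ _ _ _ _ _ (hr _)]
      exact cocycle_refl_left (hr _) _
    rcases hjk.eq_or_lt with rfl | h₂
    · rw [triExt_refl_left _ _ _ _ _ _ (hr _), triExt_refl_right _ _ _ _ _ _ (hr _)]
      exact cocycle_refl_middle (hr _) _
    rcases hkl.eq_or_lt with rfl | h₃
    · rw [triExt_refl_right _ _ _ _ _ _ (hr _), triExt_refl_right _ _ _ _ _ _ (hr _)]
      exact cocycle_refl_right (hr _) _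
    rw [Subsingleton.elim (inferInstance : Decidable (i = j)) (isFalse h₁.ne),
      Subsingleton.elim (inferInstance : Decidable (j = k)) (isFalse h₂.ne),
      Subsingleton.elim (inferInstance : Decidable (k = l)) (isFalse h₃.ne),
      Subsingleton.elim (inferInstance : Decidable (i = k)) (isFalse (h₁.trans h₂).ne),
      Subsingleton.elim (inferInstance : Decidable (j = l)) (isFalse (h₂.trans h₃).ne),
      Subsingleton.elim (inferInstance : Decidable (i = l)) (isFalse (h₁.trans (h₂.trans h₃)).ne)]
    exact cocycle h₁ h₂ h₃

end OfLT

/-! ### Simplices of the Duskin nerve of dimension at most three -/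

/-- The vertex of the nerve given by an object. -/
def pt (A : C) : DuskinSimplex C ⦋0⦌ :=
  ofLT (fun _ => A) (fun {i j : Fin 1} (h : i < j) => absurd h (by omega))
    (fun {i j _ : Fin 1} (h : i < j) => absurd h (by omega))
    (fun {i j _ _ : Fin 1} (h : i < j) => absurd h (by omega))

/-- The edge of the nerve given by a map. -/
def ofHom {A B : C} (f : A ⟶ B) : DuskinSimplex C ⦋1⦌ :=
  ofLT (fun i : Fin 2 => by
      match i with
      | 0 => exact A
      | 1 => exact B)
    (fun {i j : Fin 2} (h : i < j) => by
      refine finTwoLtCases ?_ h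
      exact f)
    (fun {i j k : Fin 2} (h : i < j) (h' : j < k) => absurd h' (by omega))
    (fun {i j k l : Fin 2} (h : i < j) (h' : j < k) => absurd h' (by omega))

/-- The triangle of the nerve given by a lax triangle. -/
def ofTri {A B D : C} {f : A ⟶ B} {g : B ⟶ D} {c : A ⟶ D} (θ : f ≫ g ⟶ c) :
    DuskinSimplex C ⦋2⦌ :=
  ofLT (fun i : Fin 3 => by
      match i with
      | 0 => exact A
      | 1 => exact B
      | 2 => exact D)
    (fun {i j : Fin 3} (h : i < j) => by
      refine finThreeLtCases ?_ ?_ ?_ h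
      exacts [f, g, c])
    (fun {i j k : Fin 3} (h : i < j) (h' : j < k) => by
      refine finThreeLtLtCases ?_ h h'
      exact θ)
    (fun {i j k l : Fin 3} (h : i < j) (h' : j < k) (h'' : k < l) => absurd h'' (by omega))

/-- The tetrahedron of the nerve given by four lax triangles which satisfy the cocycle
condition. -/
def ofCocycle {A B D E : C} {f₀₁ : A ⟶ B} {f₁₂ : B ⟶ D} {f₂₃ : D ⟶ E} {f₀₂ : A ⟶ D} {f₁₃ : B ⟶ E}
    {f₀₃ : A ⟶ E} (θ₀₁₂ : f₀₁ ≫ f₁₂ ⟶ f₀₂) (θ₁₂₃ : f₁₂ ≫ f₂₃ ⟶ f₁₃) (θ₀₁₃ : f₀₁ ≫ f₁₃ ⟶ f₀₃)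
    (θ₀₂₃ : f₀₂ ≫ f₂₃ ⟶ f₀₃)
    (e : θ₀₁₂ ▷ f₂₃ ≫ θ₀₂₃ = (α_ f₀₁ f₁₂ f₂₃).hom ≫ f₀₁ ◁ θ₁₂₃ ≫ θ₀₁₃) : DuskinSimplex C ⦋3⦌ :=
  ofLT (fun i : Fin 4 => by
      match i with
      | 0 => exact A
      | 1 => exact B
      | 2 => exact D
      | 3 => exact E)
    (fun {i j : Fin 4} (h : i < j) => by
      refine finFourLtCases ?_ ?_ ?_ ?_ ?_ ?_ h
      exacts [f₀₁, f₁₂, f₂₃, f₀₂, f₁₃, f₀₃])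
    (fun {i j k : Fin 4} (h : i < j) (h' : j < k) => by
      refine finFourLtLtCases ?_ ?_ ?_ ?_ h h'
      exacts [θ₀₁₂, θ₁₂₃, θ₀₁₃, θ₀₂₃])
    (fun {i j k l : Fin 4} (h : i < j) (h' : j < k) (h'' : k < l) => by
      obtain ⟨rfl, rfl, rfl, rfl⟩ := fin_four_eq_of_lt_of_lt_of_lt h h' h''
      exact e)

theorem eq_pt (s : DuskinSimplex C ⦋0⦌) : s = pt (s.obj (0 : Fin 1)) :=
  ext_of_lt (fun (i : Fin 1) => by
      match i with
      | 0 => rfl)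
    (fun {i j : Fin 1} (h : i < j) => absurd h (by omega))
    (fun {i j _ : Fin 1} (h : i < j) => absurd h (by omega))

theorem eq_ofHom (s : DuskinSimplex C ⦋1⦌) :
    s = ofHom (s.hom (i := (0 : Fin 2)) (j := (1 : Fin 2)) (by decide)) :=
  ext_of_lt (fun (i : Fin 2) => by
      match i with
      | 0 => rfl
      | 1 => rfl)
    (fun {i j : Fin 2} (h : i < j) => by
      refine finTwoLtCases ?_ h
      rfl)
    (fun {i j k : Fin 2} (h : i < j) (h' : j < k) => absurd h' (by omega))

theorem eq_ofTri (s : DuskinSimplex C ⦋2⦌) :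
    s = ofTri (s.tri (i := (0 : Fin 3)) (j := (1 : Fin 3)) (k := (2 : Fin 3))
      (by decide) (by decide)) :=
  ext_of_lt (fun (i : Fin 3) => by
      match i with
      | 0 => rfl
      | 1 => rfl
      | 2 => rfl)
    (fun {i j : Fin 3} (h : i < j) => by
      refine finThreeLtCases ?_ ?_ ?_ h <;> rfl)
    (fun {i j k : Fin 3} (h : i < j) (h' : j < k) => by
      refine finThreeLtLtCases ?_ h h'
      rfl)

theorem restrict_const (s : DuskinSimplex C d) (i : Fin (d.len + 1)) :
    s.restrict (SimplexCategory.const ⦋0⦌ d i) = pt (s.obj i) := eq_pt _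

theorem restrict_mkOfLe (s : DuskinSimplex C d) {i j : Fin (d.len + 1)} (h : i ≤ j) :
    s.restrict (SimplexCategory.mkOfLe i j h : ⦋1⦌ ⟶ d) = ofHom (s.hom h) := eq_ofHom _

theorem restrict_mkOfLeComp (s : DuskinSimplex C d) {i j k : Fin (d.len + 1)} (h : i ≤ j)
    (h' : j ≤ k) :
    s.restrict (SimplexCategory.mkOfLeComp i j k h h' : ⦋2⦌ ⟶ d) = ofTri (s.tri h h') :=
  eq_ofTri _

variable {A B D E : C}

theorem ofHom_δ_zero (f : A ⟶ B) : (ofHom f).restrict (SimplexCategory.δ 0) = pt B := eq_pt _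

theorem ofHom_δ_one (f : A ⟶ B) : (ofHom f).restrict (SimplexCategory.δ 1) = pt A := eq_pt _

theorem pt_σ (A : C) : (pt A).restrict (SimplexCategory.σ 0) = ofHom (𝟙 A) :=
  (eq_ofHom _).trans rfl

theorem ofTri_δ_zero {f : A ⟶ B} {g : B ⟶ D} {c : A ⟶ D} (θ : f ≫ g ⟶ c) :
    (ofTri θ).restrict (SimplexCategory.δ 0) = ofHom g := eq_ofHom _

theorem ofTri_δ_one {f : A ⟶ B} {g : B ⟶ D} {c : A ⟶ D} (θ : f ≫ g ⟶ c) :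
    (ofTri θ).restrict (SimplexCategory.δ 1) = ofHom c := eq_ofHom _

theorem ofTri_δ_two {f : A ⟶ B} {g : B ⟶ D} {c : A ⟶ D} (θ : f ≫ g ⟶ c) :
    (ofTri θ).restrict (SimplexCategory.δ 2) = ofHom f := eq_ofHom _

theorem ofHom_σ_zero (f : A ⟶ B) :
    (ofHom f).restrict (SimplexCategory.σ 0) = ofTri (λ_ f).hom :=
  (eq_ofTri _).trans (congrArg ofTri (Category.comp_id _))

theorem ofHom_σ_one (f : A ⟶ B) :
    (ofHom f).restrict (SimplexCategory.σ 1) = ofTri (ρ_ f).hom :=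
  (eq_ofTri _).trans (congrArg ofTri (Category.comp_id _))

section Tetrahedron

variable {f₀₁ : A ⟶ B} {f₁₂ : B ⟶ D} {f₂₃ : D ⟶ E} {f₀₂ : A ⟶ D} {f₁₃ : B ⟶ E} {f₀₃ : A ⟶ E}
  {θ₀₁₂ : f₀₁ ≫ f₁₂ ⟶ f₀₂} {θ₁₂₃ : f₁₂ ≫ f₂₃ ⟶ f₁₃} {θ₀₁₃ : f₀₁ ≫ f₁₃ ⟶ f₀₃}
  {θ₀₂₃ : f₀₂ ≫ f₂₃ ⟶ f₀₃}
  (e : θ₀₁₂ ▷ f₂₃ ≫ θ₀₂₃ = (α_ f₀₁ f₁₂ f₂₃).hom ≫ f₀₁ ◁ θ₁₂₃ ≫ θ₀₁₃)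

theorem ofCocycle_δ_zero :
    (ofCocycle _ _ _ _ e).restrict (SimplexCategory.δ 0) = ofTri θ₁₂₃ := eq_ofTri _

theorem ofCocycle_δ_one :
    (ofCocycle _ _ _ _ e).restrict (SimplexCategory.δ 1) = ofTri θ₀₂₃ := eq_ofTri _

theorem ofCocycle_δ_two :
    (ofCocycle _ _ _ _ e).restrict (SimplexCategory.δ 2) = ofTri θ₀₁₃ := eq_ofTri _

theorem ofCocycle_δ_three :
    (ofCocycle _ _ _ _ e).restrict (SimplexCategory.δ 3) = ofTri θ₀₁₂ := eq_ofTri _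

end Tetrahedron

end DuskinSimplex

/-! ### Operads indexed by a bicategory -/

open Bicategory in
/-- A categorical operad indexed by the cells of a bicategory `C`: categories `Q A` for the objects
and `R f` for the maps (the fibers of the maps), an action of `R f` from `Q B` to `Q A` for
`f : A ⟶ B`, and a composition `R g × R f ⥤ R h` for every lax triangle `f ≫ g ⟶ h`. The
composition is associative for every tetrahedron of the nerve of `C`, and the units are neutral for
the degenerate triangles. -/
structure IndexedOperad (C : Type u) [Bicategory.{u, u} C] where
  Q : C → Type u
  R : ∀ {A B : C}, (A ⟶ B) → Type u
  [catQ : ∀ A, SmallCategory (Q A)]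
  [catR : ∀ {A B : C} (f : A ⟶ B), SmallCategory (R f)]
  act : ∀ {A B : C} (f : A ⟶ B), Q B × R f ⥤ Q A
  mul : ∀ {A B D : C} {f : A ⟶ B} {g : B ⟶ D} {h : A ⟶ D}, (f ≫ g ⟶ h) → (R g × R f ⥤ R h)
  unit : ∀ A, R (𝟙 A)
  act_act : ∀ {A B D : C} {f : A ⟶ B} {g : B ⟶ D} {h : A ⟶ D} (θ : f ≫ g ⟶ h),
    (act g).prod (𝟭 (R f)) ⋙ act f =
      prod.associator (Q D) (R g) (R f) ⋙ (𝟭 (Q D)).prod (mul θ) ⋙ act h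
  mul_mul : ∀ {A B D E : C} {f₀₁ : A ⟶ B} {f₁₂ : B ⟶ D} {f₂₃ : D ⟶ E} {f₀₂ : A ⟶ D}
    {f₁₃ : B ⟶ E} {f₀₃ : A ⟶ E} (θ₀₁₂ : f₀₁ ≫ f₁₂ ⟶ f₀₂) (θ₁₂₃ : f₁₂ ≫ f₂₃ ⟶ f₁₃)
    (θ₀₁₃ : f₀₁ ≫ f₁₃ ⟶ f₀₃) (θ₀₂₃ : f₀₂ ≫ f₂₃ ⟶ f₀₃),
    θ₀₁₂ ▷ f₂₃ ≫ θ₀₂₃ = (α_ f₀₁ f₁₂ f₂₃).hom ≫ f₀₁ ◁ θ₁₂₃ ≫ θ₀₁₃ →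
    (mul θ₁₂₃).prod (𝟭 (R f₀₁)) ⋙ mul θ₀₁₃ =
      prod.associator (R f₂₃) (R f₁₂) (R f₀₁) ⋙ (𝟭 (R f₂₃)).prod (mul θ₀₁₂) ⋙ mul θ₀₂₃
  act_unit : ∀ A, (𝟭 (Q A)).prod' ((Functor.const (Q A)).obj (unit A)) ⋙ act (𝟙 A) = 𝟭 (Q A)
  mul_unit : ∀ {A B : C} (f : A ⟶ B),
    (𝟭 (R f)).prod' ((Functor.const (R f)).obj (unit A)) ⋙ mul (λ_ f).hom = 𝟭 (R f)
  unit_mul : ∀ {A B : C} (f : A ⟶ B),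
    ((Functor.const (R f)).obj (unit B)).prod' (𝟭 (R f)) ⋙ mul (ρ_ f).hom = 𝟭 (R f)

namespace IndexedOperad

open Bicategory

attribute [instance] catQ catR

variable {C : Type u} [Bicategory.{u, u} C] (T : IndexedOperad C) {A B D E : C}

theorem act_act_map {f : A ⟶ B} {g : B ⟶ D} {h : A ⟶ D} (θ : f ≫ g ⟶ h) {c c' : T.Q D}
    {q q' : T.R g} {p p' : T.R f} (u : c ⟶ c') (v : q ⟶ q') (w : p ⟶ p') :
    (T.act f).map (Prod.mkHom ((T.act g).map (Prod.mkHom u v)) w) ~ₕ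
      (T.act h).map (Prod.mkHom u ((T.mul θ).map (Prod.mkHom v w))) :=
  HomEq.of_functor_eq (T.act_act θ) (Prod.mkHom (Prod.mkHom u v) w)

theorem mul_mul_map {f₀₁ : A ⟶ B} {f₁₂ : B ⟶ D} {f₂₃ : D ⟶ E} {f₀₂ : A ⟶ D} {f₁₃ : B ⟶ E}
    {f₀₃ : A ⟶ E} {θ₀₁₂ : f₀₁ ≫ f₁₂ ⟶ f₀₂} {θ₁₂₃ : f₁₂ ≫ f₂₃ ⟶ f₁₃} {θ₀₁₃ : f₀₁ ≫ f₁₃ ⟶ f₀₃}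
    {θ₀₂₃ : f₀₂ ≫ f₂₃ ⟶ f₀₃}
    (e : θ₀₁₂ ▷ f₂₃ ≫ θ₀₂₃ = (α_ f₀₁ f₁₂ f₂₃).hom ≫ f₀₁ ◁ θ₁₂₃ ≫ θ₀₁₃) {r r' : T.R f₂₃}
    {q q' : T.R f₁₂} {p p' : T.R f₀₁} (u : r ⟶ r') (v : q ⟶ q') (w : p ⟶ p') :
    (T.mul θ₀₁₃).map (Prod.mkHom ((T.mul θ₁₂₃).map (Prod.mkHom u v)) w) ~ₕ
      (T.mul θ₀₂₃).map (Prod.mkHom u ((T.mul θ₀₁₂).map (Prod.mkHom v w))) :=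
  HomEq.of_functor_eq (T.mul_mul _ _ _ _ e) (Prod.mkHom (Prod.mkHom u v) w)

theorem act_unit_map {a a' : T.Q A} (u : a ⟶ a') :
    (T.act (𝟙 A)).map (Prod.mkHom u (𝟙 (T.unit A))) ~ₕ u :=
  HomEq.of_functor_eq (T.act_unit A) u

theorem mul_unit_map {f : A ⟶ B} {p p' : T.R f} (u : p ⟶ p') :
    (T.mul (λ_ f).hom).map (Prod.mkHom u (𝟙 (T.unit A))) ~ₕ u :=
  HomEq.of_functor_eq (T.mul_unit f) u

theorem unit_mul_map {f : A ⟶ B} {p p' : T.R f} (u : p ⟶ p') :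
    (T.mul (ρ_ f).hom).map (Prod.mkHom (𝟙 (T.unit B)) u) ~ₕ u :=
  HomEq.of_functor_eq (T.unit_mul f) u

theorem mul_map_congr {f : A ⟶ B} {g : B ⟶ D} {h : A ⟶ D} {θ θ' : f ≫ g ⟶ h} (e : θ = θ')
    {x y : T.R g × T.R f} (u : x ⟶ y) : (T.mul θ).map u ~ₕ (T.mul θ').map u :=
  HomEq.of_functor_eq (congrArg T.mul e) u

/-- The functor between fibers induced by a 2-cell `θ : f ⟶ f'`, which composes with the unit
along the lax triangle `f ≫ 𝟙 ⟶ f'` given by `θ`. -/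
def push {f f' : A ⟶ B} (θ : f ⟶ f') : T.R f ⥤ T.R f' :=
  ((Functor.const (T.R f)).obj (T.unit B)).prod' (𝟭 (T.R f)) ⋙ T.mul ((ρ_ f).hom ≫ θ)

theorem push_map_congr {f f' : A ⟶ B} {θ θ' : f ⟶ f'} (e : θ = θ') {p p' : T.R f} (u : p ⟶ p') :
    (T.push θ).map u ~ₕ (T.push θ').map u :=
  HomEq.of_functor_eq (congrArg T.push e) u

theorem push_id {f : A ⟶ B} {p p' : T.R f} (u : p ⟶ p') : (T.push (𝟙 f)).map u ~ₕ u :=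
  (T.mul_map_congr (Category.comp_id _) _).trans (T.unit_mul_map u)

/-- The action does not change when the fiber is pushed forward. -/
theorem act_push {f f' : A ⟶ B} (θ : f ⟶ f') {a a' : T.Q B} {p p' : T.R f} (u : a ⟶ a')
    (v : p ⟶ p') :
    (T.act f').map (Prod.mkHom u ((T.push θ).map v)) ~ₕ (T.act f).map (Prod.mkHom u v) :=
  (T.act_act_map ((ρ_ f).hom ≫ θ) u (𝟙 _) v).symm.trans
    (((T.act_unit_map u).prodMk .rfl).map _)

/-- Associativity with a unit in the first place: pushing a composite forward amounts to composing
along the pasted lax triangle. -/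
theorem push_mul {f : A ⟶ B} {g : B ⟶ D} {h h' : A ⟶ D} (θ : f ≫ g ⟶ h) (η : h ⟶ h')
    {q q' : T.R g} {p p' : T.R f} (u : q ⟶ q') (v : p ⟶ p') :
    (T.push η).map ((T.mul θ).map (Prod.mkHom u v)) ~ₕ
      (T.mul (θ ≫ η)).map (Prod.mkHom u v) :=
  (T.mul_mul_map (θ₁₂₃ := (ρ_ g).hom) (θ₀₁₃ := θ ≫ η) (by simp) (𝟙 _) u v).symm.trans
    (((T.unit_mul_map u).prodMk .rfl).map _)

theorem push_comp {f f' f'' : A ⟶ B} (θ : f ⟶ f') (η : f' ⟶ f'') {p p' : T.R f} (u : p ⟶ p') :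
    (T.push η).map ((T.push θ).map u) ~ₕ (T.push (θ ≫ η)).map u :=
  (T.push_mul _ _ _ _).trans (T.mul_map_congr (Category.assoc _ _ _) _)

/-- Associativity with a unit in the first place, for a 2-cell on the second edge of the lax
triangle. -/
theorem mul_push_left {f : A ⟶ B} {g g' : B ⟶ D} {h : A ⟶ D} (η : g ⟶ g') (θ : f ≫ g' ⟶ h)
    {q q' : T.R g} {p p' : T.R f} (u : q ⟶ q') (v : p ⟶ p') :
    (T.mul θ).map (Prod.mkHom ((T.push η).map u) v) ~ₕ
      (T.mul (f ◁ η ≫ θ)).map (Prod.mkHom u v) :=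
  (T.mul_mul_map (θ₀₁₂ := f ◁ η ≫ θ) (θ₀₂₃ := (ρ_ h).hom) (by simp) (𝟙 _) u v).trans
    (T.unit_mul_map _)

/-- Associativity with a unit in the middle: a push forward of the second factor moves into the
lax triangle. -/
theorem mul_push_right {f f' : A ⟶ B} {g : B ⟶ D} {h : A ⟶ D} (η : f ⟶ f') (θ : f' ≫ g ⟶ h)
    {q q' : T.R g} {p p' : T.R f} (u : q ⟶ q') (v : p ⟶ p') :
    (T.mul θ).map (Prod.mkHom u ((T.push η).map v)) ~ₕ
      (T.mul (η ▷ g ≫ θ)).map (Prod.mkHom u v) :=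
  (T.mul_mul_map (θ₁₂₃ := (λ_ g).hom) (θ₀₁₃ := η ▷ g ≫ θ) (by simp) u (𝟙 _) v).symm.trans
    (((T.mul_unit_map u).prodMk .rfl).map _)

theorem push_whiskerLeft (f : A ⟶ B) {g g' : B ⟶ D} (η : g ⟶ g') {q q' : T.R g} {p p' : T.R f}
    (u : q ⟶ q') (v : p ⟶ p') :
    (T.push (f ◁ η)).map ((T.mul (𝟙 (f ≫ g))).map (Prod.mkHom u v)) ~ₕ
      (T.mul (𝟙 (f ≫ g'))).map (Prod.mkHom ((T.push η).map u) v) :=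
  (T.push_mul _ _ _ _).trans ((T.mul_map_congr (by simp) _).trans (T.mul_push_left _ _ _ _).symm)

theorem push_whiskerRight {f f' : A ⟶ B} (η : f ⟶ f') (g : B ⟶ D) {q q' : T.R g} {p p' : T.R f}
    (u : q ⟶ q') (v : p ⟶ p') :
    (T.push (η ▷ g)).map ((T.mul (𝟙 (f ≫ g))).map (Prod.mkHom u v)) ~ₕ
      (T.mul (𝟙 (f' ≫ g))).map (Prod.mkHom u ((T.push η).map v)) :=
  (T.push_mul _ _ _ _).trans ((T.mul_map_congr (by simp) _).trans (T.mul_push_right _ _ _ _).symm)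

theorem push_associator (f : A ⟶ B) (g : B ⟶ D) (h : D ⟶ E) {r r' : T.R h} {q q' : T.R g}
    {p p' : T.R f} (u : r ⟶ r') (v : q ⟶ q') (w : p ⟶ p') :
    (T.push (α_ f g h).hom).map ((T.mul (𝟙 _)).map
        (Prod.mkHom u ((T.mul (𝟙 _)).map (Prod.mkHom v w)))) ~ₕ
      (T.mul (𝟙 _)).map (Prod.mkHom ((T.mul (𝟙 _)).map (Prod.mkHom u v)) w) :=
  (T.push_mul _ _ _ _).trans (T.mul_mul_map (by simp) u v w).symm

theorem push_leftUnitor (f : A ⟶ B) {p p' : T.R f} (u : p ⟶ p') :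
    (T.push (λ_ f).hom).map ((T.mul (𝟙 _)).map (Prod.mkHom u (𝟙 (T.unit A)))) ~ₕ u :=
  (T.push_mul _ _ _ _).trans ((T.mul_map_congr (by simp) _).trans (T.mul_unit_map u))

theorem push_rightUnitor (f : A ⟶ B) {p p' : T.R f} (u : p ⟶ p') :
    (T.push (ρ_ f).hom).map ((T.mul (𝟙 _)).map (Prod.mkHom (𝟙 (T.unit B)) u)) ~ₕ u :=
  (T.push_mul _ _ _ _).trans ((T.mul_map_congr (by simp) _).trans (T.unit_mul_map u))

/-- Equations of the form `push θ u = v` can be inverted if `θ` is invertible. -/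
theorem push_inv {f f' : A ⟶ B} (θ : f ≅ f') {p p' : T.R f} {q q' : T.R f'} {u : p ⟶ p'}
    {v : q ⟶ q'} (h : (T.push θ.hom).map u ~ₕ v) : (T.push θ.inv).map v ~ₕ u :=
  (h.symm.map _).trans ((T.push_comp _ _ _).trans
    ((T.push_map_congr θ.hom_inv_id _).trans (T.push_id u)))

/-! ### The total bicategory of an indexed operad -/

/-- The objects of the total bicategory: pairs `(A, a)` with `a ∈ Q A`. -/
structure Total where
  base : C
  a : T.Q base

namespace Total

variable {T}

/-- The maps `(A, a) ⟶ (B, b)` of the total bicategory: triples `(f, p, α)` with `f : A ⟶ B`,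
`p ∈ R f` and `α : b ·_f p ⟶ a`. -/
structure Hom (X Y : T.Total) where
  f : X.base ⟶ Y.base
  p : T.R f
  α : (T.act f).obj (Y.a, p) ⟶ X.a

/-- The 2-cells `(f, p, α) ⟶ (f', p', α')` of the total bicategory: a 2-cell `θ : f ⟶ f'`, and a
map `ω` from the image of `p` under `θ` to `p'` which is compatible with `α` and `α'`. -/
structure Hom₂ {X Y : T.Total} (F G : Hom X Y) where
  θ : F.f ⟶ G.f
  ω : (T.push θ).obj F.p ⟶ G.p
  compat : (T.act G.f).map (Prod.mkHom (𝟙 Y.a) ω) ≫ G.α ~ₕ F.α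

variable {X Y Z W : T.Total}

theorem Hom₂.ext {F G : Hom X Y} {η η' : Hom₂ F G} (h : η.θ = η'.θ) (h' : η.ω ~ₕ η'.ω) :
    η = η' := by
  obtain ⟨θ, ω, _⟩ := η
  obtain ⟨θ', ω', _⟩ := η'
  obtain rfl : θ = θ' := h
  obtain rfl : ω = ω' := h'.eq
  rfl

/-- A 2-cell whose second component is given with its source up to equality. -/
def Hom₂.ofEq {F G : Hom X Y} (θ : F.f ⟶ G.f) {x : T.R G.f} (hx : (T.push θ).obj F.p = x)
    (ω : x ⟶ G.p) (h : (T.act G.f).map (Prod.mkHom (𝟙 Y.a) ω) ≫ G.α ~ₕ F.α) : Hom₂ F G where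
  θ := θ
  ω := eqToHom hx ≫ ω
  compat := ((HomEq.rfl.prodMk (.eqToHom_comp hx ω)).map _).comp .rfl |>.trans h

theorem Hom₂.ofEq_ω {F G : Hom X Y} {θ : F.f ⟶ G.f} {x : T.R G.f}
    (hx : (T.push θ).obj F.p = x) (ω : x ⟶ G.p)
    (h : (T.act G.f).map (Prod.mkHom (𝟙 Y.a) ω) ≫ G.α ~ₕ F.α) : (ofEq θ hx ω h).ω ~ₕ ω :=
  .eqToHom_comp hx ω

/-- A 2-cell with second component an identity. -/
def Hom₂.pure {F G : Hom X Y} (θ : F.f ⟶ G.f) (hp : (T.push θ).obj F.p = G.p)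
    (hα : F.α ~ₕ G.α) : Hom₂ F G :=
  ofEq θ hp (𝟙 _) (.id_comp (.of_eq ((T.act G.f).map_id _)) hα.symm)

theorem Hom₂.pure_ω {F G : Hom X Y} {θ : F.f ⟶ G.f} (hp : (T.push θ).obj F.p = G.p)
    (hα : F.α ~ₕ G.α) : (pure θ hp hα).ω ~ₕ 𝟙 G.p := ofEq_ω _ _ _

theorem push_obj_id {f : A ⟶ B} (p : T.R f) : (T.push (𝟙 f)).obj p = p := (T.push_id (𝟙 p)).left

theorem push_obj_comp {f f' f'' : A ⟶ B} (θ : f ⟶ f') (η : f' ⟶ f'') (p : T.R f) :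
    (T.push (θ ≫ η)).obj p = (T.push η).obj ((T.push θ).obj p) :=
  (T.push_comp θ η (𝟙 p)).left.symm

theorem map_mkHom_id_comp {𝒜 ℬ 𝒟 : Type*} [Category* 𝒜] [Category* ℬ] [Category* 𝒟]
    (F : 𝒜 × ℬ ⥤ 𝒟) (a : 𝒜) {x y z : ℬ} (u : x ⟶ y) (v : y ⟶ z) :
    F.map (Prod.mkHom (𝟙 a) (u ≫ v)) =
      F.map (Prod.mkHom (𝟙 a) u) ≫ F.map (Prod.mkHom (𝟙 a) v) := by
  rw [← F.map_comp]
  simp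

theorem map_mkHom_comp_id {𝒜 ℬ 𝒟 : Type*} [Category* 𝒜] [Category* ℬ] [Category* 𝒟]
    (F : 𝒜 × ℬ ⥤ 𝒟) {x y z : 𝒜} (u : x ⟶ y) (v : y ⟶ z) (b : ℬ) :
    F.map (Prod.mkHom (u ≫ v) (𝟙 b)) =
      F.map (Prod.mkHom u (𝟙 b)) ≫ F.map (Prod.mkHom v (𝟙 b)) := by
  rw [← F.map_comp]
  simp

theorem map_mkHom_exchange {𝒜 ℬ 𝒟 : Type*} [Category* 𝒜] [Category* ℬ] [Category* 𝒟]
    (F : 𝒜 × ℬ ⥤ 𝒟) {x y : 𝒜} {z w : ℬ} (u : x ⟶ y) (v : z ⟶ w) :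
    F.map (Prod.mkHom u (𝟙 z)) ≫ F.map (Prod.mkHom (𝟙 y) v) =
      F.map (Prod.mkHom (𝟙 x) v) ≫ F.map (Prod.mkHom u (𝟙 w)) := by
  rw [← F.map_comp, ← F.map_comp]
  simp

theorem map_mkHom_id {𝒜 ℬ 𝒟 : Type*} [Category* 𝒜] [Category* ℬ] [Category* 𝒟]
    (F : 𝒜 × ℬ ⥤ 𝒟) {a a' x : 𝒜} {b b' y : ℬ} {u : a ⟶ a'} {v : b ⟶ b'} (hu : u ~ₕ 𝟙 x)
    (hv : v ~ₕ 𝟙 y) : F.map (Prod.mkHom u v) ~ₕ 𝟙 (F.obj (x, y)) :=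
  ((hu.prodMk hv).map F).trans (.of_eq (F.map_id (x, y)))

/-- The vertical composite of `(θ, ω)` and `(θ', ω')` is `(θ ≫ θ', push θ' ω ≫ ω')`. -/
instance homCategory (X Y : T.Total) : Category (Hom X Y) where
  Hom := Hom₂
  id F := .pure (𝟙 _) (push_obj_id _) .rfl
  comp {F G H} η ζ := .ofEq (η.θ ≫ ζ.θ) (push_obj_comp _ _ _) ((T.push ζ.θ).map η.ω ≫ ζ.ω) (by
    rw [map_mkHom_id_comp, Category.assoc]
    exact ((T.act_push _ _ _).comp ζ.compat).trans η.compat)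
  id_comp η := Hom₂.ext (Category.id_comp _) ((Hom₂.ofEq_ω _ _ _).trans
    (.id_comp ((Hom₂.pure_ω _ _).map_id _) .rfl))
  comp_id η := Hom₂.ext (Category.comp_id _) ((Hom₂.ofEq_ω _ _ _).trans
    (.comp_id (T.push_id _) (Hom₂.pure_ω _ _)))
  assoc η ζ ι := Hom₂.ext (Category.assoc _ _ _) ((Hom₂.ofEq_ω _ _ _).trans
    (.trans (((Hom₂.ofEq_ω _ _ _).map _).comp .rfl) (.trans
      (.of_eq ((congrArg (· ≫ ι.ω) ((T.push ι.θ).map_comp _ _)).trans (Category.assoc _ _ _)))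
      (((T.push_comp _ _ _).comp (Hom₂.ofEq_ω _ _ _).symm).trans (Hom₂.ofEq_ω _ _ _).symm))))

theorem hom₂_ext {F G : Hom X Y} {η η' : F ⟶ G} (h : η.θ = η'.θ) (h' : η.ω ~ₕ η'.ω) : η = η' :=
  Hom₂.ext h h'

theorem id_ω (F : Hom X Y) : Hom₂.ω (𝟙 F) ~ₕ 𝟙 F.p := Hom₂.pure_ω _ _

theorem comp_ω {F G H : Hom X Y} (η : F ⟶ G) (ζ : G ⟶ H) :
    (η ≫ ζ).ω ~ₕ (T.push ζ.θ).map η.ω ≫ ζ.ω := Hom₂.ofEq_ω _ _ _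

/-- An invertible 2-cell with second component an identity. -/
def pureIso {F G : Hom X Y} (θ : F.f ≅ G.f) (hp : (T.push θ.hom).obj F.p = G.p)
    (hα : F.α ~ₕ G.α) : F ≅ G where
  hom := Hom₂.pure θ.hom hp hα
  inv := Hom₂.pure θ.inv (T.push_inv θ (u := 𝟙 F.p) (v := 𝟙 G.p)
    ((HomEq.of_eq ((T.push θ.hom).map_id _)).trans (.id hp))).left hα.symm
  hom_inv_id := hom₂_ext θ.hom_inv_id ((comp_ω _ _).trans
    ((HomEq.id_comp (.map_id _ (Hom₂.pure_ω _ _)) (Hom₂.pure_ω _ _)).trans (id_ω _).symm))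
  inv_hom_id := hom₂_ext θ.inv_hom_id ((comp_ω _ _).trans
    ((HomEq.id_comp (.map_id _ (Hom₂.pure_ω _ _)) (Hom₂.pure_ω _ _)).trans (id_ω _).symm))

theorem pureIso_hom_ω {F G : Hom X Y} (θ : F.f ≅ G.f) (hp : (T.push θ.hom).obj F.p = G.p)
    (hα : F.α ~ₕ G.α) : (pureIso θ hp hα).hom.ω ~ₕ 𝟙 G.p := Hom₂.pure_ω hp hα

theorem pureIso_inv_ω {F G : Hom X Y} (θ : F.f ≅ G.f) (hp : (T.push θ.hom).obj F.p = G.p)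
    (hα : F.α ~ₕ G.α) : (pureIso θ hp hα).inv.ω ~ₕ 𝟙 F.p := Hom₂.pure_ω _ hα.symm

/-- The composite of `(f, p, α)` and `(g, q, β)` is `(f ≫ g, q · p, (β · p) ≫ α)`, where `q · p`
is formed along the strict triangle on `f` and `g`; the identity of `(A, a)` has the unit as its
second component. -/
instance : CategoryStruct T.Total where
  Hom := Hom
  id X := ⟨𝟙 _, T.unit _, eqToHom (T.act_unit_map (𝟙 X.a)).left⟩
  comp F G := ⟨F.f ≫ G.f, (T.mul (𝟙 _)).obj (G.p, F.p),
    eqToHom (T.act_act_map (𝟙 _) (𝟙 _) (𝟙 G.p) (𝟙 F.p)).left.symm ≫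
      (T.act F.f).map (Prod.mkHom G.α (𝟙 F.p)) ≫ F.α⟩

instance homCategory' (X Y : T.Total) : Category (X ⟶ Y) := homCategory X Y

theorem id_α (X : T.Total) : Hom.α (𝟙 X) ~ₕ 𝟙 X.a :=
  .eqToHom (T.act_unit_map (𝟙 X.a)).left

theorem comp_α (F : X ⟶ Y) (G : Y ⟶ Z) :
    (F ≫ G).α ~ₕ (T.act F.f).map (Prod.mkHom G.α (𝟙 F.p)) ≫ F.α := .eqToHom_comp _ _

/-- Whiskering on the left in the total bicategory. -/
def whiskerLeft (F : X ⟶ Y) {G H : Y ⟶ Z} (η : G ⟶ H) : F ≫ G ⟶ F ≫ H :=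
  .ofEq (F.f ◁ η.θ) (T.push_whiskerLeft F.f η.θ (𝟙 G.p) (𝟙 F.p)).left
    ((T.mul (𝟙 _)).map (Prod.mkHom η.ω (𝟙 F.p)))
    (((T.act_act_map (𝟙 (F.f ≫ H.f)) (𝟙 _) η.ω (𝟙 F.p)).symm.comp (comp_α F H)).trans <|
      (HomEq.of_eq ((Category.assoc _ _ _).symm.trans
        (congrArg (· ≫ F.α) (map_mkHom_comp_id (T.act F.f) _ _ _).symm))).trans <|
      (((η.compat.prodMk .rfl).map _).comp .rfl).trans (comp_α F G).symm)

theorem whiskerLeft_ω (F : X ⟶ Y) {G H : Y ⟶ Z} (η : G ⟶ H) :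
    (whiskerLeft F η).ω ~ₕ (T.mul (𝟙 _)).map (Prod.mkHom η.ω (𝟙 F.p)) :=
  .eqToHom_comp (T.push_whiskerLeft F.f η.θ (𝟙 G.p) (𝟙 F.p)).left _

/-- Whiskering on the right in the total bicategory. -/
def whiskerRight {F G : X ⟶ Y} (η : F ⟶ G) (H : Y ⟶ Z) : F ≫ H ⟶ G ≫ H :=
  .ofEq (η.θ ▷ H.f) (T.push_whiskerRight η.θ H.f (𝟙 H.p) (𝟙 F.p)).left
    ((T.mul (𝟙 _)).map (Prod.mkHom (𝟙 H.p) η.ω))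
    (((T.act_act_map (𝟙 (G.f ≫ H.f)) (𝟙 _) (𝟙 H.p) η.ω).symm.comp (comp_α G H)).trans <|
      ((((HomEq.of_eq ((T.act H.f).map_id _)).prodMk .rfl).map _).comp .rfl).trans <|
      (HomEq.of_eq ((Category.assoc _ _ _).symm.trans
        ((congrArg (· ≫ G.α) (map_mkHom_exchange (T.act G.f) H.α η.ω).symm).trans
          (Category.assoc _ _ _)))).trans <|
      ((((HomEq.rfl.prodMk (.of_eq ((T.push η.θ).map_id _).symm)).map _).trans
        (T.act_push η.θ H.α (𝟙 F.p))).comp η.compat).trans (comp_α F H).symm)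

theorem whiskerRight_ω {F G : X ⟶ Y} (η : F ⟶ G) (H : Y ⟶ Z) :
    (whiskerRight η H).ω ~ₕ (T.mul (𝟙 _)).map (Prod.mkHom (𝟙 H.p) η.ω) :=
  .eqToHom_comp (T.push_whiskerRight η.θ H.f (𝟙 H.p) (𝟙 F.p)).left _

theorem whisker_p_id (F : X ⟶ Y) (G : Y ⟶ Z) :
    (T.mul (𝟙 _)).map (Prod.mkHom (𝟙 G.p) (𝟙 F.p)) ~ₕ 𝟙 (F ≫ G).p :=
  .of_eq ((T.mul (𝟙 (F.f ≫ G.f))).map_id _)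

/-- The associator of the total bicategory. -/
def associator (F : X ⟶ Y) (G : Y ⟶ Z) (H : Z ⟶ W) : (F ≫ G) ≫ H ≅ F ≫ G ≫ H :=
  pureIso (α_ F.f G.f H.f) (T.push_associator F.f G.f H.f (𝟙 H.p) (𝟙 G.p) (𝟙 F.p)).left <|
    (comp_α (F ≫ G) H).trans <|
      (((((HomEq.rfl.prodMk (whisker_p_id F G).symm).map _).trans
        (T.act_act_map (𝟙 (F.f ≫ G.f)) H.α (𝟙 G.p) (𝟙 F.p)).symm).comp (comp_α F G)).trans <|
      (HomEq.of_eq ((Category.assoc _ _ _).symm.trans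
        (congrArg (· ≫ F.α) (map_mkHom_comp_id (T.act F.f) _ _ _).symm))).trans <|
      ((((comp_α G H).symm.prodMk .rfl).map _).comp .rfl).trans (comp_α F (G ≫ H)).symm)

/-- The left unitor of the total bicategory. -/
def leftUnitor (F : X ⟶ Y) : 𝟙 X ≫ F ≅ F :=
  pureIso (λ_ F.f) (T.push_leftUnitor F.f (𝟙 F.p)).left <|
    (comp_α (𝟙 X) F).trans (.comp_id (T.act_unit_map F.α) (id_α X))

/-- The right unitor of the total bicategory. -/
def rightUnitor (F : X ⟶ Y) : F ≫ 𝟙 Y ≅ F :=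
  pureIso (ρ_ F.f) (T.push_rightUnitor F.f (𝟙 F.p)).left <|
    (comp_α F (𝟙 Y)).trans (.id_comp (map_mkHom_id _ (id_α Y) .rfl) .rfl)

/-- A 2-cell is pure if its second component is an identity up to equality of its endpoints. -/
def IsPure {F G : X ⟶ Y} (η : F ⟶ G) : Prop := η.ω ~ₕ 𝟙 G.p

theorem IsPure.comp {F G H : X ⟶ Y} {η : F ⟶ G} {ζ : G ⟶ H} (h : IsPure η) (h' : IsPure ζ) :
    IsPure (η ≫ ζ) :=
  (comp_ω η ζ).trans (.id_comp (h.map_id _) h')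

theorem IsPure.whiskerLeft (F : X ⟶ Y) {G H : Y ⟶ Z} {η : G ⟶ H} (h : IsPure η) :
    IsPure (whiskerLeft F η) :=
  (whiskerLeft_ω F η).trans (map_mkHom_id _ h .rfl)

theorem IsPure.whiskerRight {F G : X ⟶ Y} {η : F ⟶ G} (h : IsPure η) (H : Y ⟶ Z) :
    IsPure (whiskerRight η H) :=
  (whiskerRight_ω η H).trans (map_mkHom_id _ .rfl h)

theorem IsPure.ext {F G : X ⟶ Y} {η ζ : F ⟶ G} (h : IsPure η) (h' : IsPure ζ)
    (e : η.θ = ζ.θ) : η = ζ := hom₂_ext e (h.trans h'.symm)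

theorem isPure_id (F : X ⟶ Y) : IsPure (𝟙 F) := id_ω F

theorem isPure_associator (F : X ⟶ Y) (G : Y ⟶ Z) (H : Z ⟶ W) :
    IsPure (associator F G H).hom := pureIso_hom_ω _ _ _

theorem isPure_leftUnitor (F : X ⟶ Y) : IsPure (leftUnitor F).hom := pureIso_hom_ω _ _ _

theorem isPure_rightUnitor (F : X ⟶ Y) : IsPure (rightUnitor F).hom := pureIso_hom_ω _ _ _

theorem isPure_associator_inv (F : X ⟶ Y) (G : Y ⟶ Z) (H : Z ⟶ W) :
    IsPure (associator F G H).inv := pureIso_inv_ω _ _ _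

theorem isPure_leftUnitor_inv (F : X ⟶ Y) : IsPure (leftUnitor F).inv := pureIso_inv_ω _ _ _

theorem isPure_rightUnitor_inv (F : X ⟶ Y) : IsPure (rightUnitor F).inv := pureIso_inv_ω _ _ _

/-- The second component of a composite with pure 2-cells on both sides. -/
theorem pure_comp_pure_ω {F G G' H : X ⟶ Y} {η : F ⟶ G} {ζ : G ⟶ G'} {ι : G' ⟶ H}
    (h : IsPure η) (h' : IsPure ι) : (η ≫ ζ ≫ ι).ω ~ₕ (T.push ι.θ).map ζ.ω :=
  (comp_ω _ _).trans (.id_comp (h.map_id _) ((comp_ω _ _).trans (.comp_id .rfl h')))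

/-- The axioms hold in the first component because they hold in `C`. In the second component they
are the compatibilities of `push` with whiskering, the associator and the unitors; the structural
2-cells are pure, so equations between composites of these only concern the first component. -/
instance bicategory : Bicategory T.Total where
  homCategory X Y := homCategory X Y
  whiskerLeft := whiskerLeft
  whiskerRight := whiskerRight
  associator := associator
  leftUnitor := leftUnitor
  rightUnitor := rightUnitor
  whiskerLeft_id F G := (IsPure.whiskerLeft F (isPure_id G)).ext (isPure_id _)
    (Bicategory.whiskerLeft_id F.f G.f)
  whiskerLeft_comp F G H I η ζ := hom₂_ext (Bicategory.whiskerLeft_comp F.f η.θ ζ.θ) <| by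
    refine (whiskerLeft_ω _ _).trans (.trans ?_ (comp_ω _ _).symm)
    refine (((comp_ω _ _).prodMk .rfl).map _).trans (.trans ?_
      ((((whiskerLeft_ω _ _).map _).trans (T.push_whiskerLeft _ _ _ _)).comp
        (whiskerLeft_ω _ _)).symm)
    exact HomEq.of_eq (map_mkHom_comp_id _ _ _ _)
  id_whiskerLeft {X Y F G} η := hom₂_ext (Bicategory.id_whiskerLeft η.θ) <|
    (whiskerLeft_ω _ _).trans (.trans (T.push_inv (λ_ G.f) (T.push_leftUnitor G.f η.ω)).symm
      (pure_comp_pure_ω (isPure_leftUnitor F) (isPure_leftUnitor_inv G)).symm)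
  comp_whiskerLeft F G H I η := hom₂_ext (Bicategory.comp_whiskerLeft F.f G.f η.θ) <| by
    refine (whiskerLeft_ω _ _).trans (.trans ?_
      (pure_comp_pure_ω (isPure_associator F G H) (isPure_associator_inv _ _ _)).symm)
    refine .trans ?_ (((whiskerLeft_ω _ _).trans
      (((whiskerLeft_ω _ _).prodMk .rfl).map _)).map _).symm
    refine .trans ?_ (T.push_inv _ (T.push_associator _ _ _ _ _ _)).symm
    exact (HomEq.rfl.prodMk (whisker_p_id F G).symm).map _
  id_whiskerRight F G := (IsPure.whiskerRight (isPure_id F) G).ext (isPure_id _)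
    (Bicategory.id_whiskerRight F.f G.f)
  comp_whiskerRight {X Y Z F G H} η ζ I :=
    hom₂_ext (Bicategory.comp_whiskerRight η.θ ζ.θ I.f) <| by
    refine (whiskerRight_ω _ _).trans (.trans ?_ (comp_ω _ _).symm)
    refine ((HomEq.rfl.prodMk (comp_ω _ _)).map _).trans (.trans ?_
      ((((whiskerRight_ω _ _).map _).trans (T.push_whiskerRight _ _ _ _)).comp
        (whiskerRight_ω _ _)).symm)
    exact HomEq.of_eq (map_mkHom_id_comp _ _ _ _)
  whiskerRight_id {X Y F G} η := hom₂_ext (Bicategory.whiskerRight_id η.θ) <|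
    (whiskerRight_ω _ _).trans (.trans (T.push_inv (ρ_ G.f) (T.push_rightUnitor G.f η.ω)).symm
      (pure_comp_pure_ω (isPure_rightUnitor F) (isPure_rightUnitor_inv G)).symm)
  whiskerRight_comp {X Y Z W F F'} η G H :=
    hom₂_ext (Bicategory.whiskerRight_comp η.θ G.f H.f) <| by
    refine (whiskerRight_ω _ _).trans (.trans ?_
      (pure_comp_pure_ω (isPure_associator_inv _ _ _) (isPure_associator F' G H)).symm)
    refine .trans ?_ (((whiskerRight_ω _ _).trans
      ((HomEq.rfl.prodMk (whiskerRight_ω _ _)).map _)).map _).symm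
    refine .trans ?_ (T.push_associator _ _ _ _ _ _).symm
    exact ((whisker_p_id G H).symm.prodMk .rfl).map _
  whisker_assoc {X Y Z W} F G G' η H := hom₂_ext (Bicategory.whisker_assoc F.f η.θ H.f) <| by
    refine (whiskerRight_ω _ _).trans (.trans ?_
      (pure_comp_pure_ω (isPure_associator F G H) (isPure_associator_inv _ _ _)).symm)
    refine .trans ?_ (((whiskerLeft_ω _ _).trans
      (((whiskerRight_ω _ _).prodMk .rfl).map _)).map _).symm
    refine .trans ?_ (T.push_inv _ (T.push_associator _ _ _ _ _ _)).symm
    exact (HomEq.rfl.prodMk (whiskerLeft_ω _ _)).map _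
  whisker_exchange {X Y Z F G H I} η ζ := hom₂_ext (Bicategory.whisker_exchange η.θ ζ.θ) <| by
    refine (comp_ω _ _).trans (.trans ?_ (comp_ω _ _).symm)
    refine ((((whiskerLeft_ω _ _).map _).trans ((T.push_whiskerRight _ _ _ _).trans
      ((HomEq.rfl.prodMk (.of_eq ((T.push η.θ).map_id _))).map _))).comp
        (whiskerRight_ω _ _)).trans (.trans (.of_eq (map_mkHom_exchange _ _ _)) ?_)
    exact ((((whiskerRight_ω _ _).map _).trans ((T.push_whiskerLeft _ _ _ _).trans
      (((HomEq.of_eq ((T.push ζ.θ).map_id _)).prodMk .rfl).map _))).comp (whiskerLeft_ω _ _)).symm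
  pentagon F G H I := IsPure.ext
    (((isPure_associator F G H).whiskerRight I).comp ((isPure_associator F (G ≫ H) I).comp
      ((isPure_associator G H I).whiskerLeft F)))
    ((isPure_associator _ _ _).comp (isPure_associator _ _ _))
    (Bicategory.pentagon F.f G.f H.f I.f)
  triangle F G := IsPure.ext ((isPure_associator _ _ _).comp ((isPure_leftUnitor G).whiskerLeft F))
    ((isPure_rightUnitor F).whiskerRight G) (Bicategory.triangle F.f G.f)

theorem hom_ext {F G : X ⟶ Y} (e : F.f = G.f) (hp : (T.push (eqToHom e)).obj F.p = G.p)
    (hα : F.α ~ₕ G.α) : F = G := by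
  obtain ⟨f, p, α⟩ := F
  obtain ⟨g, q, β⟩ := G
  obtain rfl : f = g := e
  obtain rfl : p = q := (push_obj_id p).symm.trans hp
  obtain rfl : α = β := hα.eq
  rfl

theorem eqToHom_θ {F G : X ⟶ Y} (h : F = G) :
    Hom₂.θ (eqToHom h) = eqToHom (congrArg Hom.f h) := by
  subst h
  rfl

theorem isPure_eqToHom {F G : X ⟶ Y} (h : F = G) : IsPure (eqToHom h) := by
  subst h
  exact isPure_id F

/-- A pure 2-cell over an equality is an equality. -/
theorem IsPure.eq {F G : X ⟶ Y} {η : F ⟶ G} (h : IsPure η) (e : F.f = G.f)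
    (hθ : η.θ = eqToHom e) : F = G :=
  hom_ext e (hθ ▸ h.left) (η.compat.symm.trans (.id_comp (map_mkHom_id _ .rfl h) .rfl))

theorem IsPure.eq_eqToIso {F G : X ⟶ Y} {η : F ≅ G} (h : IsPure η.hom) (e : F.f = G.f)
    (hθ : η.hom.θ = eqToHom e) (h' : F = G) : η = eqToIso h' :=
  Iso.ext (h.ext (isPure_eqToHom h') (hθ.trans (eqToHom_θ h').symm))

/-- The structural 2-cells are pure and lie over equalities, so they are equalities. -/
instance strict [Strict C] : Strict T.Total where
  id_comp F := (isPure_leftUnitor F).eq (Strict.id_comp F.f)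
    (congrArg Iso.hom (Strict.leftUnitor_eqToIso F.f))
  comp_id F := (isPure_rightUnitor F).eq (Strict.comp_id F.f)
    (congrArg Iso.hom (Strict.rightUnitor_eqToIso F.f))
  assoc F G H := (isPure_associator F G H).eq (Strict.assoc F.f G.f H.f)
    (congrArg Iso.hom (Strict.associator_eqToIso F.f G.f H.f))
  leftUnitor_eqToIso F := (isPure_leftUnitor F).eq_eqToIso (Strict.id_comp F.f)
    (congrArg Iso.hom (Strict.leftUnitor_eqToIso F.f)) _
  rightUnitor_eqToIso F := (isPure_rightUnitor F).eq_eqToIso (Strict.comp_id F.f)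
    (congrArg Iso.hom (Strict.rightUnitor_eqToIso F.f)) _
  associator_eqToIso F G H := (isPure_associator F G H).eq_eqToIso (Strict.assoc F.f G.f H.f)
    (congrArg Iso.hom (Strict.associator_eqToIso F.f G.f H.f)) _

end Total

end IndexedOperad

/-! ### The operad indexed by the cells of a unary operadic 2-category -/

namespace CategoricalOperad

variable {X : SSet.{u}} (P : CategoricalOperad X)

/-- Associativity with the faces of the lax triangle given up to equality. -/
theorem assoc' (t : X _⦋3⦌) {t₀ t₁ t₂ t₃ : X _⦋2⦌} (e₀ : X.δ 0 t = t₀) (e₁ : X.δ 1 t = t₁)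
    (e₂ : X.δ 2 t = t₂) (e₃ : X.δ 3 t = t₃) {x y z xy yz xyz : X _⦋1⦌}
    (h₀ : X.δ 0 t₀ = x) (h₁ : X.δ 2 t₀ = y) (h₂ : X.δ 1 t₀ = xy)
    (h₃ : X.δ 0 t₂ = xy) (h₄ : X.δ 2 t₂ = z) (h₅ : X.δ 1 t₂ = xyz)
    (h₆ : X.δ 0 t₃ = y) (h₇ : X.δ 2 t₃ = z) (h₈ : X.δ 1 t₃ = yz)
    (h₉ : X.δ 0 t₁ = x) (h₁₀ : X.δ 2 t₁ = yz) (h₁₁ : X.δ 1 t₁ = xyz) :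
    (P.mul t₀ h₀ h₁ h₂).prod (𝟭 (P.cat z)) ⋙ P.mul t₂ h₃ h₄ h₅ =
      prod.associator (P.cat x) (P.cat y) (P.cat z) ⋙
        (𝟭 (P.cat x)).prod (P.mul t₃ h₆ h₇ h₈) ⋙ P.mul t₁ h₉ h₁₀ h₁₁ := by
  subst e₀ e₁ e₂ e₃
  exact P.assoc t h₀ h₁ h₂ h₃ h₄ h₅ h₆ h₇ h₈ h₉ h₁₀ h₁₁

/-- The right unit law with the faces given up to equality. -/
theorem mul_unit' {x y : X _⦋1⦌} {f : X _⦋2⦌} {c : X _⦋0⦌} (e : X.σ 0 x = f) (hc : X.δ 1 x = c)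
    (h₀ : X.δ 0 f = x) (h₁ : X.δ 1 f = x) (h₂ : X.δ 2 f = y) (hy : X.σ 0 c = y) :
    (𝟭 (P.cat x)).prod' ((Functor.const (P.cat x)).obj (P.unitAt c hy)) ⋙ P.mul f h₀ h₂ h₁ =
      𝟭 (P.cat x) := by
  subst e hc hy
  exact P.mul_unit x h₀ h₁

/-- The left unit law with the faces given up to equality. -/
theorem unit_mul' {x y : X _⦋1⦌} {f : X _⦋2⦌} {c : X _⦋0⦌} (e : X.σ 1 x = f) (hc : X.δ 0 x = c)
    (h₀ : X.δ 0 f = y) (h₁ : X.δ 1 f = x) (h₂ : X.δ 2 f = x) (hy : X.σ 0 c = y) :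
    ((Functor.const (P.cat x)).obj (P.unitAt c hy)).prod' (𝟭 (P.cat x)) ⋙ P.mul f h₀ h₂ h₁ =
      𝟭 (P.cat x) := by
  subst e hc hy
  exact P.unit_mul x h₁ h₂

end CategoricalOperad

/-- The faces of the upper décalage are the faces of the simplicial set other than the top one. -/
theorem addTop_map_δ {n : ℕ} (i : Fin (n + 2)) :
    addTop.map (SimplexCategory.δ i) = SimplexCategory.δ i.castSucc := by
  ext j : 3
  induction j using Fin.lastCases with
  | last =>
    exact (extendTopFun_last _).trans (Fin.succAbove_ne_last_last (Fin.castSucc_lt_last i).ne).symm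
  | cast j => exact (extendTopFun_castSucc _ j).trans (Fin.castSucc_succAbove_castSucc).symm

/-- The degeneracies of the upper décalage are the degeneracies of the simplicial set other than the
top one. -/
theorem addTop_map_σ {n : ℕ} (i : Fin (n + 1)) :
    addTop.map (SimplexCategory.σ i) = SimplexCategory.σ i.castSucc := by
  ext j : 3
  induction j using Fin.lastCases with
  | last => exact (extendTopFun_last _).trans (Fin.predAbove_right_last).symm
  | cast j => exact (extendTopFun_castSucc _ j).trans (Fin.castSucc_predAbove_castSucc _ _).symm

namespace UnaryOperadicStructure

open Bicategory

attribute [instance] bicategory strict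

variable {X : SSet.{u}} (O : UnaryOperadicStructure X)

/-- The simplex of `X` which corresponds to a simplex of the nerve. -/
def realize {d : SimplexCategory} (s : DuskinSimplex O.C d) : X.obj (op ⦋d.len + 1⦌) :=
  O.iso.inv.app (op d) s

/-- The simplex of the nerve which corresponds to a simplex of `X`. -/
def nerveOf {d : SimplexCategory} (b : X.obj (op ⦋d.len + 1⦌)) : DuskinSimplex O.C d :=
  O.iso.hom.app (op d) b

theorem realize_nerveOf {d : SimplexCategory} (b : X.obj (op ⦋d.len + 1⦌)) :
    O.realize (O.nerveOf b) = b := ConcreteCategory.congr_hom (O.iso.hom_inv_id_app (op d)) b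

theorem nerveOf_realize {d : SimplexCategory} (s : DuskinSimplex O.C d) :
    O.nerveOf (O.realize s) = s := ConcreteCategory.congr_hom (O.iso.inv_hom_id_app (op d)) s

theorem realize_restrict {d d' : SimplexCategory} (s : DuskinSimplex O.C d) (θ : d' ⟶ d) :
    O.realize (s.restrict θ) = X.map (addTop.map θ).op (O.realize s) :=
  ConcreteCategory.congr_hom (O.iso.inv.naturality θ.op) s

theorem nerveOf_map {d d' : SimplexCategory} (b : X.obj (op ⦋d.len + 1⦌)) (θ : d' ⟶ d) :
    O.nerveOf (X.map (addTop.map θ).op b) = (O.nerveOf b).restrict θ :=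
  ConcreteCategory.congr_hom (O.iso.hom.naturality θ.op) b

theorem map_addTop {d d' : SimplexCategory} (b : X.obj (op ⦋d.len + 1⦌)) (θ : d' ⟶ d) :
    X.map (addTop.map θ).op b = O.realize ((O.nerveOf b).restrict θ) := by
  rw [realize_restrict, realize_nerveOf]

theorem δ_realize {n : ℕ} (i : Fin (n + 2)) (s : DuskinSimplex O.C ⦋n + 1⦌) :
    X.δ i.castSucc (O.realize s) = O.realize (s.restrict (SimplexCategory.δ i)) := by
  rw [realize_restrict, addTop_map_δ]
  rfl

theorem σ_realize {n : ℕ} (i : Fin (n + 1)) (s : DuskinSimplex O.C ⦋n⦌) :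
    X.σ i.castSucc (O.realize s) = O.realize (s.restrict (SimplexCategory.σ i)) := by
  rw [realize_restrict, addTop_map_σ]
  rfl

/-- The element of `X_1` which corresponds to an object. -/
def ob (A : O.C) : X _⦋1⦌ := O.realize (.pt A)

/-- The element of `X_2` which corresponds to a map. -/
def mor {A B : O.C} (f : A ⟶ B) : X _⦋2⦌ := O.realize (.ofHom f)

/-- The element of `X_3` which corresponds to a lax triangle. -/
def tr {A B D : O.C} {f : A ⟶ B} {g : B ⟶ D} {h : A ⟶ D} (θ : f ≫ g ⟶ h) : X _⦋3⦌ :=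
  O.realize (.ofTri θ)

variable {A B D E : O.C}

theorem δ_zero_mor (f : A ⟶ B) : X.δ 0 (O.mor f) = O.ob B :=
  (O.δ_realize 0 _).trans (congrArg _ (DuskinSimplex.ofHom_δ_zero f))

theorem δ_one_mor (f : A ⟶ B) : X.δ 1 (O.mor f) = O.ob A :=
  (O.δ_realize 1 _).trans (congrArg _ (DuskinSimplex.ofHom_δ_one f))

theorem σ_zero_ob (A : O.C) : X.σ 0 (O.ob A) = O.mor (𝟙 A) :=
  (O.σ_realize 0 _).trans (congrArg _ (DuskinSimplex.pt_σ A))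

theorem σ_zero_mor (f : A ⟶ B) : X.σ 0 (O.mor f) = O.tr (λ_ f).hom :=
  (O.σ_realize 0 _).trans (congrArg _ (DuskinSimplex.ofHom_σ_zero f))

theorem σ_one_mor (f : A ⟶ B) : X.σ 1 (O.mor f) = O.tr (ρ_ f).hom :=
  (O.σ_realize 1 _).trans (congrArg _ (DuskinSimplex.ofHom_σ_one f))

section

variable {f : A ⟶ B} {g : B ⟶ D} {h : A ⟶ D} (θ : f ≫ g ⟶ h)

theorem δ_zero_tr : X.δ 0 (O.tr θ) = O.mor g :=
  (O.δ_realize 0 _).trans (congrArg _ (DuskinSimplex.ofTri_δ_zero θ))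

theorem δ_one_tr : X.δ 1 (O.tr θ) = O.mor h :=
  (O.δ_realize 1 _).trans (congrArg _ (DuskinSimplex.ofTri_δ_one θ))

theorem δ_two_tr : X.δ 2 (O.tr θ) = O.mor f :=
  (O.δ_realize 2 _).trans (congrArg _ (DuskinSimplex.ofTri_δ_two θ))

/-- The fiber of a map. -/
def fib (f : A ⟶ B) : X _⦋1⦌ := X.δ 2 (O.mor f)

/-- The fiber of a lax triangle `f ≫ g ⟶ h`, which is a map from the fiber of `h` to the fiber of
`g` with fiber the fiber of `f`. -/
def fibTr : X _⦋2⦌ := X.δ 3 (O.tr θ)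

theorem δ_zero_fibTr : X.δ 0 (O.fibTr θ) = O.fib g :=
  (SSet.δ_comp_δ_apply (i := (0 : Fin 3)) (j := 2) (by decide) _).trans
    (congrArg (X.δ 2) (O.δ_zero_tr θ))

theorem δ_one_fibTr : X.δ 1 (O.fibTr θ) = O.fib h :=
  (SSet.δ_comp_δ_apply (i := (1 : Fin 3)) (j := 2) (by decide) _).trans
    (congrArg (X.δ 2) (O.δ_one_tr θ))

theorem δ_two_fibTr : X.δ 2 (O.fibTr θ) = O.fib f :=
  (SSet.δ_comp_δ_apply (i := (2 : Fin 3)) (j := 2) (by decide) _).trans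
    (congrArg (X.δ 2) (O.δ_two_tr θ))

end

theorem fib_id (A : O.C) : X.σ 0 (X.δ 1 (O.ob A)) = O.fib (𝟙 A) :=
  (δ_two_σ_zero (O.ob A)).symm.trans (congrArg (X.δ 2) (O.σ_zero_ob A))

/-- A categorical operad, indexed by the cells of the 2-category. The action of `R f` is the
composition along `f ∈ X_2`, and the composition along a lax triangle in `X_3` is the one along its
fiber in `X_2`. -/
def indexedOperad (P : CategoricalOperad X) : IndexedOperad O.C where
  Q A := P.cat (O.ob A)
  R f := P.cat (O.fib f)
  act f := P.mul (O.mor f) (O.δ_zero_mor f) rfl (O.δ_one_mor f)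
  mul θ := P.mul (O.fibTr θ) (O.δ_zero_fibTr θ) (O.δ_two_fibTr θ) (O.δ_one_fibTr θ)
  unit A := P.unitAt (X.δ 1 (O.ob A)) (O.fib_id A)
  -- The associativity of `P` for the lax triangle itself.
  act_act θ := P.assoc' (O.tr θ) (O.δ_zero_tr θ) (O.δ_one_tr θ) (O.δ_two_tr θ) rfl
    _ _ _ _ _ _ _ _ _ _ _ _
  -- The associativity of `P` for the fiber of the tetrahedron, whose faces are the fibers of the
  -- four lax triangles.
  mul_mul θ₀₁₂ θ₁₂₃ θ₀₁₃ θ₀₂₃ e :=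
    P.assoc' (X.δ 4 (O.realize (.ofCocycle θ₀₁₂ θ₁₂₃ θ₀₁₃ θ₀₂₃ e)))
      ((SSet.δ_comp_δ_apply (i := (0 : Fin 4)) (j := 3) (by decide) _).trans (congrArg (X.δ 3)
        ((O.δ_realize 0 _).trans (congrArg _ (DuskinSimplex.ofCocycle_δ_zero e)))))
      ((SSet.δ_comp_δ_apply (i := (1 : Fin 4)) (j := 3) (by decide) _).trans (congrArg (X.δ 3)
        ((O.δ_realize 1 _).trans (congrArg _ (DuskinSimplex.ofCocycle_δ_one e)))))
      ((SSet.δ_comp_δ_apply (i := (2 : Fin 4)) (j := 3) (by decide) _).trans (congrArg (X.δ 3)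
        ((O.δ_realize 2 _).trans (congrArg _ (DuskinSimplex.ofCocycle_δ_two e)))))
      ((SSet.δ_comp_δ_apply (i := (3 : Fin 4)) (j := 3) (by decide) _).trans (congrArg (X.δ 3)
        ((O.δ_realize 3 _).trans (congrArg _ (DuskinSimplex.ofCocycle_δ_three e)))))
      _ _ _ _ _ _ _ _ _ _ _ _
  act_unit A := P.mul_unit' (O.σ_zero_ob A) rfl _ _ _ _
  mul_unit {A B} f := P.mul_unit'
    ((SSet.δ_comp_σ_of_gt_apply (i := (2 : Fin 3)) (j := (0 : Fin 2)) (by decide) _).symm.trans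
      (congrArg (X.δ 3) (O.σ_zero_mor f)))
    ((SSet.δ_comp_δ_apply (i := (1 : Fin 2)) (j := 1) (by decide) _).trans
      (congrArg (X.δ 1) (O.δ_one_mor f))) _ _ _ _
  unit_mul {A B} f := P.unit_mul'
    ((SSet.δ_comp_σ_of_gt_apply (i := (2 : Fin 3)) (j := (1 : Fin 2)) (by decide) _).symm.trans
      (congrArg (X.δ 3) (O.σ_one_mor f)))
    ((SSet.δ_comp_δ_apply (i := (0 : Fin 2)) (j := 1) (by decide) _).trans
      (congrArg (X.δ 1) (O.δ_zero_mor f))) _ _ _ _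

end UnaryOperadicStructure

/-! ### Simplices of the operadic Grothendieck construction -/

section DegenerateFaces

variable {X : SSet.{u}} {d : SimplexCategory} (b : X.obj (op d)) {i j : Fin (d.len + 1)}
  (hij : i ≤ j)

theorem δ_one_edge : X.δ 1 (edge b hij) = vertex b i := by
  refine map_map_eq ?_ b
  ext a : 3
  fin_cases a
  rfl

theorem δ_zero_edge : X.δ 0 (edge b hij) = vertex b j := by
  refine map_map_eq ?_ b
  ext a : 3
  fin_cases a
  rfl

theorem σ_zero_edge : X.σ 0 (edge b hij) = triangle b (le_refl i) hij := by
  refine map_map_eq ?_ b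
  ext a : 3
  fin_cases a <;> rfl

theorem σ_one_edge : X.σ 1 (edge b hij) = triangle b hij (le_refl j) := by
  refine map_map_eq ?_ b
  ext a : 3
  fin_cases a <;> rfl

end DegenerateFaces

namespace CategoricalOperad

variable {X : SSet.{u}} (P : CategoricalOperad X)

/-- Two morphisms in possibly different categories `P_x` and `P_y` are equal, together with `x`
and `y`, their sources and their targets. -/
structure Same {x y : X _⦋1⦌} {a b : P.cat x} {c d : P.cat y} (u : a ⟶ b) (v : c ⟶ d) : Prop where
  base : x = y
  left : a ≍ c
  right : b ≍ d
  heq : u ≍ v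

namespace Same

variable {P} {x y z : X _⦋1⦌} {a b : P.cat x} {c d : P.cat y} {e f : P.cat z}
  {u : a ⟶ b} {v : c ⟶ d} {w : e ⟶ f}

theorem rfl : P.Same u u := ⟨.refl _, .refl _, .refl _, .refl _⟩

theorem symm (h : P.Same u v) : P.Same v u := ⟨h.1.symm, h.2.symm, h.3.symm, h.4.symm⟩

theorem trans (h : P.Same u v) (h' : P.Same v w) : P.Same u w :=
  ⟨h.1.trans h'.1, h.2.trans h'.2, h.3.trans h'.3, h.4.trans h'.4⟩

theorem of_homEq {c d : P.cat x} {v : c ⟶ d} (h : u ~ₕ v) : P.Same u v :=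
  ⟨.refl _, heq_of_eq h.left, heq_of_eq h.right, h.heq⟩

theorem homEq {c d : P.cat x} {v : c ⟶ d} (h : P.Same u v) : u ~ₕ v :=
  ⟨eq_of_heq h.left, eq_of_heq h.right, h.heq⟩

theorem id (h : x = y) (h' : a ≍ c) : P.Same (𝟙 a) (𝟙 c) := by
  subst h h'
  exact rfl

theorem comp {b' : P.cat x} {d' : P.cat y} {u' : b ⟶ b'} {v' : d ⟶ d'} (h : P.Same u v)
    (h' : P.Same u' v') : P.Same (u ≫ u') (v ≫ v') := by
  obtain ⟨rfl, ha, hb, h⟩ := h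
  obtain ⟨-, -, hd, h'⟩ := h'
  subst ha hb hd h h'
  exact rfl

theorem mul {x₁ y₁ z₁ x₂ y₂ z₂ : X _⦋1⦌} {t t' : X _⦋2⦌} (e : t = t') (hx₁ : X.δ 0 t = x₁)
    (hy₁ : X.δ 2 t = y₁) (hz₁ : X.δ 1 t = z₁) (hx₂ : X.δ 0 t' = x₂) (hy₂ : X.δ 2 t' = y₂)
    (hz₂ : X.δ 1 t' = z₂) {a b : P.cat x₁} {u : a ⟶ b} {a' b' : P.cat y₁} {u' : a' ⟶ b'}
    {c d : P.cat x₂} {v : c ⟶ d} {c' d' : P.cat y₂} {v' : c' ⟶ d'} (h : P.Same u v)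
    (h' : P.Same u' v') :
    P.Same ((P.mul t hx₁ hy₁ hz₁).map (Prod.mkHom u u'))
      ((P.mul t' hx₂ hy₂ hz₂).map (Prod.mkHom v v')) := by
  subst e hx₁ hy₁ hz₁ hx₂ hy₂ hz₂
  obtain ⟨-, ha, hb, h⟩ := h
  obtain ⟨-, ha', hb', h'⟩ := h'
  subst ha hb ha' hb' h h'
  exact rfl

end Same

theorem mul_obj_heq {x₁ y₁ z₁ x₂ y₂ z₂ : X _⦋1⦌} {t t' : X _⦋2⦌} (e : t = t')
    (hx₁ : X.δ 0 t = x₁) (hy₁ : X.δ 2 t = y₁) (hz₁ : X.δ 1 t = z₁) (hx₂ : X.δ 0 t' = x₂)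
    (hy₂ : X.δ 2 t' = y₂) (hz₂ : X.δ 1 t' = z₂) {a : P.cat x₁} {b : P.cat y₁} {c : P.cat x₂}
    {d : P.cat y₂} (h : a ≍ c) (h' : b ≍ d) :
    (P.mul t hx₁ hy₁ hz₁).obj (a, b) ≍ (P.mul t' hx₂ hy₂ hz₂).obj (c, d) := by
  subst e hx₁ hy₁ hz₁ hx₂ hy₂ hz₂ h h'
  rfl

variable {d : SimplexCategory}

/-- The multiplication functor of a triangle of a simplex. -/
def mulAt (b : X.obj (op d)) {i j k : Fin (d.len + 1)} (hij : i ≤ j) (hjk : j ≤ k) :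
    P.cat (edge b hjk) × P.cat (edge b hij) ⥤ P.cat (edge b (hij.trans hjk)) :=
  P.mul (triangle b hij hjk) (δ_zero_triangle _ _ _) (δ_two_triangle _ _ _)
    (δ_one_triangle _ _ _)

theorem mulAt_refl_left (b : X.obj (op d)) {i j : Fin (d.len + 1)} (hij : i ≤ j) :
    (𝟭 _).prod' ((Functor.const _).obj (P.unitAt (vertex b i) (σ_vertex b i))) ⋙
      P.mulAt b (le_refl i) hij = 𝟭 _ :=
  P.mul_unit' (σ_zero_edge b hij) (δ_one_edge b hij) _ _ _ _

theorem mulAt_refl_right (b : X.obj (op d)) {i j : Fin (d.len + 1)} (hij : i ≤ j) :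
    ((Functor.const _).obj (P.unitAt (vertex b j) (σ_vertex b j))).prod' (𝟭 _) ⋙
      P.mulAt b hij (le_refl j) = 𝟭 _ :=
  P.unit_mul' (σ_one_edge b hij) (δ_zero_edge b hij) _ _ _ _

theorem mulAt_assoc (b : X.obj (op d)) {i j k l : Fin (d.len + 1)} (hij : i ≤ j) (hjk : j ≤ k)
    (hkl : k ≤ l) :
    (P.mulAt b hjk hkl).prod (𝟭 _) ⋙ P.mulAt b hij (hjk.trans hkl) =
      prod.associator _ _ _ ⋙ (𝟭 _).prod (P.mulAt b hij hjk) ⋙ P.mulAt b (hij.trans hjk) hkl := by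
  -- The associativity of `P` for the `3`-simplex with vertices `i`, `j`, `k` and `l`.
  let θ : ⦋3⦌ ⟶ d := SimplexCategory.Hom.mk
    ⟨![i, j, k, l], by
      refine Fin.monotone_iff_le_succ.mpr fun q => ?_
      fin_cases q
      exacts [hij, hjk, hkl]⟩
  refine P.assoc' (X.map θ.op b) ?_ ?_ ?_ ?_ _ _ _ _ _ _ _ _ _ _ _ _ <;>
  · refine map_map_eq ?_ b
    ext a : 3
    fin_cases a <;> rfl

end CategoricalOperad

namespace GrothendieckSimplex

variable {X : SSet.{u}} {P : CategoricalOperad X} {d : SimplexCategory}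

theorem obj_heq (s : GrothendieckSimplexData P d) {i j : Fin (d.len + 1)} (h : i ≤ j)
    {x : X _⦋1⦌} (hx : edge s.base h = x) : s.obj h hx ≍ s.a h := by
  subst hx
  rfl

theorem hom_same (s : GrothendieckSimplexData P d) {i j k : Fin (d.len + 1)} (hij : i ≤ j)
    (hjk : j ≤ k) {t : X _⦋2⦌} (ht : triangle s.base hij hjk = t) {x y z : X _⦋1⦌}
    (hx : X.δ 0 t = x) (hy : X.δ 2 t = y) (hz : X.δ 1 t = z) (hx' : edge s.base hjk = x)
    (hy' : edge s.base hij = y) (hz' : edge s.base (hij.trans hjk) = z) :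
    P.Same (s.hom hij hjk ht hx hy hz hx' hy' hz') (s.γ hij hjk) := by
  subst ht hx' hy' hz'
  exact .rfl

/-- A simplex of the operadic Grothendieck construction is determined by its base and its
nondegenerate edges and triangles. -/
theorem ext_of_lt {s s' : GrothendieckSimplex P d} (hb : s.base = s'.base)
    (ha : ∀ {i j} (h : i < j), s.a h.le ≍ s'.a h.le)
    (hγ : ∀ {i j k} (h : i < j) (h' : j < k), s.γ h.le h'.le ≍ s'.γ h.le h'.le) : s = s' := by
  have ho {i j : Fin (d.len + 1)} (h : i ≤ j) {x : X _⦋1⦌} (hx : edge s.base h = x)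
      (hx' : edge s'.base h = x) : s.obj h hx = s'.obj h hx' := by
    rcases h.eq_or_lt with rfl | hlt
    · rw [s.a_refl' i rfl hx ((σ_vertex _ _).trans hx),
        s'.a_refl' i (congrArg (vertex · i) hb.symm) hx' ((σ_vertex _ _).trans hx)]
    · exact eq_of_heq ((obj_heq _ h hx).trans ((ha hlt).trans (obj_heq _ h hx').symm))
  refine ext' hb ho ?_
  intro i j k hij hjk t ht ht' x y z hx hy hz hx₁ hy₁ hz₁ hx₂ hy₂ hz₂
  rcases hij.eq_or_lt with rfl | h
  · refine (s.γ_refl_left' _ ht hx hy hz hx₁ hy₁ hz₁).trans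
      (.trans ?_ (s'.γ_refl_left' _ ht' hx hy hz hx₂ hy₂ hz₂).symm)
    rw [ho hjk hx₁ hx₂]
  rcases hjk.eq_or_lt with rfl | h'
  · refine (s.γ_refl_right' _ ht hx hy hz hx₁ hy₁ hz₁).trans
      (.trans ?_ (s'.γ_refl_right' _ ht' hx hy hz hx₂ hy₂ hz₂).symm)
    rw [ho hij hy₁ hy₂]
  · exact (hom_same _ _ _ ht hx hy hz hx₁ hy₁ hz₁).heq.trans ((hγ h h').trans
      (hom_same _ _ _ ht' hx hy hz hx₂ hy₂ hz₂).heq.symm)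

/-- The data of a simplex from objects and maps over the edges and triangles themselves. -/
def mkData (b : X.obj (op d)) (a : ∀ {i j : Fin (d.len + 1)} (h : i ≤ j), P.cat (edge b h))
    (γ : ∀ {i j k : Fin (d.len + 1)} (hij : i ≤ j) (hjk : j ≤ k),
      (P.mulAt b hij hjk).obj (a hjk, a hij) ⟶ a (hij.trans hjk)) :
    GrothendieckSimplexData P d where
  base := b
  obj h _ hx := hx ▸ a h
  hom hij hjk _ ht _ _ _ hx hy hz hx' hy' hz' := by
    subst ht hx' hy' hz'
    exact γ hij hjk

section OfLT

variable (b : X.obj (op d)) (a : ∀ {i j : Fin (d.len + 1)} (h : i < j), P.cat (edge b h.le))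
  (γ : ∀ {i j k : Fin (d.len + 1)} (hij : i < j) (hjk : j < k),
    (P.mulAt b hij.le hjk.le).obj (a hjk, a hij) ⟶ a (hij.trans hjk))

/-- The extension by units of a family of objects indexed by `i < j` to `i ≤ j`. The decision
whether `i = j` is an argument, so that case distinctions on it reduce by computation. -/
def aExt {i j : Fin (d.len + 1)} (h : i ≤ j) (p : Decidable (i = j)) : P.cat (edge b h) :=
  @dite _ (i = j) p
    (fun e => P.unitAt (vertex b i) (by
      subst e
      exact σ_vertex b i))
    (fun n => a (lt_of_le_of_ne h n))

theorem aExt_refl (i : Fin (d.len + 1)) (p : Decidable (i = i)) :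
    aExt b a (le_refl i) p = P.unitAt (vertex b i) (σ_vertex b i) := by
  match p with
  | isTrue _ => rfl
  | isFalse n => exact absurd rfl n

theorem mulAt_aExt_left {i j : Fin (d.len + 1)} (h : i ≤ j) (p : Decidable (i = i))
    (c : P.cat (edge b h)) :
    (P.mulAt b (le_refl i) h).obj (c, aExt b a (le_refl i) p) = c := by
  rw [aExt_refl]
  exact Functor.congr_obj (P.mulAt_refl_left b h) c

theorem mulAt_aExt_right {i j : Fin (d.len + 1)} (h : i ≤ j) (p : Decidable (j = j))
    (c : P.cat (edge b h)) :
    (P.mulAt b h (le_refl j)).obj (aExt b a (le_refl j) p, c) = c := by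
  rw [aExt_refl]
  exact Functor.congr_obj (P.mulAt_refl_right b h) c

theorem mulAt_map_left {i j : Fin (d.len + 1)} (h : i ≤ j) (p : Decidable (i = i))
    {c c' : P.cat (edge b h)} (u : c ⟶ c') :
    (P.mulAt b (le_refl i) h).map (Prod.mkHom u (𝟙 (aExt b a (le_refl i) p))) ~ₕ u := by
  rw [aExt_refl]
  exact HomEq.of_functor_eq (P.mulAt_refl_left b h) u

theorem mulAt_map_right {i j : Fin (d.len + 1)} (h : i ≤ j) (p : Decidable (j = j))
    {c c' : P.cat (edge b h)} (u : c ⟶ c') :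
    (P.mulAt b h (le_refl j)).map (Prod.mkHom (𝟙 (aExt b a (le_refl j) p)) u) ~ₕ u := by
  rw [aExt_refl]
  exact HomEq.of_functor_eq (P.mulAt_refl_right b h) u

/-- The extension by identities of a family of maps indexed by `i < j < k` to `i ≤ j ≤ k`. -/
def γExt {i j k : Fin (d.len + 1)} (hij : i ≤ j) (hjk : j ≤ k) (p : Decidable (i = j))
    (q : Decidable (j = k)) (r : Decidable (i = k)) :
    (P.mulAt b hij hjk).obj (aExt b a hjk q, aExt b a hij p) ⟶ aExt b a (hij.trans hjk) r := by
  match p, q, r with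
  | isTrue e, q, r =>
    subst e
    exact eqToHom ((mulAt_aExt_left b a hjk _ _).trans
      (congrArg (aExt b a hjk) (Subsingleton.elim q r)))
  | isFalse n, isTrue e, r =>
    subst e
    exact eqToHom ((mulAt_aExt_right b a hij _ _).trans
      (congrArg (aExt b a hij) (Subsingleton.elim (isFalse n) r)))
  | isFalse n, isFalse n', isFalse _ => exact γ (lt_of_le_of_ne hij n) (lt_of_le_of_ne hjk n')
  | isFalse n, isFalse _, isTrue e => exact absurd (le_antisymm hij (e ▸ hjk)) n

theorem γExt_refl_left {i j : Fin (d.len + 1)} (h : i ≤ j) (p : Decidable (i = i))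
    (q : Decidable (i = j)) : γExt b a γ (le_refl i) h p q q ~ₕ 𝟙 (aExt b a h q) := by
  match p with
  | isTrue _ => exact .eqToHom (mulAt_aExt_left b a h _ _)
  | isFalse n => exact absurd rfl n

theorem γExt_refl_right {i j : Fin (d.len + 1)} (h : i ≤ j) (p : Decidable (j = j))
    (q : Decidable (i = j)) : γExt b a γ h (le_refl j) q p q ~ₕ 𝟙 (aExt b a h q) := by
  match p, q with
  | isTrue _, isFalse _ => exact .eqToHom (mulAt_aExt_right b a h _ _)
  | isTrue _, isTrue e =>
    subst e
    exact .eqToHom (mulAt_aExt_right b a h _ _)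
  | isFalse n, _ => exact absurd rfl n

/-- A simplex of the operadic Grothendieck construction from its base and its nondegenerate edges
and triangles. It suffices to have the cocycle condition for `i < j < k < l`: for degenerate
tetrahedra both sides reduce to a single map `γ` by the unit laws. -/
def ofLT (cocycle : ∀ {i j k l : Fin (d.len + 1)} (hij : i < j) (hjk : j < k) (hkl : k < l),
    (P.mulAt b hij.le (hjk.trans hkl).le).map (Prod.mkHom (γ hjk hkl) (𝟙 (a hij))) ≫
      γ hij (hjk.trans hkl) ~ₕ
    (P.mulAt b (hij.trans hjk).le hkl.le).map (Prod.mkHom (𝟙 (a hkl)) (γ hij hjk)) ≫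
      γ (hij.trans hjk) hkl) : GrothendieckSimplex P d where
  toGrothendieckSimplexData := mkData b (fun h => aExt b a h inferInstance)
    (fun h h' => γExt b a γ h h' inferInstance inferInstance inferInstance)
  a_refl i := aExt_refl b a i _
  γ_refl_left h := (γExt_refl_left b a γ h _ _).heq
  γ_refl_right h := (γExt_refl_right b a γ h _ _).heq
  cocycle {i j k l} hij hjk hkl := by
    refine HomEq.heq (u := (P.mulAt b hij (hjk.trans hkl)).map (Prod.mkHom
        (γExt b a γ hjk hkl inferInstance inferInstance inferInstance)
        (𝟙 (aExt b a hij inferInstance))) ≫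
      γExt b a γ hij (hjk.trans hkl) inferInstance inferInstance inferInstance)
      (v := (P.mulAt b (hij.trans hjk) hkl).map (Prod.mkHom (𝟙 (aExt b a hkl inferInstance))
        (γExt b a γ hij hjk inferInstance inferInstance inferInstance)) ≫
      γExt b a γ (hij.trans hjk) hkl inferInstance inferInstance inferInstance) ?_
    rcases hij.eq_or_lt with rfl | h₁
    · exact (HomEq.comp_id (mulAt_map_left b a _ _ _) (γExt_refl_left b a γ _ _ _)).trans
        (HomEq.id_comp (((HomEq.rfl.prodMk (γExt_refl_left b a γ _ _ _)).map _).trans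
          (.of_eq ((P.mulAt b _ hkl).map_id _))) .rfl).symm
    rcases hjk.eq_or_lt with rfl | h₂
    · exact (HomEq.id_comp ((((γExt_refl_left b a γ _ _ _).prodMk .rfl).map _).trans
          (.of_eq ((P.mulAt b hij _).map_id _))) .rfl).trans
        (HomEq.id_comp (((HomEq.rfl.prodMk (γExt_refl_right b a γ _ _ _)).map _).trans
          (.of_eq ((P.mulAt b _ hkl).map_id _))) .rfl).symm
    rcases hkl.eq_or_lt with rfl | h₃
    · exact (HomEq.id_comp ((((γExt_refl_right b a γ _ _ _).prodMk .rfl).map _).trans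
          (.of_eq ((P.mulAt b hij _).map_id _))) .rfl).trans
        (HomEq.comp_id (mulAt_map_right b a _ _ _) (γExt_refl_right b a γ _ _ _)).symm
    rw [Subsingleton.elim (inferInstance : Decidable (i = j)) (isFalse h₁.ne),
      Subsingleton.elim (inferInstance : Decidable (j = k)) (isFalse h₂.ne),
      Subsingleton.elim (inferInstance : Decidable (k = l)) (isFalse h₃.ne),
      Subsingleton.elim (inferInstance : Decidable (i = k)) (isFalse (h₁.trans h₂).ne),
      Subsingleton.elim (inferInstance : Decidable (j = l)) (isFalse (h₂.trans h₃).ne),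
      Subsingleton.elim (inferInstance : Decidable (i = l)) (isFalse (h₁.trans (h₂.trans h₃)).ne)]
    exact cocycle h₁ h₂ h₃

end OfLT

end GrothendieckSimplex

/-! ### The nerve of the total bicategory -/

namespace IndexedOperad

open Bicategory

variable {C : Type u} [Bicategory.{u, u} C] (T : IndexedOperad C)

/-- The structure which lifts a simplex of the nerve of `C` to the total bicategory: objects
`a i ∈ Q (x_i)`, objects `p_{ij} ∈ R (f_{ij})`, and maps `α_{ij} : a_j · p_{ij} ⟶ a_i` and
`γ_{ijk} : p_{jk} · p_{ij} ⟶ p_{ik}`, unital and associative. The condition `α_cocycle` says that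
the pair of the lax triangle and `γ_{ijk}` is a 2-cell of the total bicategory, and `γ_cocycle` is
the second component of its cocycle condition. -/
structure Decoration {d : SimplexCategory} (s : DuskinSimplex C d) where
  a : ∀ i, T.Q (s.obj i)
  p : ∀ {i j : Fin (d.len + 1)} (h : i ≤ j), T.R (s.hom h)
  α : ∀ {i j : Fin (d.len + 1)} (h : i ≤ j), (T.act (s.hom h)).obj (a j, p h) ⟶ a i
  γ : ∀ {i j k : Fin (d.len + 1)} (hij : i ≤ j) (hjk : j ≤ k),
    (T.mul (s.tri hij hjk)).obj (p hjk, p hij) ⟶ p (hij.trans hjk)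
  p_refl : ∀ i, p (le_refl i) ≍ T.unit (s.obj i)
  α_refl : ∀ i, α (le_refl i) ~ₕ 𝟙 (a i)
  γ_refl_left : ∀ {i j : Fin (d.len + 1)} (h : i ≤ j), γ (le_refl i) h ~ₕ 𝟙 (p h)
  γ_refl_right : ∀ {i j : Fin (d.len + 1)} (h : i ≤ j), γ h (le_refl j) ~ₕ 𝟙 (p h)
  α_cocycle : ∀ {i j k : Fin (d.len + 1)} (hij : i ≤ j) (hjk : j ≤ k),
    (T.act (s.hom hij)).map (Prod.mkHom (α hjk) (𝟙 (p hij))) ≫ α hij ~ₕ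
      (T.act (s.hom (hij.trans hjk))).map (Prod.mkHom (𝟙 (a k)) (γ hij hjk)) ≫ α (hij.trans hjk)
  γ_cocycle : ∀ {i j k l : Fin (d.len + 1)} (hij : i ≤ j) (hjk : j ≤ k) (hkl : k ≤ l),
    (T.mul (s.tri hij (hjk.trans hkl))).map (Prod.mkHom (γ hjk hkl) (𝟙 (p hij))) ≫
        γ hij (hjk.trans hkl) ~ₕ
      (T.mul (s.tri (hij.trans hjk) hkl)).map (Prod.mkHom (𝟙 (p hkl)) (γ hij hjk)) ≫
        γ (hij.trans hjk) hkl

variable {T} {d d' : SimplexCategory} {s : DuskinSimplex C d}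

namespace Decoration

theorem ext_of_lt {D D' : T.Decoration s} (ha : ∀ i, D.a i = D'.a i)
    (hp : ∀ {i j} (h : i < j), D.p h.le = D'.p h.le)
    (hα : ∀ {i j} (h : i < j), D.α h.le ≍ D'.α h.le)
    (hγ : ∀ {i j k} (h : i < j) (h' : j < k), D.γ h.le h'.le ≍ D'.γ h.le h'.le) : D = D' := by
  obtain ⟨a, p, α, γ, r, αr, γl, γr, _, _⟩ := D
  obtain ⟨a', p', α', γ', r', αr', γl', γr', _, _⟩ := D'
  obtain rfl : a = a' := funext ha
  obtain rfl : @p = @p' := by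
    funext i j h
    rcases h.eq_or_lt with rfl | hlt
    · exact eq_of_heq ((r i).trans (r' i).symm)
    · exact hp hlt
  obtain rfl : @α = @α' := by
    funext i j h
    rcases h.eq_or_lt with rfl | hlt
    · exact ((αr i).trans (αr' i).symm).eq
    · exact eq_of_heq (hα hlt)
  obtain rfl : @γ = @γ' := by
    funext i j k hij hjk
    rcases hij.eq_or_lt with rfl | hlt
    · exact ((γl hjk).trans (γl' hjk).symm).eq
    rcases hjk.eq_or_lt with rfl | hlt'
    · exact ((γr hij).trans (γr' hij).symm).eq
    · exact eq_of_heq (hγ hlt hlt')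
  rfl

/-- Restriction along a monotone map. -/
def restrict (D : T.Decoration s) (θ : d' ⟶ d) : T.Decoration (s.restrict θ) where
  a i := D.a (θ.toOrderHom i)
  p h := D.p (θ.toOrderHom.monotone h)
  α h := D.α (θ.toOrderHom.monotone h)
  γ h h' := D.γ (θ.toOrderHom.monotone h) (θ.toOrderHom.monotone h')
  p_refl _ := D.p_refl _
  α_refl _ := D.α_refl _
  γ_refl_left _ := D.γ_refl_left _
  γ_refl_right _ := D.γ_refl_right _
  α_cocycle _ _ := D.α_cocycle _ _
  γ_cocycle _ _ _ := D.γ_cocycle _ _ _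

theorem push_obj_heq {A B : C} {f f' : A ⟶ B} (e : f = f') (p : T.R f) :
    (T.push (eqToHom e)).obj p ≍ p := by
  subst e
  exact heq_of_eq (Total.push_obj_id p)

/-- The composition along a lax triangle is the composition along the strict triangle, followed by
the push forward along the 2-cell. -/
theorem push_mul_one_obj {A B E : C} {f : A ⟶ B} {g : B ⟶ E} {h : A ⟶ E} (θ : f ≫ g ⟶ h)
    {q q' : T.R g} {p p' : T.R f} (u : q ⟶ q') (v : p ⟶ p') :
    (T.push θ).map ((T.mul (𝟙 _)).map (Prod.mkHom u v)) ~ₕ (T.mul θ).map (Prod.mkHom u v) :=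
  (T.push_mul _ _ _ _).trans (T.mul_map_congr (Category.id_comp _) _)

/-- The object of the total bicategory over a vertex. -/
def totalObj (D : T.Decoration s) (i : Fin (d.len + 1)) : T.Total := ⟨s.obj i, D.a i⟩

/-- The map of the total bicategory over an edge. -/
def totalHom (D : T.Decoration s) {i j : Fin (d.len + 1)} (h : i ≤ j) :
    D.totalObj i ⟶ D.totalObj j :=
  Total.Hom.mk (s.hom h) (D.p h) (D.α h)

/-- The 2-cell of the total bicategory over a lax triangle. -/
def totalTri (D : T.Decoration s) {i j k : Fin (d.len + 1)} (hij : i ≤ j) (hjk : j ≤ k) :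
    D.totalHom hij ≫ D.totalHom hjk ⟶ D.totalHom (hij.trans hjk) :=
  Total.Hom₂.ofEq (s.tri hij hjk) (push_mul_one_obj _ (𝟙 (D.p hjk)) (𝟙 (D.p hij))).left
    (D.γ hij hjk) ((D.α_cocycle hij hjk).symm.trans
      (Total.comp_α (D.totalHom hij) (D.totalHom hjk)).symm)

theorem totalTri_ω (D : T.Decoration s) {i j k : Fin (d.len + 1)} (hij : i ≤ j) (hjk : j ≤ k) :
    (D.totalTri hij hjk).ω ~ₕ D.γ hij hjk :=
  .eqToHom_comp (push_mul_one_obj _ (𝟙 (D.p hjk)) (𝟙 (D.p hij))).left _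

theorem total_hom_refl (D : T.Decoration s) (i : Fin (d.len + 1)) :
    D.totalHom (le_refl i) = 𝟙 (D.totalObj i) :=
  Total.hom_ext (s.hom_refl i) (eq_of_heq ((push_obj_heq _ _).trans (D.p_refl i)))
    ((D.α_refl i).trans (Total.id_α (D.totalObj i)).symm)

/-- The simplex of the nerve of the total bicategory given by a decorated simplex. -/
def total (D : T.Decoration s) : DuskinSimplex T.Total d where
  obj := D.totalObj
  hom := D.totalHom
  tri := D.totalTri
  hom_refl := D.total_hom_refl
  tri_refl_left h := Total.IsPure.ext ((D.totalTri_ω _ _).trans (D.γ_refl_left h))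
    (((Total.isPure_eqToHom _).whiskerRight _).comp (Total.isPure_leftUnitor _))
    ((s.tri_refl_left h).trans (congrArg (· ▷ s.hom h ≫ (λ_ (s.hom h)).hom)
      (Total.eqToHom_θ (D.total_hom_refl _)).symm))
  tri_refl_right h := Total.IsPure.ext ((D.totalTri_ω _ _).trans (D.γ_refl_right h))
    (((Total.isPure_eqToHom _).whiskerLeft _).comp (Total.isPure_rightUnitor _))
    ((s.tri_refl_right h).trans (congrArg (fun η => s.hom h ◁ η ≫ (ρ_ (s.hom h)).hom)
      (Total.eqToHom_θ (D.total_hom_refl _)).symm))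
  cocycle hij hjk hkl := Total.hom₂_ext (s.cocycle hij hjk hkl) <| by
    refine (Total.comp_ω _ _).trans (.trans (((((Total.whiskerRight_ω _ _).trans
      ((HomEq.rfl.prodMk (D.totalTri_ω _ _)).map _)).map _).trans
        (push_mul_one_obj _ _ _)).comp (D.totalTri_ω _ _)) ?_)
    refine (D.γ_cocycle hij hjk hkl).symm.trans (.symm ?_)
    refine (Total.comp_ω (α_ (D.totalHom hij) (D.totalHom hjk) (D.totalHom hkl)).hom
      (D.totalHom hij ◁ D.totalTri hjk hkl ≫ D.totalTri hij (hjk.trans hkl))).trans (.trans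
        (.id_comp ((Total.isPure_associator (D.totalHom hij) (D.totalHom hjk)
          (D.totalHom hkl)).map_id _) (Total.comp_ω _ _)) ?_)
    exact ((((Total.whiskerLeft_ω _ _).trans
      (((D.totalTri_ω _ _).prodMk .rfl).map _)).map _).trans
        (push_mul_one_obj _ _ _)).comp (D.totalTri_ω _ _)

end Decoration

namespace Total

/-- The projection of a simplex of the nerve of the total bicategory. -/
def forget (S : DuskinSimplex T.Total d) : DuskinSimplex C d where
  obj i := (S.obj i).base
  hom h := (S.hom h).f
  tri h h' := (S.tri h h').θ
  hom_refl i := congrArg Hom.f (S.hom_refl i)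
  tri_refl_left h := (congrArg Hom₂.θ (S.tri_refl_left h)).trans
    (congrArg (· ▷ (S.hom h).f ≫ (λ_ (S.hom h).f).hom) (eqToHom_θ _))
  tri_refl_right h := (congrArg Hom₂.θ (S.tri_refl_right h)).trans
    (congrArg ((S.hom h).f ◁ · ≫ (ρ_ (S.hom h).f).hom) (eqToHom_θ _))
  cocycle h h' h'' := congrArg Hom₂.θ (S.cocycle h h' h'')

theorem p_heq {X Y : T.Total} {F G : X ⟶ Y} (h : F = G) : F.p ≍ G.p := by
  subst h
  rfl

theorem α_homEq {X Y : T.Total} {F G : X ⟶ Y} (h : F = G) : F.α ~ₕ G.α := by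
  subst h
  exact .rfl

theorem ω_homEq {X Y : T.Total} {F G : X ⟶ Y} {η ζ : F ⟶ G} (h : η = ζ) : η.ω ~ₕ ζ.ω := by
  subst h
  exact .rfl

theorem isPure_of_eq {X Y : T.Total} {F G : X ⟶ Y} {η ζ : F ⟶ G} (h : η = ζ) (hζ : IsPure ζ) :
    η.ω ~ₕ 𝟙 G.p := by
  subst h
  exact hζ

/-- The decoration of the projection of a simplex of the nerve of the total bicategory. -/
def decoration (S : DuskinSimplex T.Total d) : T.Decoration (forget S) where
  a i := (S.obj i).a
  p h := (S.hom h).p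
  α h := (S.hom h).α
  γ hij hjk := eqToHom (Decoration.push_mul_one_obj (S.tri hij hjk).θ (𝟙 (S.hom hjk).p)
    (𝟙 (S.hom hij).p)).left.symm ≫ (S.tri hij hjk).ω
  p_refl i := p_heq (S.hom_refl i)
  α_refl i := (α_homEq (S.hom_refl i)).trans (id_α _)
  γ_refl_left h := (HomEq.eqToHom_comp _ _).trans (isPure_of_eq (S.tri_refl_left h)
    (((isPure_eqToHom _).whiskerRight _).comp (isPure_leftUnitor _)))
  γ_refl_right h := (HomEq.eqToHom_comp _ _).trans (isPure_of_eq (S.tri_refl_right h)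
    (((isPure_eqToHom _).whiskerLeft _).comp (isPure_rightUnitor _)))
  α_cocycle hij hjk := (comp_α _ _).symm.trans ((S.tri hij hjk).compat.symm.trans
    (((HomEq.rfl.prodMk (HomEq.eqToHom_comp _ _)).map _).comp .rfl).symm)
  γ_cocycle hij hjk hkl := by
    refine .trans ?_ (((ω_homEq (S.cocycle hij hjk hkl)).symm.trans (comp_ω _ _)).trans ?_)
    · refine .symm ((comp_ω _ _).trans (.trans
        (.id_comp ((isPure_associator _ _ _).map_id _) (comp_ω _ _)) ?_))
      exact ((((whiskerLeft_ω _ _).trans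
        (((HomEq.eqToHom_comp _ _).symm.prodMk .rfl).map _)).map _).trans
          (Decoration.push_mul_one_obj _ _ _)).comp (HomEq.eqToHom_comp _ _).symm
    · exact ((((whiskerRight_ω _ _).trans
        ((HomEq.rfl.prodMk (HomEq.eqToHom_comp _ _).symm).map _)).map _).trans
          (Decoration.push_mul_one_obj _ _ _)).comp (HomEq.eqToHom_comp _ _).symm

theorem total_decoration (S : DuskinSimplex T.Total d) : (decoration S).total = S :=
  DuskinSimplex.ext_of_lt (fun _ => rfl) (fun _ => .rfl) fun h h' => heq_of_eq <|
    hom₂_ext rfl (((decoration S).totalTri_ω h.le h'.le).trans (HomEq.eqToHom_comp _ _))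

theorem decoration_total (D : T.Decoration s) : decoration D.total = D :=
  Decoration.ext_of_lt (fun _ => rfl) (fun _ => rfl) (fun _ => .rfl) fun h h' =>
    ((HomEq.eqToHom_comp _ _).trans (D.totalTri_ω h.le h'.le)).heq

/-- The simplices of the nerve of the total bicategory are the decorated simplices. -/
def decorationEquiv (T : IndexedOperad C) (d : SimplexCategory) :
    (Σ s : DuskinSimplex C d, T.Decoration s) ≃ DuskinSimplex T.Total d where
  toFun D := D.2.total
  invFun S := ⟨forget S, decoration S⟩
  left_inv D := Sigma.ext rfl (heq_of_eq (decoration_total D.2))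
  right_inv S := total_decoration S

end Total

end IndexedOperad

/-! ### The décalage of the operadic Grothendieck construction -/

namespace GrothendieckSimplex

variable {X : SSet.{u}} {P : CategoricalOperad X} {d : SimplexCategory}
  (S : GrothendieckSimplex P d) {i j k l : Fin (d.len + 1)}

theorem obj_heq_obj {i' j' : Fin (d.len + 1)} (hi : i = i') (hj : j = j') (h : i ≤ j)
    (h' : i' ≤ j') {x x' : X _⦋1⦌} (hx : edge S.base h = x) (hx' : edge S.base h' = x') :
    S.obj h hx ≍ S.obj h' hx' := by
  subst hi hj hx hx'
  rfl

theorem hom_same_hom {i' j' k' : Fin (d.len + 1)} (hi : i = i') (hj : j = j') (hk : k = k')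
    (hij : i ≤ j) (hjk : j ≤ k) (hij' : i' ≤ j') (hjk' : j' ≤ k') {t t' : X _⦋2⦌}
    (ht : triangle S.base hij hjk = t) {x y z x' y' z' : X _⦋1⦌}
    (hx : X.δ 0 t = x) (hy : X.δ 2 t = y) (hz : X.δ 1 t = z) (hxe : edge S.base hjk = x)
    (hye : edge S.base hij = y) (hze : edge S.base (hij.trans hjk) = z)
    (ht' : triangle S.base hij' hjk' = t')
    (hx' : X.δ 0 t' = x') (hy' : X.δ 2 t' = y') (hz' : X.δ 1 t' = z')
    (hxe' : edge S.base hjk' = x') (hye' : edge S.base hij' = y')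
    (hze' : edge S.base (hij'.trans hjk') = z') :
    P.Same (S.hom hij hjk ht hx hy hz hxe hye hze)
      (S.hom hij' hjk' ht' hx' hy' hz' hxe' hye' hze') := by
  subst hi hj hk
  exact (hom_same _ _ _ ht hx hy hz hxe hye hze).trans
    (hom_same _ _ _ ht' hx' hy' hz' hxe' hye' hze').symm

theorem hom_refl_left (h : i ≤ j) {t : X _⦋2⦌} (ht : triangle S.base (le_refl i) h = t)
    {x y : X _⦋1⦌} (hx : X.δ 0 t = x) (hy : X.δ 2 t = y) (hz : X.δ 1 t = x)
    (hx' : edge S.base h = x) (hy' : edge S.base (le_refl i) = y) (hz' : edge S.base h = x) :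
    S.hom (le_refl i) h ht hx hy hz hx' hy' hz' ~ₕ 𝟙 (S.obj h hx') := by
  subst ht hx' hy'
  refine ⟨?_, rfl, S.γ_refl_left h⟩
  refine Eq.trans ?_ (Functor.congr_obj (P.mulAt_refl_left S.base h) (S.a h))
  exact congrArg (fun c => (P.mulAt S.base (le_refl i) h).obj (S.a h, c)) (S.a_refl i)

theorem hom_refl_right (h : i ≤ j) {t : X _⦋2⦌} (ht : triangle S.base h (le_refl j) = t)
    {x y : X _⦋1⦌} (hx : X.δ 0 t = x) (hy : X.δ 2 t = y) (hz : X.δ 1 t = y)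
    (hx' : edge S.base (le_refl j) = x) (hy' : edge S.base h = y) (hz' : edge S.base h = y) :
    S.hom h (le_refl j) ht hx hy hz hx' hy' hz' ~ₕ 𝟙 (S.obj h hy') := by
  subst ht hx' hy'
  refine ⟨?_, rfl, S.γ_refl_right h⟩
  refine Eq.trans ?_ (Functor.congr_obj (P.mulAt_refl_right S.base h) (S.a h))
  exact congrArg (fun c => (P.mulAt S.base h (le_refl j)).obj (c, S.a h)) (S.a_refl j)

theorem hom_cocycle (hij : i ≤ j) (hjk : j ≤ k) (hkl : k ≤ l) {tijk tijl tikl tjkl : X _⦋2⦌}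
    {xij xik xil xjk xjl xkl : X _⦋1⦌}
    (htijk : triangle S.base hij hjk = tijk) (htijl : triangle S.base hij (hjk.trans hkl) = tijl)
    (htikl : triangle S.base (hij.trans hjk) hkl = tikl) (htjkl : triangle S.base hjk hkl = tjkl)
    (hxij : edge S.base hij = xij) (hxik : edge S.base (hij.trans hjk) = xik)
    (hxil : edge S.base (hij.trans (hjk.trans hkl)) = xil) (hxjk : edge S.base hjk = xjk)
    (hxjl : edge S.base (hjk.trans hkl) = xjl) (hxkl : edge S.base hkl = xkl)
    (h₀ : X.δ 0 tijk = xjk) (h₁ : X.δ 2 tijk = xij) (h₂ : X.δ 1 tijk = xik)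
    (h₃ : X.δ 0 tijl = xjl) (h₄ : X.δ 2 tijl = xij) (h₅ : X.δ 1 tijl = xil)
    (h₆ : X.δ 0 tikl = xkl) (h₇ : X.δ 2 tikl = xik) (h₈ : X.δ 1 tikl = xil)
    (h₉ : X.δ 0 tjkl = xkl) (h₁₀ : X.δ 2 tjkl = xjk) (h₁₁ : X.δ 1 tjkl = xjl) :
    (P.mul tijl h₃ h₄ h₅).map
        (Prod.mkHom (S.hom hjk hkl htjkl h₉ h₁₀ h₁₁ hxkl hxjk hxjl) (𝟙 (S.obj hij hxij))) ≫
      S.hom hij (hjk.trans hkl) htijl h₃ h₄ h₅ hxjl hxij hxil ~ₕ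
    (P.mul tikl h₆ h₇ h₈).map
        (Prod.mkHom (𝟙 (S.obj hkl hxkl)) (S.hom hij hjk htijk h₀ h₁ h₂ hxjk hxij hxik)) ≫
      S.hom (hij.trans hjk) hkl htikl h₆ h₇ h₈ hxkl hxik hxil := by
  subst htijk htijl htikl htjkl hxij hxik hxil hxjk hxjl hxkl
  exact ⟨Functor.congr_obj (P.mulAt_assoc S.base hij hjk hkl) ((S.a hkl, S.a hjk), S.a hij), rfl,
    S.cocycle hij hjk hkl⟩

section OfLT

variable (b : X.obj (op d)) (a : ∀ {i j : Fin (d.len + 1)} (h : i < j), P.cat (edge b h.le))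
  (γ : ∀ {i j k : Fin (d.len + 1)} (hij : i < j) (hjk : j < k),
    (P.mulAt b hij.le hjk.le).obj (a hjk, a hij) ⟶ a (hij.trans hjk))

theorem aExt_of_lt (h : i < j) (p : Decidable (i = j)) : aExt b a h.le p = a h := by
  match p with
  | isTrue e => exact absurd e h.ne
  | isFalse _ => rfl

theorem γExt_of_lt (hij : i < j) (hjk : j < k) (p : Decidable (i = j)) (q : Decidable (j = k))
    (r : Decidable (i = k)) : γExt b a γ hij.le hjk.le p q r ≍ γ hij hjk := by
  match p, q, r with
  | isTrue e, _, _ => exact absurd e hij.ne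
  | isFalse _, isTrue e, _ => exact absurd e hjk.ne
  | isFalse _, isFalse _, isTrue e => exact absurd e (hij.trans hjk).ne
  | isFalse _, isFalse _, isFalse _ => rfl

variable (cocycle : ∀ {i j k l : Fin (d.len + 1)} (hij : i < j) (hjk : j < k) (hkl : k < l),
    (P.mulAt b hij.le (hjk.trans hkl).le).map (Prod.mkHom (γ hjk hkl) (𝟙 (a hij))) ≫
      γ hij (hjk.trans hkl) ~ₕ
    (P.mulAt b (hij.trans hjk).le hkl.le).map (Prod.mkHom (𝟙 (a hkl)) (γ hij hjk)) ≫
      γ (hij.trans hjk) hkl)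

theorem ofLT_a (h : i < j) : (ofLT b a γ cocycle).a h.le = a h := aExt_of_lt b a h _

theorem ofLT_γ (hij : i < j) (hjk : j < k) :
    P.Same ((ofLT b a γ cocycle).γ hij.le hjk.le) (γ hij hjk) where
  base := rfl
  left := by
    refine P.mul_obj_heq rfl _ _ _ _ _ _ (heq_of_eq (ofLT_a ..)) (heq_of_eq (ofLT_a ..))
  right := heq_of_eq (ofLT_a b a γ cocycle (hij.trans hjk))
  heq := γExt_of_lt b a γ hij hjk _ _ _

end OfLT

end GrothendieckSimplex

namespace CategoricalOperad.Same

variable {X : SSet.{u}} {P : CategoricalOperad X}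

/-- A map can be transported to a category and to endpoints which are equal to its own. -/
theorem exists_of_heq {x y : X _⦋1⦌} (e : x = y) {a b : P.cat y} (u : a ⟶ b) {a' b' : P.cat x}
    (ha : a' ≍ a) (hb : b' ≍ b) : ∃ u' : a' ⟶ b', P.Same u' u := by
  subst e ha hb
  exact ⟨u, .rfl⟩

end CategoricalOperad.Same

namespace UnaryOperadicStructure

open Bicategory

variable {X : SSet.{u}} (O : UnaryOperadicStructure X) {d d' : SimplexCategory}

section

variable {b : X.obj (op ⦋d.len + 1⦌)} {s : DuskinSimplex O.C d}

/-- The edge from `i` to the top vertex corresponds to the `i`-th object. -/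
theorem edge_last (hs : O.nerveOf b = s) (i : Fin (d.len + 1)) :
    edge (d := ⦋d.len + 1⦌) b (Fin.le_last i.castSucc) = O.ob (s.obj i) := by
  subst hs
  refine .trans ?_ ((O.map_addTop b (SimplexCategory.const ⦋0⦌ d i)).trans
    (congrArg O.realize (DuskinSimplex.restrict_const _ _)))
  refine congrArg (fun f : ⦋1⦌ ⟶ ⦋d.len + 1⦌ => X.map f.op b) ?_
  ext a : 3
  fin_cases a
  · exact (extendTopFun_castSucc (SimplexCategory.const ⦋0⦌ d i).toOrderHom (0 : Fin 1)).symm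
  · exact (extendTopFun_last _).symm

/-- The triangle on `i`, `j` and the top vertex corresponds to the map from `i` to `j`. -/
theorem triangle_last (hs : O.nerveOf b = s) {i j : Fin (d.len + 1)} (h : i ≤ j) :
    triangle (d := ⦋d.len + 1⦌) b (Fin.castSucc_le_castSucc_iff.mpr h) (Fin.le_last j.castSucc) =
      O.mor (s.hom h) := by
  subst hs
  refine .trans ?_ ((O.map_addTop b (SimplexCategory.mkOfLe i j h)).trans
    (congrArg O.realize (DuskinSimplex.restrict_mkOfLe _ _)))
  refine congrArg (fun f : ⦋2⦌ ⟶ ⦋d.len + 1⦌ => X.map f.op b) ?_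
  ext a : 3
  fin_cases a
  · exact (extendTopFun_castSucc (SimplexCategory.mkOfLe i j h).toOrderHom (0 : Fin 2)).symm
  · exact (extendTopFun_castSucc (SimplexCategory.mkOfLe i j h).toOrderHom (1 : Fin 2)).symm
  · exact (extendTopFun_last _).symm

/-- An edge without the top vertex is the fiber of a map. -/
theorem edge_castSucc (hs : O.nerveOf b = s) {i j : Fin (d.len + 1)} (h : i ≤ j) :
    edge (d := ⦋d.len + 1⦌) b (Fin.castSucc_le_castSucc_iff.mpr h) = O.fib (s.hom h) :=
  (δ_two_triangle b _ _).symm.trans (congrArg (X.δ 2) (O.triangle_last hs h))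

/-- A triangle without the top vertex is the fiber of a lax triangle. -/
theorem triangle_castSucc (hs : O.nerveOf b = s) {i j k : Fin (d.len + 1)} (hij : i ≤ j)
    (hjk : j ≤ k) :
    triangle (d := ⦋d.len + 1⦌) b (Fin.castSucc_le_castSucc_iff.mpr hij)
      (Fin.castSucc_le_castSucc_iff.mpr hjk) = O.fibTr (s.tri hij hjk) := by
  subst hs
  refine .trans ?_ (congrArg (X.δ 3) ((O.map_addTop b
    (SimplexCategory.mkOfLeComp i j k hij hjk)).trans
      (congrArg O.realize (DuskinSimplex.restrict_mkOfLeComp _ _ _))))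
  refine (map_map_eq ?_ b).symm
  ext a : 3
  fin_cases a
  · exact extendTopFun_castSucc _ (0 : Fin 3)
  · exact extendTopFun_castSucc _ (1 : Fin 3)
  · exact extendTopFun_castSucc _ (2 : Fin 3)

end

variable {P : CategoricalOperad X}

/-- The decoration of a simplex of the nerve given by a simplex of the décalage of the operadic
Grothendieck construction over it. Edges and triangles which contain the top vertex give the
objects `a` and the maps `α`, all others lie over fibers and give `p` and `γ`. -/
def decoration (S : GrothendieckSimplex P ⦋d.len + 1⦌) {s : DuskinSimplex O.C d}
    (hs : O.nerveOf S.base = s) : (O.indexedOperad P).Decoration s where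
  a i := S.obj (Fin.le_last i.castSucc) (O.edge_last hs i)
  p h := S.obj (Fin.castSucc_le_castSucc_iff.mpr h) (O.edge_castSucc hs h)
  α {i j} h := S.hom (Fin.castSucc_le_castSucc_iff.mpr h) (Fin.le_last j.castSucc)
    (O.triangle_last hs h) _ _ _ (O.edge_last hs j) (O.edge_castSucc hs h) (O.edge_last hs i)
  γ hij hjk := S.hom (Fin.castSucc_le_castSucc_iff.mpr hij) (Fin.castSucc_le_castSucc_iff.mpr hjk)
    (O.triangle_castSucc hs hij hjk) _ _ _ (O.edge_castSucc hs hjk) (O.edge_castSucc hs hij)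
    (O.edge_castSucc hs (hij.trans hjk))
  p_refl i := by
    have e : vertex S.base i.castSucc = X.δ 1 (O.ob (s.obj i)) :=
      (δ_one_edge S.base (Fin.le_last i.castSucc)).symm.trans
        (congrArg (X.δ 1) (O.edge_last hs i))
    have hx := (σ_vertex S.base i.castSucc).symm.trans
      ((congrArg (X.σ 0) e).trans (O.fib_id (s.obj i)))
    exact (S.obj_heq_obj rfl rfl _ _ _ hx).trans (heq_of_eq (S.a_refl' _ e hx _))
  α_refl i := S.hom_refl_left _ _ _ _ _ _ _ _
  γ_refl_left h := S.hom_refl_left _ _ _ _ _ _ _ _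
  γ_refl_right h := S.hom_refl_right _ _ _ _ _ _ _ _
  α_cocycle hij hjk := S.hom_cocycle _ _ _ _ _ _ _ _ _ _ _ _ _ _ _ _ _ _ _ _ _ _ _ _ _
  γ_cocycle hij hjk hkl := S.hom_cocycle _ _ _ _ _ _ _ _ _ _ _ _ _ _ _ _ _ _ _ _ _ _ _ _ _

theorem eq_of_nerveOf_eq {b b' : X.obj (op ⦋d.len + 1⦌)} (h : O.nerveOf b = O.nerveOf b') :
    b = b' := by
  rw [← O.realize_nerveOf b, h, O.realize_nerveOf]

theorem decoration_injective {S S' : GrothendieckSimplex P ⦋d.len + 1⦌} {s : DuskinSimplex O.C d}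
    (hs : O.nerveOf S.base = s) (hs' : O.nerveOf S'.base = s)
    (h : O.decoration S hs = O.decoration S' hs') : S = S' := by
  refine GrothendieckSimplex.ext_of_lt (O.eq_of_nerveOf_eq (hs.trans hs'.symm)) ?_ ?_
  · intro i j hij
    obtain ⟨i, rfl⟩ := Fin.exists_castSucc_eq.mpr (ne_of_lt (lt_of_lt_of_le hij (Fin.le_last j)))
    induction j using Fin.lastCases with
    | last =>
      exact (GrothendieckSimplex.obj_heq _ _ (O.edge_last hs i)).symm.trans
        ((heq_of_eq (congrArg (fun D => D.a i) h)).trans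
          (GrothendieckSimplex.obj_heq _ _ (O.edge_last hs' i)))
    | cast j =>
      have hij' : i < j := hij
      exact (GrothendieckSimplex.obj_heq _ _ (O.edge_castSucc hs hij'.le)).symm.trans
        ((heq_of_eq (congrArg (fun D => D.p hij'.le) h)).trans
          (GrothendieckSimplex.obj_heq _ _ (O.edge_castSucc hs' hij'.le)))
  · intro i j k hij hjk
    obtain ⟨i, rfl⟩ := Fin.exists_castSucc_eq.mpr (ne_of_lt (lt_of_lt_of_le hij (Fin.le_last j)))
    obtain ⟨j, rfl⟩ := Fin.exists_castSucc_eq.mpr (ne_of_lt (lt_of_lt_of_le hjk (Fin.le_last k)))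
    have hij' : i < j := hij
    induction k using Fin.lastCases with
    | last =>
      have e : (O.decoration S hs).α hij'.le ≍ (O.decoration S' hs').α hij'.le := by rw [h]
      exact (GrothendieckSimplex.hom_same _ _ _ (O.triangle_last hs hij'.le) _ _ _
        (O.edge_last hs j) (O.edge_castSucc hs hij'.le) (O.edge_last hs i)).heq.symm.trans
          (e.trans (GrothendieckSimplex.hom_same _ _ _ (O.triangle_last hs' hij'.le) _ _ _
            (O.edge_last hs' j) (O.edge_castSucc hs' hij'.le) (O.edge_last hs' i)).heq)
    | cast k =>
      have hjk' : j < k := hjk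
      have e : (O.decoration S hs).γ hij'.le hjk'.le ≍ (O.decoration S' hs').γ hij'.le hjk'.le := by
        rw [h]
      exact (GrothendieckSimplex.hom_same _ _ _ (O.triangle_castSucc hs hij'.le hjk'.le) _ _ _
        (O.edge_castSucc hs hjk'.le) (O.edge_castSucc hs hij'.le)
        (O.edge_castSucc hs (hij'.le.trans hjk'.le))).heq.symm.trans
          (e.trans (GrothendieckSimplex.hom_same _ _ _ (O.triangle_castSucc hs' hij'.le hjk'.le)
            _ _ _ (O.edge_castSucc hs' hjk'.le) (O.edge_castSucc hs' hij'.le)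
            (O.edge_castSucc hs' (hij'.le.trans hjk'.le))).heq)

theorem decoration_restrict (S : GrothendieckSimplex P ⦋d.len + 1⦌) {s : DuskinSimplex O.C d}
    (hs : O.nerveOf S.base = s) (θ : d' ⟶ d)
    (hs' : O.nerveOf (S.restrict (addTop.map θ)).base = s.restrict θ) :
    O.decoration (S.restrict (addTop.map θ)) hs' = (O.decoration S hs).restrict θ := by
  have e (i : Fin (d'.len + 1)) : (addTop.map θ).toOrderHom i.castSucc =
      (θ.toOrderHom i).castSucc := extendTopFun_castSucc θ.toOrderHom i
  have e' : (addTop.map θ).toOrderHom (Fin.last (d'.len + 1)) = Fin.last (d.len + 1) :=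
    extendTopFun_last θ.toOrderHom
  exact IndexedOperad.Decoration.ext_of_lt
    (fun i => eq_of_heq (S.obj_heq_obj (e i) e' _ _ _ _))
    (fun {i j} h => eq_of_heq (S.obj_heq_obj (e i) (e j) _ _ _ _))
    (fun {i j} h => (S.hom_same_hom (e i) (e j) e' _ _ _ _ _ _ _ _ _ _ _ _ _ _ _ _ _ _).heq)
    (fun {i j k} h h' =>
      (S.hom_same_hom (e i) (e j) (e k) _ _ _ _ _ _ _ _ _ _ _ _ _ _ _ _ _ _).heq)

/-- The objects `a` and `p` of a decoration form a family over the edges of the corresponding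
simplex of `X`, characterized up to the equalities of these edges with the objects and the fibers
of the maps. -/
theorem exists_obj {b : X.obj (op ⦋d.len + 1⦌)} {s : DuskinSimplex O.C d}
    (hs : O.nerveOf b = s) (D : (O.indexedOperad P).Decoration s) :
    ∃ a : ∀ {i j : Fin (d.len + 2)} (h : i < j), P.cat (edge (d := ⦋d.len + 1⦌) b h.le),
      (∀ i, a (Fin.castSucc_lt_last i) ≍ D.a i) ∧
        ∀ {i j} (h : i < j), a (Fin.castSucc_lt_castSucc_iff.mpr h) ≍ D.p h.le := by
  have key (i j : Fin (d.len + 2)) (h : i < j) :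
      ∃ x : P.cat (edge (d := ⦋d.len + 1⦌) b h.le),
        (∀ i', i = Fin.castSucc i' → j = Fin.last _ → x ≍ D.a i') ∧
        ∀ (i' j') (h' : i' < j'), i = Fin.castSucc i' → j = Fin.castSucc j' → x ≍ D.p h'.le := by
    obtain ⟨i, rfl⟩ := Fin.exists_castSucc_eq.mpr (ne_of_lt (lt_of_lt_of_le h (Fin.le_last j)))
    induction j using Fin.lastCases with
    | last =>
      refine ⟨cast (congrArg P.cat (O.edge_last hs i).symm) (D.a i), ?_, ?_⟩
      · intro i' hi _
        obtain rfl := Fin.castSucc_injective _ hi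
        exact cast_heq _ _
      · intro i' j' _ _ hj
        exact absurd hj.symm (Fin.castSucc_ne_last j')
    | cast j =>
      have h' : i < j := h
      refine ⟨cast (congrArg P.cat (O.edge_castSucc hs h'.le).symm) (D.p h'.le), ?_, ?_⟩
      · intro i' _ hj
        exact absurd hj (Fin.castSucc_ne_last j)
      · intro i' j' _ hi hj
        obtain rfl := Fin.castSucc_injective _ hi
        obtain rfl := Fin.castSucc_injective _ hj
        exact cast_heq _ _
  choose a ha ha' using key
  exact ⟨fun {i j} h => a i j h, fun i => ha _ _ _ i rfl rfl, fun h => ha' _ _ _ _ _ h rfl rfl⟩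

/-- The maps `α` and `γ` of a decoration form a family over the triangles of the corresponding
simplex of `X`. -/
theorem exists_hom {b : X.obj (op ⦋d.len + 1⦌)} {s : DuskinSimplex O.C d}
    (hs : O.nerveOf b = s) (D : (O.indexedOperad P).Decoration s)
    (a : ∀ {i j : Fin (d.len + 2)} (h : i < j), P.cat (edge (d := ⦋d.len + 1⦌) b h.le))
    (ha : ∀ i, a (Fin.castSucc_lt_last i) ≍ D.a i)
    (hp : ∀ {i j} (h : i < j), a (Fin.castSucc_lt_castSucc_iff.mpr h) ≍ D.p h.le) :
    ∃ γ : ∀ {i j k : Fin (d.len + 2)} (hij : i < j) (hjk : j < k),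
      (P.mulAt (d := ⦋d.len + 1⦌) b hij.le hjk.le).obj (a hjk, a hij) ⟶ a (hij.trans hjk),
      (∀ {i j} (h : i < j), P.Same
        (γ (Fin.castSucc_lt_castSucc_iff.mpr h) (Fin.castSucc_lt_last j)) (D.α h.le)) ∧
      ∀ {i j k} (h : i < j) (h' : j < k), P.Same (γ (Fin.castSucc_lt_castSucc_iff.mpr h)
        (Fin.castSucc_lt_castSucc_iff.mpr h')) (D.γ h.le h'.le) := by
  have key (i j k : Fin (d.len + 2)) (hij : i < j) (hjk : j < k) :
      ∃ u : (P.mulAt (d := ⦋d.len + 1⦌) b hij.le hjk.le).obj (a hjk, a hij) ⟶ a (hij.trans hjk),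
        (∀ (i' j') (h' : i' < j'), i = Fin.castSucc i' → j = Fin.castSucc j' → k = Fin.last _ →
          P.Same u (D.α h'.le)) ∧
        ∀ (i' j' k') (h' : i' < j') (h'' : j' < k'), i = Fin.castSucc i' → j = Fin.castSucc j' →
          k = Fin.castSucc k' → P.Same u (D.γ h'.le h''.le) := by
    obtain ⟨i, rfl⟩ := Fin.exists_castSucc_eq.mpr (ne_of_lt (lt_of_lt_of_le hij (Fin.le_last j)))
    obtain ⟨j, rfl⟩ := Fin.exists_castSucc_eq.mpr (ne_of_lt (lt_of_lt_of_le hjk (Fin.le_last k)))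
    have hij' : i < j := hij
    induction k using Fin.lastCases with
    | last =>
      obtain ⟨u, hu⟩ := CategoricalOperad.Same.exists_of_heq (O.edge_last hs i) (D.α hij'.le)
        (P.mul_obj_heq (O.triangle_last hs hij'.le) _ _ _ _ _ _ (ha j) (hp hij')) (ha i)
      refine ⟨u, ?_, ?_⟩
      · intro i' j' _ hi hj _
        obtain rfl := Fin.castSucc_injective _ hi
        obtain rfl := Fin.castSucc_injective _ hj
        exact hu
      · intro _ _ k' _ _ _ _ hk
        exact absurd hk.symm (Fin.castSucc_ne_last k')
    | cast k =>
      have hjk' : j < k := hjk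
      obtain ⟨u, hu⟩ := CategoricalOperad.Same.exists_of_heq
        (O.edge_castSucc hs (hij'.le.trans hjk'.le)) (D.γ hij'.le hjk'.le)
        (P.mul_obj_heq (O.triangle_castSucc hs hij'.le hjk'.le) _ _ _ _ _ _ (hp hjk') (hp hij'))
        (hp (hij'.trans hjk'))
      refine ⟨u, ?_, ?_⟩
      · intro _ _ _ _ _ hk
        exact absurd hk (Fin.castSucc_ne_last k)
      · intro i' j' k' _ _ hi hj hk
        obtain rfl := Fin.castSucc_injective _ hi
        obtain rfl := Fin.castSucc_injective _ hj
        obtain rfl := Fin.castSucc_injective _ hk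
        exact hu
  choose γ h h' using key
  exact ⟨fun {i j k} hij hjk => γ i j k hij hjk, fun hij => h _ _ _ _ _ _ _ hij rfl rfl rfl,
    fun hij hjk => h' _ _ _ _ _ _ _ _ hij hjk rfl rfl rfl⟩

theorem exists_decoration_eq {b : X.obj (op ⦋d.len + 1⦌)} {s : DuskinSimplex O.C d}
    (hs : O.nerveOf b = s) (D : (O.indexedOperad P).Decoration s) :
    ∃ (S : GrothendieckSimplex P ⦋d.len + 1⦌) (hS : O.nerveOf S.base = s),
      O.decoration S hS = D := by
  obtain ⟨a, ha, hp⟩ := O.exists_obj hs D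
  obtain ⟨γ, hα, hγ⟩ := O.exists_hom hs D a ha hp
  refine ⟨GrothendieckSimplex.ofLT b a γ ?_, hs, ?_⟩
  · intro i j k l hij hjk hkl
    obtain ⟨i, rfl⟩ := Fin.exists_castSucc_eq.mpr (ne_of_lt (lt_of_lt_of_le hij (Fin.le_last j)))
    obtain ⟨j, rfl⟩ := Fin.exists_castSucc_eq.mpr (ne_of_lt (lt_of_lt_of_le hjk (Fin.le_last k)))
    obtain ⟨k, rfl⟩ := Fin.exists_castSucc_eq.mpr (ne_of_lt (lt_of_lt_of_le hkl (Fin.le_last l)))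
    have hij' : i < j := hij
    have hjk' : j < k := hjk
    refine CategoricalOperad.Same.homEq ?_
    -- The cocycle condition is `α_cocycle` if `l` is the top vertex, and `γ_cocycle` otherwise.
    induction l using Fin.lastCases with
    | last =>
      refine .trans ?_ ((CategoricalOperad.Same.of_homEq (D.α_cocycle hij'.le hjk'.le)).trans
        (.symm ?_))
      · exact .comp (.mul (O.triangle_last hs _) _ _ _ _ _ _ (hα hjk')
          (.id (O.edge_castSucc hs _) (hp hij'))) (hα hij')
      · exact .comp (.mul (O.triangle_last hs _) _ _ _ _ _ _ (.id (O.edge_last hs _) (ha k))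
          (hγ hij' hjk')) (hα (hij'.trans hjk'))
    | cast l =>
      have hkl' : k < l := hkl
      refine .trans ?_ ((CategoricalOperad.Same.of_homEq
        (D.γ_cocycle hij'.le hjk'.le hkl'.le)).trans (.symm ?_))
      · exact .comp (.mul (O.triangle_castSucc hs _ _) _ _ _ _ _ _ (hγ hjk' hkl')
          (.id (O.edge_castSucc hs _) (hp hij'))) (hγ hij' (hjk'.trans hkl'))
      · exact .comp (.mul (O.triangle_castSucc hs _ _) _ _ _ _ _ _
          (.id (O.edge_castSucc hs _) (hp hkl')) (hγ hij' hjk')) (hγ (hij'.trans hjk') hkl')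
  · refine IndexedOperad.Decoration.ext_of_lt ?_ ?_ ?_ ?_
    · intro i
      exact eq_of_heq ((GrothendieckSimplex.obj_heq _ _ _).trans ((heq_of_eq
        (GrothendieckSimplex.ofLT_a b a γ _ (Fin.castSucc_lt_last i))).trans (ha i)))
    · intro i j h
      exact eq_of_heq ((GrothendieckSimplex.obj_heq _ _ _).trans ((heq_of_eq
        (GrothendieckSimplex.ofLT_a b a γ _ (Fin.castSucc_lt_castSucc_iff.mpr h))).trans (hp h)))
    · intro i j h
      exact ((GrothendieckSimplex.hom_same _ _ _ _ _ _ _ _ _ _).trans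
        ((GrothendieckSimplex.ofLT_γ b a γ _ (Fin.castSucc_lt_castSucc_iff.mpr h)
          (Fin.castSucc_lt_last j)).trans (hα h))).heq
    · intro i j k h h'
      exact ((GrothendieckSimplex.hom_same _ _ _ _ _ _ _ _ _ _).trans
        ((GrothendieckSimplex.ofLT_γ b a γ _ (Fin.castSucc_lt_castSucc_iff.mpr h)
          (Fin.castSucc_lt_castSucc_iff.mpr h')).trans (hγ h h'))).heq

/-- The map from the décalage of the operadic Grothendieck construction to the nerve of the total
bicategory. -/
def grothendieckToNerve (S : GrothendieckSimplex P ⦋d.len + 1⦌) :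
    DuskinSimplex (O.indexedOperad P).Total d :=
  (O.decoration S rfl).total

theorem grothendieckToNerve_eq (S : GrothendieckSimplex P ⦋d.len + 1⦌) {s : DuskinSimplex O.C d}
    (hs : O.nerveOf S.base = s) : O.grothendieckToNerve S = (O.decoration S hs).total := by
  subst hs
  rfl

theorem grothendieckToNerve_restrict (S : GrothendieckSimplex P ⦋d.len + 1⦌) (θ : d' ⟶ d) :
    O.grothendieckToNerve (S.restrict (addTop.map θ)) = (O.grothendieckToNerve S).restrict θ :=
  (O.grothendieckToNerve_eq _ (O.nerveOf_map S.base θ)).trans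
    (congrArg IndexedOperad.Decoration.total (O.decoration_restrict S rfl θ _))

theorem grothendieckToNerve_bijective :
    Function.Bijective (O.grothendieckToNerve (P := P) (d := d)) := by
  constructor
  · intro S S' h
    have h' := (IndexedOperad.Total.decorationEquiv (O.indexedOperad P) d).injective
      (a₁ := ⟨O.nerveOf S.base, O.decoration S rfl⟩)
      (a₂ := ⟨O.nerveOf S'.base, O.decoration S' rfl⟩) h
    have key (σ : Σ s, (O.indexedOperad P).Decoration s)
        (hσ : ⟨O.nerveOf S.base, O.decoration S rfl⟩ = σ) :
        ∃ hs : O.nerveOf S.base = σ.1, O.decoration S hs = σ.2 := by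
      subst hσ
      exact ⟨rfl, rfl⟩
    obtain ⟨hs, e⟩ := key _ h'
    exact O.decoration_injective hs rfl e
  · intro T
    obtain ⟨⟨s, D⟩, rfl⟩ := (IndexedOperad.Total.decorationEquiv (O.indexedOperad P) d).surjective T
    obtain ⟨S, hS, rfl⟩ := O.exists_decoration_eq (O.nerveOf_realize s) D
    exact ⟨S, O.grothendieckToNerve_eq S hS⟩

/-- The operadic Grothendieck construction is a unary operadic 2-category. -/
noncomputable def grothendieck (P : CategoricalOperad X) :
    UnaryOperadicStructure P.grothendieck where
  C := (O.indexedOperad P).Total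
  iso := NatIso.ofComponents
    (fun d => (Equiv.ofBijective _ (O.grothendieckToNerve_bijective (d := d.unop))).toIso)
    (by
      intro d d' θ
      ext S
      exact O.grothendieckToNerve_restrict S θ.unop)

end UnaryOperadicStructure

/-! ### Horns and operadic cartesian maps -/

section Horns

variable {X Y : SSet.{u}}

theorem yonedaEquiv_δ_comp {n : ℕ} (i : Fin (n + 2)) (f : (Δ[n + 1] : SSet.{u}) ⟶ X) :
    SSet.yonedaEquiv (SSet.stdSimplex.δ i ≫ f) = X.δ i (SSet.yonedaEquiv f) := by
  obtain ⟨x, rfl⟩ := SSet.yonedaEquiv.symm.surjective f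
  rw [Equiv.apply_symm_apply]
  exact (Equiv.eq_symm_apply _).mp (SSet.yonedaEquiv_symm_naturality_left _ _)

theorem yonedaEquiv_ι_comp {n : ℕ} (i j : Fin (n + 2)) (h : j ≠ i)
    (l : (Λ[n + 1, i] : SSet.{u}) ⟶ X) :
    SSet.yonedaEquiv (SSet.horn.ι i j h ≫ l) = l.app (op ⦋n⦌) (SSet.horn.face i j h) := by
  rw [SSet.horn.ι, SSet.yonedaEquiv_symm_comp, Equiv.apply_symm_apply]

/-- A map is operadic cartesian if it satisfies the lifting property for compatible families of
faces in place of horns. -/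
theorem isOperadicCartesian_of_faces {p : X ⟶ Y} {f : X _⦋2⦌}
    (h : ∀ (g k : X _⦋2⦌) (s : Y _⦋3⦌), p.app (op ⦋2⦌) f = Y.δ 0 s → p.app (op ⦋2⦌) g = Y.δ 1 s →
      p.app (op ⦋2⦌) k = Y.δ 3 s → X.δ 0 g = X.δ 0 f → X.δ 0 k = X.δ 2 f → X.δ 1 k = X.δ 2 g →
      ∃! t : X _⦋3⦌, p.app (op ⦋3⦌) t = s ∧ X.δ 0 t = f ∧ X.δ 1 t = g ∧ X.δ 3 t = k) :
    IsOperadicCartesian p f := by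
  intro l hl σ hσ
  have hc := SSet.horn.IsCompatible.of_hom l
  have face (j : Fin 4) (hj : j ≠ 2) : p.app (op ⦋2⦌) (l.app (op ⦋2⦌) (SSet.horn.face 2 j hj)) =
      Y.δ j (SSet.yonedaEquiv σ) := by
    rw [← yonedaEquiv_δ_comp, ← SSet.horn.ι_ι 2 j hj, Category.assoc, hσ, yonedaEquiv_ι_comp]
    rfl
  have comp (j k : Fin 4) (hj : j ≠ 2) (hk : k ≠ 2) (hjk : j < k) :
      X.δ (k.pred (Fin.ne_zero_of_lt hjk)) (l.app (op ⦋2⦌) (SSet.horn.face 2 j hj)) =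
        X.δ (j.castPred (Fin.ne_last_of_lt hjk)) (l.app (op ⦋2⦌) (SSet.horn.face 2 k hk)) := by
    rw [← yonedaEquiv_ι_comp, ← yonedaEquiv_ι_comp, ← yonedaEquiv_δ_comp, ← yonedaEquiv_δ_comp]
    exact congrArg SSet.yonedaEquiv (hc j k hj hk hjk)
  -- The fillers of the horn over `σ` are the `3`-simplices over `σ` with the three given faces.
  have key (t : X _⦋3⦌) : ((SSet.horn 3 2).ι ≫ SSet.yonedaEquiv.symm t = l ∧
      SSet.yonedaEquiv.symm t ≫ p = σ) ↔ p.app (op ⦋3⦌) t = SSet.yonedaEquiv σ ∧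
        X.δ 0 t = f ∧ X.δ 1 t = l.app (op ⦋2⦌) (SSet.horn.face 2 1 (by decide)) ∧
          X.δ 3 t = l.app (op ⦋2⦌) (SSet.horn.face 2 3 (by decide)) := by
    have e (j : Fin 4) (hj : j ≠ 2) : SSet.horn.ι 2 j hj ≫ (SSet.horn 3 2).ι ≫
        SSet.yonedaEquiv.symm t = SSet.horn.ι 2 j hj ≫ l ↔
          X.δ j t = l.app (op ⦋2⦌) (SSet.horn.face 2 j hj) := by
      rw [← SSet.yonedaEquiv.injective.eq_iff, SSet.horn.ι_ι_assoc, yonedaEquiv_ι_comp,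
        yonedaEquiv_δ_comp, Equiv.apply_symm_apply]
    rw [SSet.yonedaEquiv_symm_comp, Equiv.symm_apply_eq, ← hl, ← e, ← e, ← e]
    constructor
    · rintro ⟨h, h'⟩
      rw [h]
      exact ⟨h', rfl, rfl, rfl⟩
    · rintro ⟨h, h₀, h₁, h₃⟩
      refine ⟨SSet.horn.hom_ext' fun j hj => ?_, h⟩
      fin_cases j
      · exact h₀
      · exact h₁
      · exact absurd rfl hj
      · exact h₃
  obtain ⟨t, ht, ht'⟩ := h _ _ (SSet.yonedaEquiv σ) (hl ▸ face 0 (by decide)) (face 1 (by decide))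
    (face 3 (by decide)) (hl ▸ (comp 0 1 (by decide) (by decide) (by decide)).symm)
    (hl ▸ (comp 0 3 (by decide) (by decide) (by decide)).symm)
    (comp 1 3 (by decide) (by decide) (by decide)).symm
  refine ⟨SSet.yonedaEquiv.symm t, (key t).mpr ht, fun τ hτ => ?_⟩
  rw [← ht' (SSet.yonedaEquiv τ) ((key _).mp (by rwa [Equiv.symm_apply_apply])),
    Equiv.symm_apply_apply]

end Horns

/-! ### Faces of the simplices of the operadic Grothendieck construction -/

section Faces

variable {X : SSet.{u}} {d d' : SimplexCategory} {b' : X.obj (op d')} {b : X.obj (op d)}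
  {θ : d' ⟶ d}

theorem edge_eq_of_map (hb : b' = X.map θ.op b) {i j : Fin (d'.len + 1)} (h : i ≤ j)
    {i' j' : Fin (d.len + 1)} (hi : θ.toOrderHom i = i') (hj : θ.toOrderHom j = j')
    (h' : i' ≤ j') : edge b' h = edge b h' := by
  subst hb hi hj
  exact edge_map θ b h

theorem triangle_eq_of_map (hb : b' = X.map θ.op b) {i j k : Fin (d'.len + 1)} (hij : i ≤ j)
    (hjk : j ≤ k) {i' j' k' : Fin (d.len + 1)} (hi : θ.toOrderHom i = i')
    (hj : θ.toOrderHom j = j') (hk : θ.toOrderHom k = k') (hij' : i' ≤ j') (hjk' : j' ≤ k') :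
    triangle b' hij hjk = triangle b hij' hjk' := by
  subst hb hi hj hk
  exact triangle_map θ b hij hjk

end Faces

namespace GrothendieckSimplex

variable {X : SSet.{u}} {P : CategoricalOperad X} {d d' : SimplexCategory}

theorem a_heq_of_restrict {S : GrothendieckSimplex P d} {S' : GrothendieckSimplex P d'}
    {θ : d' ⟶ d} (e : S.restrict θ = S') {i j : Fin (d'.len + 1)} (h : i ≤ j)
    {i' j' : Fin (d.len + 1)} (hi : θ.toOrderHom i = i') (hj : θ.toOrderHom j = j')
    (h' : i' ≤ j') : S.a h' ≍ S'.a h := by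
  subst e
  exact S.obj_heq_obj hi.symm hj.symm _ _ _ _

theorem γ_same_of_restrict {S : GrothendieckSimplex P d} {S' : GrothendieckSimplex P d'}
    {θ : d' ⟶ d} (e : S.restrict θ = S') {i j k : Fin (d'.len + 1)} (hij : i ≤ j) (hjk : j ≤ k)
    {i' j' k' : Fin (d.len + 1)} (hi : θ.toOrderHom i = i') (hj : θ.toOrderHom j = j')
    (hk : θ.toOrderHom k = k') (hij' : i' ≤ j') (hjk' : j' ≤ k') :
    P.Same (S.γ hij' hjk') (S'.γ hij hjk) := by
  subst e
  exact S.hom_same_hom hi.symm hj.symm hk.symm _ _ _ _ _ _ _ _ _ _ _ _ _ _ _ _ _ _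

theorem γ_cocycle (S : GrothendieckSimplex P d) {i j k l : Fin (d.len + 1)} (hij : i ≤ j)
    (hjk : j ≤ k) (hkl : k ≤ l) :
    (P.mulAt S.base hij (hjk.trans hkl)).map (Prod.mkHom (S.γ hjk hkl) (𝟙 (S.a hij))) ≫
      S.γ hij (hjk.trans hkl) ~ₕ
    (P.mulAt S.base (hij.trans hjk) hkl).map (Prod.mkHom (𝟙 (S.a hkl)) (S.γ hij hjk)) ≫
      S.γ (hij.trans hjk) hkl :=
  S.hom_cocycle hij hjk hkl _ _ _ _ _ _ _ _ _ _ _ _ _ _ _ _ _ _ _ _ _ _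

/-- If `γ_{jkl}` is an identity, then the cocycle condition expresses `γ_{ijl}` through the other
two maps. -/
theorem γ_homEq_of_id (S : GrothendieckSimplex P d) {i j k l : Fin (d.len + 1)} (hij : i ≤ j)
    (hjk : j ≤ k) (hkl : k ≤ l) (h : S.γ hjk hkl ~ₕ 𝟙 (S.a (hjk.trans hkl))) :
    S.γ hij (hjk.trans hkl) ~ₕ
      (P.mulAt S.base (hij.trans hjk) hkl).map (Prod.mkHom (𝟙 (S.a hkl)) (S.γ hij hjk)) ≫
        S.γ (hij.trans hjk) hkl :=
  (HomEq.id_comp (((h.prodMk .rfl).map _).trans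
    (.of_eq ((P.mulAt S.base hij (hjk.trans hkl)).map_id _))) .rfl).symm.trans
      (S.γ_cocycle hij hjk hkl)

/-- The map `γ₀₁₂` of a `2`-simplex is an identity, up to equality of its source and target. -/
def IsStrict (t : GrothendieckSimplex P ⦋2⦌) : Prop :=
  t.γ (i := 0) (j := 1) (k := 2) (by decide) (by decide) ~ₕ
    𝟙 (t.a (i := 0) (j := 2) (by decide))

end GrothendieckSimplex

theorem CategoricalOperad.Same.homEq_id {X : SSet.{u}} {P : CategoricalOperad X} {x y : X _⦋1⦌}
    {a b : P.cat x} {c d : P.cat y} {u : a ⟶ b} {v : c ⟶ d} (h : P.Same u v) (h' : v ~ₕ 𝟙 d) :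
    u ~ₕ 𝟙 b := by
  obtain ⟨rfl, ha, hb, hu⟩ := h
  subst ha hb hu
  exact h'

namespace GrothendieckSimplex

variable {X : SSet.{u}} {P : CategoricalOperad X}

section Three

variable {T T' : GrothendieckSimplex P ⦋3⦌} {t g k : GrothendieckSimplex P ⦋2⦌}

theorem γ₁₂₃_homEq_id (h₀ : T.restrict (SimplexCategory.δ 0) = t) (ht : t.IsStrict) :
    T.γ (i := 1) (j := 2) (k := 3) (by decide) (by decide) ~ₕ
      𝟙 (T.a (i := 1) (j := 3) (by decide)) :=
  (γ_same_of_restrict h₀ (i := 0) (j := 1) (k := 2) (by decide) (by decide) rfl rfl rfl _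
    _).homEq_id ht

/-- A `3`-simplex with strict face `0` is determined by its base and its faces `0`, `1` and `3`: the
only map outside these faces is `γ₀₁₃`, which the cocycle condition determines. -/
theorem eq_of_faces (hb : T.base = T'.base)
    (h₀ : T.restrict (SimplexCategory.δ 0) = t) (h₁ : T.restrict (SimplexCategory.δ 1) = g)
    (h₃ : T.restrict (SimplexCategory.δ 3) = k) (h₀' : T'.restrict (SimplexCategory.δ 0) = t)
    (h₁' : T'.restrict (SimplexCategory.δ 1) = g) (h₃' : T'.restrict (SimplexCategory.δ 3) = k)
    (ht : t.IsStrict) : T = T' := by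
  have ha {i j : Fin 4} (h : i < j) : T.a (i := i) (j := j) h.le ≍ T'.a (i := i) (j := j) h.le := by
    refine finFourLtCases ?_ ?_ ?_ ?_ ?_ ?_ h
    · exact (a_heq_of_restrict h₃ (i := 0) (j := 1) (by decide) rfl rfl _).trans
        (a_heq_of_restrict h₃' (i := 0) (j := 1) (by decide) rfl rfl _).symm
    · exact (a_heq_of_restrict h₃ (i := 1) (j := 2) (by decide) rfl rfl _).trans
        (a_heq_of_restrict h₃' (i := 1) (j := 2) (by decide) rfl rfl _).symm
    · exact (a_heq_of_restrict h₀ (i := 1) (j := 2) (by decide) rfl rfl _).trans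
        (a_heq_of_restrict h₀' (i := 1) (j := 2) (by decide) rfl rfl _).symm
    · exact (a_heq_of_restrict h₃ (i := 0) (j := 2) (by decide) rfl rfl _).trans
        (a_heq_of_restrict h₃' (i := 0) (j := 2) (by decide) rfl rfl _).symm
    · exact (a_heq_of_restrict h₀ (i := 0) (j := 2) (by decide) rfl rfl _).trans
        (a_heq_of_restrict h₀' (i := 0) (j := 2) (by decide) rfl rfl _).symm
    · exact (a_heq_of_restrict h₁ (i := 0) (j := 2) (by decide) rfl rfl _).trans
        (a_heq_of_restrict h₁' (i := 0) (j := 2) (by decide) rfl rfl _).symm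
  have h₀₁₂ := (γ_same_of_restrict h₃ (i := 0) (j := 1) (k := 2) (i' := 0) (j' := 1) (k' := 2)
    (by decide) (by decide) rfl rfl rfl (by decide) (by decide)).trans
      (γ_same_of_restrict h₃' (i := 0) (j := 1) (k := 2) (i' := 0) (j' := 1) (k' := 2)
        (by decide) (by decide) rfl rfl rfl (by decide) (by decide)).symm
  have h₀₂₃ := (γ_same_of_restrict h₁ (i := 0) (j := 1) (k := 2) (i' := 0) (j' := 2) (k' := 3)
    (by decide) (by decide) rfl rfl rfl (by decide) (by decide)).trans
      (γ_same_of_restrict h₁' (i := 0) (j := 1) (k := 2) (i' := 0) (j' := 2) (k' := 3)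
        (by decide) (by decide) rfl rfl rfl (by decide) (by decide)).symm
  refine ext_of_lt hb ha fun h h' => finFourLtLtCases ?_ ?_ ?_ ?_ h h'
  · exact h₀₁₂.heq
  · exact ((γ_same_of_restrict h₀ (i := 0) (j := 1) (k := 2) (by decide) (by decide) rfl rfl rfl
      _ _).trans (γ_same_of_restrict h₀' (i := 0) (j := 1) (k := 2) (by decide) (by decide) rfl
        rfl rfl _ _).symm).heq
  · refine ((CategoricalOperad.Same.of_homEq (T.γ_homEq_of_id (i := 0) (j := 1) (k := 2) (l := 3)
      (by decide) (by decide) (by decide) (γ₁₂₃_homEq_id h₀ ht))).trans (.trans ?_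
        (CategoricalOperad.Same.of_homEq (T'.γ_homEq_of_id (i := 0) (j := 1) (k := 2) (l := 3)
          (by decide) (by decide) (by decide) (γ₁₂₃_homEq_id h₀' ht))).symm)).heq
    exact .comp (.mul (by rw [hb]) _ _ _ _ _ _ (.id (by rw [hb])
      (ha (i := 2) (j := 3) (by decide))) h₀₁₂) h₀₂₃
  · exact h₀₂₃.heq

end Three

end GrothendieckSimplex

/-! ### Fillers of horns in the operadic Grothendieck construction -/

namespace GrothendieckSimplex

variable {X : SSet.{u}} {P : CategoricalOperad X}

/-- The edges and triangles of a `3`-simplex can be prescribed, subject to a single cocycle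
condition. -/
theorem exists_three {s : X _⦋3⦌} {a₀₁ : P.cat (edge s (i := 0) (j := 1) (by decide))}
    {a₁₂ : P.cat (edge s (i := 1) (j := 2) (by decide))}
    {a₂₃ : P.cat (edge s (i := 2) (j := 3) (by decide))}
    {a₀₂ : P.cat (edge s (i := 0) (j := 2) (by decide))}
    {a₁₃ : P.cat (edge s (i := 1) (j := 3) (by decide))}
    {a₀₃ : P.cat (edge s (i := 0) (j := 3) (by decide))}
    (γ₀₁₂ : (P.mulAt s (i := 0) (j := 1) (k := 2) (by decide) (by decide)).obj (a₁₂, a₀₁) ⟶ a₀₂)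
    (γ₁₂₃ : (P.mulAt s (i := 1) (j := 2) (k := 3) (by decide) (by decide)).obj (a₂₃, a₁₂) ⟶ a₁₃)
    (γ₀₁₃ : (P.mulAt s (i := 0) (j := 1) (k := 3) (by decide) (by decide)).obj (a₁₃, a₀₁) ⟶ a₀₃)
    (γ₀₂₃ : (P.mulAt s (i := 0) (j := 2) (k := 3) (by decide) (by decide)).obj (a₂₃, a₀₂) ⟶ a₀₃)
    (cocycle : (P.mulAt s (i := 0) (j := 1) (k := 3) (by decide) (by decide)).map
        (Prod.mkHom γ₁₂₃ (𝟙 a₀₁)) ≫ γ₀₁₃ ~ₕ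
      (P.mulAt s (i := 0) (j := 2) (k := 3) (by decide) (by decide)).map
        (Prod.mkHom (𝟙 a₂₃) γ₀₁₂) ≫ γ₀₂₃) :
    ∃ T : GrothendieckSimplex P ⦋3⦌, T.base = s ∧
      (T.a (i := 0) (j := 1) (by decide) ≍ a₀₁ ∧ T.a (i := 1) (j := 2) (by decide) ≍ a₁₂ ∧
      T.a (i := 2) (j := 3) (by decide) ≍ a₂₃ ∧ T.a (i := 0) (j := 2) (by decide) ≍ a₀₂ ∧
      T.a (i := 1) (j := 3) (by decide) ≍ a₁₃ ∧ T.a (i := 0) (j := 3) (by decide) ≍ a₀₃) ∧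
      P.Same (T.γ (i := 0) (j := 1) (k := 2) (by decide) (by decide)) γ₀₁₂ ∧
      P.Same (T.γ (i := 1) (j := 2) (k := 3) (by decide) (by decide)) γ₁₂₃ ∧
      P.Same (T.γ (i := 0) (j := 2) (k := 3) (by decide) (by decide)) γ₀₂₃ := by
  let a {i j : Fin 4} (h : i < j) : P.cat (edge s (i := i) (j := j) h.le) :=
    finFourLtCases (motive := fun i j h => P.cat (edge s (i := i) (j := j) h.le))
      a₀₁ a₁₂ a₂₃ a₀₂ a₁₃ a₀₃ h
  let γ {i j k : Fin 4} (h : i < j) (h' : j < k) :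
      (P.mulAt s (i := i) (j := j) (k := k) h.le h'.le).obj (a h', a h) ⟶ a (h.trans h') :=
    finFourLtLtCases (motive := fun i j k h h' =>
      (P.mulAt s (i := i) (j := j) (k := k) h.le h'.le).obj (a h', a h) ⟶ a (h.trans h'))
      γ₀₁₂ γ₁₂₃ γ₀₁₃ γ₀₂₃ h h'
  have hc {i j k l : Fin 4} (hij : i < j) (hjk : j < k) (hkl : k < l) :
    (P.mulAt s (i := i) (j := j) (k := l) hij.le (hjk.trans hkl).le).map
        (Prod.mkHom (γ hjk hkl) (𝟙 (a hij))) ≫ γ hij (hjk.trans hkl) ~ₕ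
    (P.mulAt s (i := i) (j := k) (k := l) (hij.trans hjk).le hkl.le).map
        (Prod.mkHom (𝟙 (a hkl)) (γ hij hjk)) ≫ γ (hij.trans hjk) hkl := by
    obtain ⟨rfl, rfl, rfl, rfl⟩ := fin_four_eq_of_lt_of_lt_of_lt hij hjk hkl
    exact cocycle
  refine ⟨ofLT s a γ hc, rfl, ⟨?_, ?_, ?_, ?_, ?_, ?_⟩, ?_, ?_, ?_⟩
  · exact heq_of_eq (ofLT_a s a γ hc (i := 0) (j := 1) (by decide))
  · exact heq_of_eq (ofLT_a s a γ hc (i := 1) (j := 2) (by decide))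
  · exact heq_of_eq (ofLT_a s a γ hc (i := 2) (j := 3) (by decide))
  · exact heq_of_eq (ofLT_a s a γ hc (i := 0) (j := 2) (by decide))
  · exact heq_of_eq (ofLT_a s a γ hc (i := 1) (j := 3) (by decide))
  · exact heq_of_eq (ofLT_a s a γ hc (i := 0) (j := 3) (by decide))
  · exact ofLT_γ s a γ hc (i := 0) (j := 1) (k := 2) (by decide) (by decide)
  · exact ofLT_γ s a γ hc (i := 1) (j := 2) (k := 3) (by decide) (by decide)
  · exact ofLT_γ s a γ hc (i := 0) (j := 2) (k := 3) (by decide) (by decide)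

theorem exists_obj_of_map {d d' : SimplexCategory} (S : GrothendieckSimplex P d') {θ : d' ⟶ d}
    {s : X.obj (op d)} (hb : S.base = X.map θ.op s) {i j : Fin (d'.len + 1)} (h : i ≤ j)
    {i' j' : Fin (d.len + 1)} (hi : θ.toOrderHom i = i') (hj : θ.toOrderHom j = j')
    (h' : i' ≤ j') : ∃ x : P.cat (edge s h'), x ≍ S.a h :=
  ⟨S.obj h (edge_eq_of_map hb h hi hj h'), obj_heq _ _ _⟩

theorem exists_hom_of_map {d d' : SimplexCategory} (S : GrothendieckSimplex P d') {θ : d' ⟶ d}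
    {s : X.obj (op d)} (hb : S.base = X.map θ.op s) {i j k : Fin (d'.len + 1)} (hij : i ≤ j)
    (hjk : j ≤ k) {i' j' k' : Fin (d.len + 1)} (hi : θ.toOrderHom i = i')
    (hj : θ.toOrderHom j = j') (hk : θ.toOrderHom k = k') (hij' : i' ≤ j') (hjk' : j' ≤ k')
    {x : P.cat (edge s hij')} {y : P.cat (edge s hjk')} {z : P.cat (edge s (hij'.trans hjk'))}
    (hx : x ≍ S.a hij) (hy : y ≍ S.a hjk) (hz : z ≍ S.a (hij.trans hjk)) :
    ∃ u : (P.mulAt s hij' hjk').obj (y, x) ⟶ z, P.Same u (S.γ hij hjk) :=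
  CategoricalOperad.Same.exists_of_heq (edge_eq_of_map hb _ hi hk _).symm _
    (P.mul_obj_heq (triangle_eq_of_map hb hij hjk hi hj hk _ _).symm _ _ _ _ _ _ hy hx) hz

/-- Compatible faces `0`, `1` and `3`, the first of which is strict, have a filler over a given
`3`-simplex of the base: its edges and all its triangles but `013` lie in these faces, and the
cocycle condition determines the remaining map. -/
theorem exists_of_faces {t g k : GrothendieckSimplex P ⦋2⦌} {s : X _⦋3⦌}
    (hbt : t.base = X.δ 0 s) (hbg : g.base = X.δ 1 s) (hbk : k.base = X.δ 3 s)
    (hgt : g.restrict (SimplexCategory.δ 0) = t.restrict (SimplexCategory.δ 0))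
    (hkt : k.restrict (SimplexCategory.δ 0) = t.restrict (SimplexCategory.δ 2))
    (hkg : k.restrict (SimplexCategory.δ 1) = g.restrict (SimplexCategory.δ 2))
    (ht : t.IsStrict) :
    ∃ T : GrothendieckSimplex P ⦋3⦌, T.base = s ∧ T.restrict (SimplexCategory.δ 0) = t ∧
      T.restrict (SimplexCategory.δ 1) = g ∧ T.restrict (SimplexCategory.δ 3) = k := by
  obtain ⟨a₀₁, e₀₁⟩ := exists_obj_of_map (θ := SimplexCategory.δ 3) (i := 0) (j := 1)
    (i' := 0) (j' := 1) k hbk (by decide) rfl rfl (by decide)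
  obtain ⟨a₁₂, e₁₂⟩ := exists_obj_of_map (θ := SimplexCategory.δ 3) (i := 1) (j := 2)
    (i' := 1) (j' := 2) k hbk (by decide) rfl rfl (by decide)
  obtain ⟨a₀₂, e₀₂⟩ := exists_obj_of_map (θ := SimplexCategory.δ 3) (i := 0) (j := 2)
    (i' := 0) (j' := 2) k hbk (by decide) rfl rfl (by decide)
  obtain ⟨a₂₃, e₂₃⟩ := exists_obj_of_map (θ := SimplexCategory.δ 0) (i := 1) (j := 2)
    (i' := 2) (j' := 3) t hbt (by decide) rfl rfl (by decide)
  obtain ⟨a₁₃, e₁₃⟩ := exists_obj_of_map (θ := SimplexCategory.δ 0) (i := 0) (j := 2)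
    (i' := 1) (j' := 3) t hbt (by decide) rfl rfl (by decide)
  obtain ⟨a₀₃, e₀₃⟩ := exists_obj_of_map (θ := SimplexCategory.δ 1) (i := 0) (j := 2)
    (i' := 0) (j' := 3) g hbg (by decide) rfl rfl (by decide)
  have e₁₂' : a₁₂ ≍ t.a (i := 0) (j := 1) (by decide) := e₁₂.trans
    ((a_heq_of_restrict hkt (i := 0) (j := 1) (by decide) rfl rfl _).trans
      (a_heq_of_restrict rfl (i := 0) (j := 1) (by decide) rfl rfl _).symm)
  have e₂₃' : a₂₃ ≍ g.a (i := 1) (j := 2) (by decide) := e₂₃.trans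
    ((a_heq_of_restrict hgt (i := 0) (j := 1) (by decide) rfl rfl _).trans
      (a_heq_of_restrict rfl (i := 0) (j := 1) (by decide) rfl rfl _).symm).symm
  have e₀₂' : a₀₂ ≍ g.a (i := 0) (j := 1) (by decide) := e₀₂.trans
    ((a_heq_of_restrict hkg (i := 0) (j := 1) (by decide) rfl rfl _).trans
      (a_heq_of_restrict rfl (i := 0) (j := 1) (by decide) rfl rfl _).symm)
  obtain ⟨γ₀₁₂, h₀₁₂⟩ := exists_hom_of_map (θ := SimplexCategory.δ 3) (i := 0) (j := 1) (k := 2)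
    (i' := 0) (j' := 1) (k' := 2) k hbk (by decide) (by decide) rfl rfl rfl
    (by decide) (by decide) e₀₁ e₁₂ e₀₂
  obtain ⟨γ₁₂₃, h₁₂₃⟩ := exists_hom_of_map (θ := SimplexCategory.δ 0) (i := 0) (j := 1) (k := 2)
    (i' := 1) (j' := 2) (k' := 3) t hbt (by decide) (by decide) rfl rfl rfl
    (by decide) (by decide) e₁₂' e₂₃ e₁₃
  obtain ⟨γ₀₂₃, h₀₂₃⟩ := exists_hom_of_map (θ := SimplexCategory.δ 1) (i := 0) (j := 1) (k := 2)
    (i' := 0) (j' := 2) (k' := 3) g hbg (by decide) (by decide) rfl rfl rfl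
    (by decide) (by decide) e₀₂' e₂₃' e₀₃
  have hid : γ₁₂₃ ~ₕ 𝟙 a₁₃ := h₁₂₃.homEq_id ht
  have assoc : (P.mulAt s (i := 0) (j := 1) (k := 3) (by decide) (by decide)).obj (a₁₃, a₀₁) =
      (P.mulAt s (i := 0) (j := 2) (k := 3) (by decide) (by decide)).obj
        (a₂₃, (P.mulAt s (i := 0) (j := 1) (k := 2) (by decide) (by decide)).obj (a₁₂, a₀₁)) :=
    (congrArg (fun c => (P.mulAt s (i := 0) (j := 1) (k := 3) (by decide) (by decide)).obj
      (c, a₀₁)) hid.left.symm).trans (Functor.congr_obj (P.mulAt_assoc s (i := 0) (j := 1)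
        (k := 2) (l := 3) (by decide) (by decide) (by decide)) ((a₂₃, a₁₂), a₀₁))
  -- The map `γ₀₁₃` is defined by the cocycle condition, in which `γ₁₂₃` is an identity.
  obtain ⟨T, hb, ⟨h₀₁, h₁₂, h₂₃, h₀₂, h₁₃, h₀₃⟩, h₀₁₂', h₁₂₃', h₀₂₃'⟩ := exists_three γ₀₁₂ γ₁₂₃
    (eqToHom assoc ≫ (P.mulAt s (i := 0) (j := 2) (k := 3) (by decide) (by decide)).map
      (Prod.mkHom (𝟙 a₂₃) γ₀₁₂) ≫ γ₀₂₃) γ₀₂₃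
    (HomEq.id_comp (((hid.prodMk .rfl).map _).trans
      (.of_eq ((P.mulAt s (i := 0) (j := 1) (k := 3) (by decide) (by decide)).map_id _)))
        (HomEq.eqToHom_comp assoc _))
  refine ⟨T, hb, ?_, ?_, ?_⟩
  · refine ext_of_lt ((congrArg _ hb).trans hbt.symm) (fun h => finThreeLtCases ?_ ?_ ?_ h)
      (fun h h' => finThreeLtLtCases ?_ h h')
    · exact (a_heq_of_restrict rfl (i := 0) (j := 1) (by decide) rfl rfl _).symm.trans
        (h₁₂.trans e₁₂')
    · exact (a_heq_of_restrict rfl (i := 1) (j := 2) (by decide) rfl rfl _).symm.trans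
        (h₂₃.trans e₂₃)
    · exact (a_heq_of_restrict rfl (i := 0) (j := 2) (by decide) rfl rfl _).symm.trans
        (h₁₃.trans e₁₃)
    · exact ((γ_same_of_restrict rfl (i := 0) (j := 1) (k := 2) (by decide) (by decide) rfl rfl
        rfl _ _).symm.trans (h₁₂₃'.trans h₁₂₃)).heq
  · refine ext_of_lt ((congrArg _ hb).trans hbg.symm) (fun h => finThreeLtCases ?_ ?_ ?_ h)
      (fun h h' => finThreeLtLtCases ?_ h h')
    · exact (a_heq_of_restrict rfl (i := 0) (j := 1) (by decide) rfl rfl _).symm.trans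
        (h₀₂.trans e₀₂')
    · exact (a_heq_of_restrict rfl (i := 1) (j := 2) (by decide) rfl rfl _).symm.trans
        (h₂₃.trans e₂₃')
    · exact (a_heq_of_restrict rfl (i := 0) (j := 2) (by decide) rfl rfl _).symm.trans
        (h₀₃.trans e₀₃)
    · exact ((γ_same_of_restrict rfl (i := 0) (j := 1) (k := 2) (by decide) (by decide) rfl rfl
        rfl _ _).symm.trans (h₀₂₃'.trans h₀₂₃)).heq
  · refine ext_of_lt ((congrArg _ hb).trans hbk.symm) (fun h => finThreeLtCases ?_ ?_ ?_ h)
      (fun h h' => finThreeLtLtCases ?_ h h')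
    · exact (a_heq_of_restrict rfl (i := 0) (j := 1) (by decide) rfl rfl _).symm.trans
        (h₀₁.trans e₀₁)
    · exact (a_heq_of_restrict rfl (i := 1) (j := 2) (by decide) rfl rfl _).symm.trans
        (h₁₂.trans e₁₂)
    · exact (a_heq_of_restrict rfl (i := 0) (j := 2) (by decide) rfl rfl _).symm.trans
        (h₀₂.trans e₀₂)
    · exact ((γ_same_of_restrict rfl (i := 0) (j := 1) (k := 2) (by decide) (by decide) rfl rfl
        rfl _ _).symm.trans (h₀₁₂'.trans h₀₁₂)).heq

end GrothendieckSimplex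

/-! ### The canonical splitting -/

namespace IsCanonicalLift

open GrothendieckSimplex

variable {X : SSet.{u}} {P : CategoricalOperad X} {A B : GrothendieckSimplex P ⦋1⦌}
  {f : X _⦋2⦌} {t t' : GrothendieckSimplex P ⦋2⦌}

theorem of_isStrict (hb : t.base = f)
    (h₁₂ : t.a (i := 1) (j := 2) (by decide) ≍ A.a (i := 0) (j := 1) (by decide))
    (h₀₁ : t.a (i := 0) (j := 1) (by decide) ≍ B.a (i := 0) (j := 1) (by decide))
    (ht : t.IsStrict) : IsCanonicalLift A B f t where
  base_eq := hb
  target_eq := h₁₂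
  fiber_eq := h₀₁
  source_eq := ht.left
  hom_eq := (ht.trans (HomEq.eqToHom ht.left).symm).eq

theorem isStrict (h : IsCanonicalLift A B f t) : t.IsStrict :=
  (HomEq.of_eq h.hom_eq).trans (.eqToHom _)

/-- The lift `(f, b, 𝟙)` is determined by its target, its fiber and `f`. -/
theorem unique (h : IsCanonicalLift A B f t) (h' : IsCanonicalLift A B f t') : t = t' := by
  have hb := h.base_eq.trans h'.base_eq.symm
  have h₀₁ := h.fiber_eq.trans h'.fiber_eq.symm
  have h₁₂ := h.target_eq.trans h'.target_eq.symm
  have h₀₂ : t.a (i := 0) (j := 2) (by decide) ≍ t'.a (i := 0) (j := 2) (by decide) :=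
    (heq_of_eq h.source_eq).symm.trans ((P.mul_obj_heq (by rw [hb]) _ _ _ _ _ _ h₁₂ h₀₁).trans
      (heq_of_eq h'.source_eq))
  refine ext_of_lt hb (finThreeLtCases h₀₁ h₁₂ h₀₂) (finThreeLtLtCases ?_)
  exact ((CategoricalOperad.Same.of_homEq h.isStrict).trans ((CategoricalOperad.Same.id
    (by rw [hb]) h₀₂).trans (CategoricalOperad.Same.of_homEq h'.isStrict).symm)).heq

theorem eq_of_a_heq {S S' : GrothendieckSimplex P ⦋1⦌} (hb : S.base = S'.base)
    (ha : S.a (i := 0) (j := 1) (by decide) ≍ S'.a (i := 0) (j := 1) (by decide)) : S = S' :=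
  ext_of_lt hb (finTwoLtCases ha) fun h h' =>
    absurd ((fin_two_eq_of_lt h).2.symm.trans (fin_two_eq_of_lt h').1) (by decide)

theorem restrict_δ_zero (h : IsCanonicalLift A B f t) (h₀ : X.δ 0 f = A.base) :
    t.restrict (SimplexCategory.δ 0) = A :=
  eq_of_a_heq ((congrArg _ h.base_eq).trans h₀)
    ((a_heq_of_restrict rfl (i := 0) (j := 1) (by decide) rfl rfl _).symm.trans h.target_eq)

theorem restrict_δ_two (h : IsCanonicalLift A B f t) (h₂ : X.δ 2 f = B.base) :
    t.restrict (SimplexCategory.δ 2) = B :=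
  eq_of_a_heq ((congrArg _ h.base_eq).trans h₂)
    ((a_heq_of_restrict rfl (i := 0) (j := 1) (by decide) rfl rfl _).symm.trans h.fiber_eq)

end IsCanonicalLift

namespace GrothendieckSimplex

variable {X : SSet.{u}} {P : CategoricalOperad X}

theorem IsStrict.isOperadicCartesian {t : GrothendieckSimplex P ⦋2⦌} (ht : t.IsStrict) :
    IsOperadicCartesian P.proj t := by
  refine isOperadicCartesian_of_faces (X := P.grothendieck) fun g k s hbt hbg hbk hgt hkt hkg => ?_
  obtain ⟨T, hb, h₀, h₁, h₃⟩ := exists_of_faces hbt hbg hbk hgt hkt hkg ht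
  exact ⟨T, ⟨hb, h₀, h₁, h₃⟩, fun T' h' =>
    eq_of_faces (h'.1.trans hb.symm) h'.2.1 h'.2.2.1 h'.2.2.2 h₀ h₁ h₃ ht⟩

/-- If the faces `0`, `1` and `3` of a `3`-simplex are strict, then so is the face `2`. -/
theorem γ₀₁₃_homEq_id {T : GrothendieckSimplex P ⦋3⦌} {t g k : GrothendieckSimplex P ⦋2⦌}
    (h₀ : T.restrict (SimplexCategory.δ 0) = t) (h₁ : T.restrict (SimplexCategory.δ 1) = g)
    (h₃ : T.restrict (SimplexCategory.δ 3) = k) (ht : t.IsStrict) (hg : g.IsStrict)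
    (hk : k.IsStrict) : T.γ (i := 0) (j := 1) (k := 3) (by decide) (by decide) ~ₕ
      𝟙 (T.a (i := 0) (j := 3) (by decide)) := by
  have h₀₁₂ := (γ_same_of_restrict h₃ (i := 0) (j := 1) (k := 2) (i' := 0) (j' := 1) (k' := 2)
    (by decide) (by decide) rfl rfl rfl (by decide) (by decide)).homEq_id hk
  have h₀₂₃ := (γ_same_of_restrict h₁ (i := 0) (j := 1) (k := 2) (i' := 0) (j' := 2) (k' := 3)
    (by decide) (by decide) rfl rfl rfl (by decide) (by decide)).homEq_id hg
  exact (T.γ_homEq_of_id (i := 0) (j := 1) (k := 2) (l := 3) (by decide) (by decide) (by decide)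
    (γ₁₂₃_homEq_id h₀ ht)).trans (.id_comp (((HomEq.rfl.prodMk h₀₁₂).map _).trans
      (.of_eq ((P.mulAt T.base (i := 0) (j := 2) (k := 3) (by decide) (by decide)).map_id _)))
        h₀₂₃)

theorem exists_isCanonicalLift (A B : GrothendieckSimplex P ⦋1⦌) (f : X _⦋2⦌)
    (h₀ : X.δ 0 f = A.base) (h₂ : X.δ 2 f = B.base) : ∃ t, IsCanonicalLift A B f t := by
  obtain ⟨a₁₂, e₁₂⟩ := exists_obj_of_map (θ := SimplexCategory.δ 0) (i := 0) (j := 1) (i' := 1)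
    (j' := 2) A h₀.symm (by decide) rfl rfl (by decide)
  obtain ⟨a₀₁, e₀₁⟩ := exists_obj_of_map (θ := SimplexCategory.δ 2) (i := 0) (j := 1) (i' := 0)
    (j' := 1) B h₂.symm (by decide) rfl rfl (by decide)
  let a₀₂ := (P.mulAt f (i := 0) (j := 1) (k := 2) (by decide) (by decide)).obj (a₁₂, a₀₁)
  let a {i j : Fin 3} (h : i < j) : P.cat (edge f (i := i) (j := j) h.le) :=
    finThreeLtCases (motive := fun i j h => P.cat (edge f (i := i) (j := j) h.le)) a₀₁ a₁₂ a₀₂ h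
  let γ {i j k : Fin 3} (h : i < j) (h' : j < k) :
      (P.mulAt f (i := i) (j := j) (k := k) h.le h'.le).obj (a h', a h) ⟶ a (h.trans h') :=
    finThreeLtLtCases (motive := fun i j k h h' =>
      (P.mulAt f (i := i) (j := j) (k := k) h.le h'.le).obj (a h', a h) ⟶ a (h.trans h'))
      (𝟙 a₀₂) h h'
  have hc {i j k l : Fin 3} (hij : i < j) (hjk : j < k) (hkl : k < l) :
      (P.mulAt f (i := i) (j := j) (k := l) hij.le (hjk.trans hkl).le).map
          (Prod.mkHom (γ hjk hkl) (𝟙 (a hij))) ≫ γ hij (hjk.trans hkl) ~ₕ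
      (P.mulAt f (i := i) (j := k) (k := l) (hij.trans hjk).le hkl.le).map
          (Prod.mkHom (𝟙 (a hkl)) (γ hij hjk)) ≫ γ (hij.trans hjk) hkl :=
    absurd hkl (by
      have := fin_three_eq_of_lt_of_lt hij hjk
      omega)
  exact ⟨ofLT f a γ hc, .of_isStrict rfl
    ((heq_of_eq (ofLT_a f a γ hc (i := 1) (j := 2) (by decide))).trans e₁₂)
    ((heq_of_eq (ofLT_a f a γ hc (i := 0) (j := 1) (by decide))).trans e₀₁)
    (((ofLT_γ f a γ hc (i := 0) (j := 1) (k := 2) (by decide) (by decide)).homEq).trans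
      (.id (ofLT_a f a γ hc (i := 0) (j := 2) (by decide)).symm))⟩

end GrothendieckSimplex

namespace CategoricalOperad

open GrothendieckSimplex

variable {X : SSet.{u}} (P : CategoricalOperad X)

theorem isCartesianLift_of_isCanonicalLift {A B : GrothendieckSimplex P ⦋1⦌} {f : X _⦋2⦌}
    {t : GrothendieckSimplex P ⦋2⦌} (h : IsCanonicalLift A B f t) (h₀ : X.δ 0 f = A.base)
    (h₂ : X.δ 2 f = B.base) : IsCartesianLift P.proj A B f t where
  map_eq := h.base_eq
  target_eq := h.restrict_δ_zero h₀
  fiber_eq := h.restrict_δ_two h₂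
  cartesian := h.isStrict.isOperadicCartesian

/-- The canonical lift `(f, b, 𝟙)`, chosen by its characterization, which determines it uniquely. -/
noncomputable def canonicalLift : LiftChoice P.proj := fun A B f h₀ h₂ =>
  (exists_isCanonicalLift A B f h₀ h₂).choose

theorem isCanonicalLift_canonicalLift (A B : P.grothendieck _⦋1⦌) (f : X _⦋2⦌)
    (h₀ : X.δ 0 f = P.proj.app (op ⦋1⦌) A) (h₂ : X.δ 2 f = P.proj.app (op ⦋1⦌) B) :
    IsCanonicalLift A B f (P.canonicalLift A B f h₀ h₂) :=
  (exists_isCanonicalLift A B f h₀ h₂).choose_spec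

theorem isSplitting_canonicalLift : IsSplitting P.proj P.canonicalLift where
  isLift A B f h₀ h₂ :=
    P.isCartesianLift_of_isCanonicalLift (P.isCanonicalLift_canonicalLift A B f h₀ h₂) h₀ h₂
  -- Degenerate triangles are strict, so they are canonical lifts.
  lift_trivial x h₀ h₂ := by
    refine (P.isCanonicalLift_canonicalLift _ _ _ h₀ h₂).unique
      (.of_isStrict (t := x.restrict (SimplexCategory.σ 1)) rfl ?_ ?_ ?_)
    · exact (a_heq_of_restrict rfl (i := 1) (j := 2) (i' := 1) (j' := 1) (by decide) rfl rfl
        (le_refl _)).symm.trans ((a_heq_of_restrict (S := x)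
          (S' := x.restrict (SimplexCategory.δ 0)) rfl (i := 0) (j := 0) (le_refl _) rfl rfl
            _).trans (a_heq_of_restrict (S := x.restrict (SimplexCategory.δ 0)) rfl (i := 0)
              (j := 1) (i' := 0) (j' := 0) (by decide) rfl rfl _))
    · exact (a_heq_of_restrict rfl (i := 0) (j := 1) (by decide) rfl rfl _).symm
    · exact (γ_same_of_restrict rfl (i := 0) (j := 1) (k := 2) (i' := 0) (j' := 1) (k' := 1)
        (by decide) (by decide) rfl rfl rfl (by decide) (le_refl _)).symm.homEq_id
          (hom_refl_right x _ rfl _ _ _ rfl rfl rfl)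
  lift_identity x h₀ h₂ := by
    refine (P.isCanonicalLift_canonicalLift _ _ _ h₀ h₂).unique
      (.of_isStrict (t := x.restrict (SimplexCategory.σ 0)) rfl ?_ ?_ ?_)
    · exact (a_heq_of_restrict rfl (i := 1) (j := 2) (by decide) rfl rfl _).symm
    · exact (a_heq_of_restrict rfl (i := 0) (j := 1) (i' := 0) (j' := 0) (by decide) rfl rfl
        (le_refl _)).symm.trans ((a_heq_of_restrict (S := x)
          (S' := x.restrict (SimplexCategory.δ 1)) rfl (i := 0) (j := 0) (le_refl _) rfl rfl
            _).trans (a_heq_of_restrict (S := x.restrict (SimplexCategory.δ 1)) rfl (i := 0)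
              (j := 1) (i' := 0) (j' := 0) (by decide) rfl rfl _))
    · exact (γ_same_of_restrict rfl (i := 0) (j := 1) (k := 2) (i' := 0) (j' := 0) (k' := 1)
        (by decide) (by decide) rfl rfl rfl (le_refl _) (by decide)).symm.homEq_id
          (hom_refl_left x _ rfl _ _ _ rfl rfl rfl)
  lift_assoc s x y z hz hy hy' hx hzy hx' hz' hyx := by
    have ht := P.isCanonicalLift_canonicalLift z y _ hz hy
    have hk := P.isCanonicalLift_canonicalLift y x _ hy' hx
    have hg := P.isCanonicalLift_canonicalLift z _ _ hz' hyx
    obtain ⟨T, hb, h₀, h₁, h₃⟩ := exists_of_faces ht.base_eq hg.base_eq hk.base_eq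
      ((hg.restrict_δ_zero hz').trans (ht.restrict_δ_zero hz).symm)
      ((hk.restrict_δ_zero hy').trans (ht.restrict_δ_two hy).symm)
      (hg.restrict_δ_two hyx).symm ht.isStrict
    -- The face `2` of the filler is strict, so it is the canonical lift.
    have h₂ : T.restrict (SimplexCategory.δ 2) = P.canonicalLift _ x _ hzy hx' := by
      refine IsCanonicalLift.unique (.of_isStrict (congrArg (X.δ 2) hb) ?_ ?_ ?_)
        (P.isCanonicalLift_canonicalLift _ x _ hzy hx')
      · exact (a_heq_of_restrict rfl (i := 1) (j := 2) (i' := 1) (j' := 3) (by decide) rfl rfl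
          (by decide)).symm.trans ((a_heq_of_restrict h₀ (i := 0) (j := 2) (by decide) rfl rfl
            _).trans (a_heq_of_restrict rfl (i := 0) (j := 1) (i' := 0) (j' := 2) (by decide) rfl
              rfl _))
      · exact (a_heq_of_restrict rfl (i := 0) (j := 1) (i' := 0) (j' := 1) (by decide) rfl rfl
          (by decide)).symm.trans ((a_heq_of_restrict h₃ (i := 0) (j := 1) (by decide) rfl rfl
            _).trans hk.fiber_eq)
      · exact (γ_same_of_restrict rfl (i := 0) (j := 1) (k := 2) (i' := 0) (j' := 1) (k' := 3)
          (by decide) (by decide) rfl rfl rfl (by decide) (by decide)).symm.homEq_id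
            (γ₀₁₃_homEq_id h₀ h₁ h₃ ht.isStrict hg.isStrict hk.isStrict)
    refine ⟨?_, T, hb, h₀, h₁, h₂, h₃⟩
    rw [← h₂, ← h₁]
    exact SSet.δ_comp_δ_apply (S := P.grothendieck) (i := (1 : Fin 3)) (j := 1) (by decide) T

theorem mapπ₀_decMap_proj_surjective :
    Function.Surjective (SSet.mapπ₀ (decMap P.proj)) := by
  intro q
  induction q with
  | mk x =>
    -- The object `x` is connected to `s₀ d₀ x` by the map `s₁ x`, and `s₀ d₀ x` lies in the image
    -- because `d₀ x` lifts to the `0`-simplex without decorations.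
    let c : X _⦋0⦌ := X.δ (n := 0) 0 x
    let S : GrothendieckSimplex P ⦋0⦌ := ofLT c
      (fun h => absurd (Subsingleton.elim (α := Fin 1) _ _) h.ne)
      (fun h _ => absurd (Subsingleton.elim (α := Fin 1) _ _) h.ne)
      (fun h _ _ => absurd (Subsingleton.elim (α := Fin 1) _ _) h.ne)
    refine ⟨SSet.π₀.mk (X := dec P.grothendieck) (S.restrict (SimplexCategory.σ 0)), ?_⟩
    refine (SSet.π₀.sound (X := dec X) (.mk (X.σ (n := 1) 1 x) ?_ ?_)).symm
    · change X.map (addTop.map (SimplexCategory.δ 1)).op (X.σ (n := 1) 1 x) = x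
      rw [addTop_map_δ]
      exact SSet.δ_comp_σ_self_apply (i := (1 : Fin 2)) x
    · change X.map (addTop.map (SimplexCategory.δ 0)).op (X.σ (n := 1) 1 x) = X.σ (n := 0) 0 c
      rw [addTop_map_δ]
      exact δ_zero_σ_one x

theorem isOperadicFibration_proj : IsOperadicFibration P.proj where
  surjective := P.mapπ₀_decMap_proj_surjective
  exists_lift A B f h₀ h₂ := ⟨_, P.isSplitting_canonicalLift.isLift A B f h₀ h₂⟩

end CategoricalOperad

theorem mainTheorem4 {X : SSet.{u}} (O : UnaryOperadicStructure X) (P : CategoricalOperad X) :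
    Nonempty (UnaryOperadicStructure P.grothendieck) ∧
    IsOperadicFibration P.proj ∧
    ∃ ℓ : LiftChoice P.proj, IsSplitting P.proj ℓ ∧
      ∀ (A B : P.grothendieck _⦋1⦌) (f : X _⦋2⦌) (h₀ : X.δ 0 f = P.proj.app (op ⦋1⦌) A)
        (h₂ : X.δ 2 f = P.proj.app (op ⦋1⦌) B), IsCanonicalLift A B f (ℓ A B f h₀ h₂) :=
  ⟨⟨O.grothendieck P⟩, P.isOperadicFibration_proj, P.canonicalLift, P.isSplitting_canonicalLift,
    P.isCanonicalLift_canonicalLift⟩
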